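/- Let $\kappa,D>0$. For an open triangle $T\subset\mathbb{R}^2$ (with non-collinear vertices) let $$H(\nabla\mathrm{div},T):=\{\boldsymbol v\in L_2(T)^2;\ \nabla\mathrm{div}\,\boldsymbol v\in L_2(T)^2\}\ \text{(in the sense of distributions)},\qquad \|\boldsymbol v\|_{\nabla\mathrm{div},T}^2:=\|\boldsymbol v\|_{L_2(T)}^2+\|\nabla\mathrm{div}\,\boldsymbol v\|_{L_2(T)}^2 .$$ Let $(\cdot,\cdot)_T$ be the $L_2(T)^2$ inner product, $P^p(T)$ the space of polynomials on $T$ of total degree at most $p$, $P^0(\partial T)$ the functions that are constant on each edge of $T$, and $P^{1,c}(\partial T)$ the continuous functions on $\partial T$ that are polynomials of degree at most one on each edge. For $\boldsymbol u\in H(\nabla\mathrm{div},T)$, its $\nabla\mathrm{div}$-trace is the pair $(\boldsymbol u\cdot\boldsymbol n|_{\partial T},(\mathrm{div}\,\boldsymbol u)|_{\partial T})$, where $\boldsymbol n$ is the exterior unit normal and the traces are understood in the sense of integration by parts. The duality of this trace $\widehat{\boldsymbol u}$ with $\boldsymbol v\in H(\nabla\mathrm{div},T)$ is $$\langle\widehat{\boldsymbol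 u},\boldsymbol v\rangle_{\partial T}:=(\boldsymbol u,\nabla\mathrm{div}\,\boldsymbol v)_T-(\nabla\mathrm{div}\,\boldsymbol u,\boldsymbol v)_T .$$ Then there is a constant $C>0$, depending only on $\kappa$ and $D$, such that for every triangle $T$ with $\mathrm{diam}(T)^2/|T|\le\kappa$ and $\mathrm{diam}(T)\le D$ there is a linear operator $\Pi_T:\ H(\nabla\mathrm{div},T)\to P^3(T)^2$ with the following properties. 1. For all $\boldsymbol w\in P^0(T)^2$ and $\boldsymbol v\in H(\nabla\mathrm{div},T)$, $$(\boldsymbol w,(1-\Pi_T)\boldsymbol v)_T=0\quad\text{and}\quad(\boldsymbol w,\nabla\mathrm{div}(1-\Pi_T)\boldsymbol v)_T=0 .$$ 2. Every $\widehat{\boldsymbol w}\in P^0(\partial T)\times P^{1,c}(\partial T)$ is the $\nabla\mathrm{div}$-trace $\widehat{\boldsymbol u}$ of some $\boldsymbol u\in H(\nabla\mathrm{div},T)$, and, for every such $\boldsymbol u$, $$\langle\widehat{\boldsymbol w},(1-\Pi_T)\boldsymbol v\rangle_{\partial T}=\langle\widehat{\boldsymbol u},(1-\Pi_T)\boldsymbol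 v\rangle_{\partial T}=0\qquad\text{for all }\boldsymbol v\in H(\nabla\mathrm{div},T).$$ 3. For all $\boldsymbol v\in H(\nabla\mathrm{div},T)$, $$\|\Pi_T\boldsymbol v\|_{\nabla\mathrm{div},T}\le C\,\|\boldsymbol v\|_{\nabla\mathrm{div},T}.$$ -/

import Mathlib

open MeasureTheory Set
open scoped ContDiff RealInnerProductSpace

namespace GradDivFortin

noncomputable section

/-- The Euclidean plane. -/
abbrev Plane := EuclideanSpace ℝ (Fin 2)

/-! ### Classical differential operators and test functions -/

/-- The classical divergence of a (smooth) vector field. -/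
def divergence (φ : Plane → Plane) (x : Plane) : ℝ :=
  ∑ i, (fderiv ℝ φ x (EuclideanSpace.single i 1)) i

/-- The classical operator `∇ div` on (smooth) vector fields. -/
def classicalGradDiv (φ : Plane → Plane) (x : Plane) : Plane :=
  gradient (divergence φ) x

/-- `φ` is an infinitely differentiable function with compact support contained in `K`. -/
structure IsTest {F : Type*} [NormedAddCommGroup F] [NormedSpace ℝ F]
    (K : Set Plane) (φ : Plane → F) : Prop where
  smooth : ContDiff ℝ ∞ φ
  compact : HasCompactSupport φ
  subset : tsupport φ ⊆ K

/-! ### Lebesgue spaces and weak derivatives -/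

/-- `L₂(K)`. -/
abbrev L2S (K : Set Plane) := Lp ℝ 2 (volume.restrict K)

/-- `L₂(K)²`. -/
abbrev L2V (K : Set Plane) := Lp Plane 2 (volume.restrict K)

/-- `d` is the weak divergence of `v` in `K`. -/
def IsWeakDiv (K : Set Plane) (v : L2V K) (d : L2S K) : Prop :=
  ∀ φ : Plane → ℝ, IsTest K φ →
    ∫ x in K, ⟪v x, gradient φ x⟫ = - ∫ x in K, d x * φ x

/-- `g` is the distribution `∇ div v` in `K`. -/
def IsWeakGradDiv (K : Set Plane) (v g : L2V K) : Prop :=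
  ∀ φ : Plane → Plane, IsTest K φ →
    ∫ x in K, ⟪v x, classicalGradDiv φ x⟫ = ∫ x in K, ⟪g x, φ x⟫

lemma IsTest.continuous_classicalGradDiv {K : Set Plane} {φ : Plane → Plane}
    (h : IsTest K φ) : Continuous (classicalGradDiv φ) := by
  have hd : ContDiff ℝ ∞ (divergence φ) := by
    unfold divergence
    refine ContDiff.sum fun i _ => ?_
    have h1 : ContDiff ℝ ∞ (fun x => fderiv ℝ φ x (EuclideanSpace.single i 1)) :=
      (h.smooth.fderiv_right (m := ∞) (by simp)).clm_apply contDiff_const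
    exact (EuclideanSpace.proj (𝕜 := ℝ) i).contDiff.comp h1
  unfold classicalGradDiv gradient
  exact (InnerProductSpace.toDual ℝ Plane).symm.continuous.comp
    (hd.continuous_fderiv (by simp))

lemma IsTest.compact_classicalGradDiv {K : Set Plane} {φ : Plane → Plane}
    (h : IsTest K φ) : HasCompactSupport (classicalGradDiv φ) := by
  have h1 : HasCompactSupport (divergence φ) := by
    refine (h.compact.fderiv (𝕜 := ℝ)).mono fun x hx => ?_
    contrapose! hx
    simp only [Function.mem_support, not_not] at hx ⊢
    simp [divergence, hx]
  refine (h1.fderiv (𝕜 := ℝ)).mono fun x hx => ?_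
  contrapose! hx
  simp only [Function.mem_support, not_not] at hx ⊢
  simp [classicalGradDiv, gradient, hx]

lemma integrable_inner_of_compact {K : Set Plane} (v : L2V K) {ψ : Plane → Plane}
    (hc : Continuous ψ) (hs : HasCompactSupport ψ) :
    Integrable (fun x => ⟪v x, ψ x⟫) (volume.restrict K) := by
  have hm : MemLp ψ 2 (volume.restrict K) := hc.memLp_of_hasCompactSupport hs
  refine (L2.integrable_inner (𝕜 := ℝ) v (hm.toLp ψ)).congr ?_
  filter_upwards [hm.coeFn_toLp] with x hx
  rw [hx]

lemma integral_inner_add {K : Set Plane} (v w : L2V K) {ψ : Plane → Plane}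
    (hc : Continuous ψ) (hs : HasCompactSupport ψ) :
    ∫ x in K, ⟪(v + w : L2V K) x, ψ x⟫ = (∫ x in K, ⟪v x, ψ x⟫) + ∫ x in K, ⟪w x, ψ x⟫ := by
  rw [← integral_add (integrable_inner_of_compact v hc hs) (integrable_inner_of_compact w hc hs)]
  refine integral_congr_ae ?_
  filter_upwards [Lp.coeFn_add v w] with x hx
  rw [hx, Pi.add_apply, inner_add_left]

lemma integral_inner_smul {K : Set Plane} (c : ℝ) (v : L2V K) (ψ : Plane → Plane) :
    ∫ x in K, ⟪(c • v : L2V K) x, ψ x⟫ = c * ∫ x in K, ⟪v x, ψ x⟫ := by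
  rw [← integral_const_mul]
  refine integral_congr_ae ?_
  filter_upwards [Lp.coeFn_smul c v] with x hx
  rw [hx, Pi.smul_apply, real_inner_smul_left]

lemma integral_inner_zero {K : Set Plane} (ψ : Plane → Plane) :
    ∫ x in K, ⟪(0 : L2V K) x, ψ x⟫ = 0 := by
  have := integral_inner_smul (K := K) 0 0 ψ
  simpa using this

/-- The space `H(∇div, K)` of all `v ∈ L₂(K)²` with `∇ div v ∈ L₂(K)²`. -/
def HGradDiv (K : Set Plane) : Submodule ℝ (L2V K) where
  carrier := {v | ∃ g, IsWeakGradDiv K v g}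
  zero_mem' := ⟨0, fun φ _ => by rw [integral_inner_zero, integral_inner_zero]⟩
  add_mem' := by
    rintro v w ⟨g, hg⟩ ⟨k, hk⟩
    refine ⟨g + k, fun φ hφ => ?_⟩
    rw [integral_inner_add _ _ hφ.continuous_classicalGradDiv hφ.compact_classicalGradDiv,
      integral_inner_add _ _ hφ.smooth.continuous hφ.compact, hg φ hφ, hk φ hφ]
  smul_mem' := by
    rintro c v ⟨g, hg⟩
    refine ⟨c • g, fun φ hφ => ?_⟩
    rw [integral_inner_smul, integral_inner_smul, hg φ hφ]

/-- The weak `∇ div v ∈ L₂(K)²` of `v ∈ H(∇div, K)`; it is unique when `K` is open,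
see `IsWeakGradDiv.unique`. -/
def gradDiv {K : Set Plane} (v : HGradDiv K) : L2V K := v.2.choose

lemma gradDiv_spec {K : Set Plane} (v : HGradDiv K) : IsWeakGradDiv K v (gradDiv v) :=
  v.2.choose_spec

lemma IsWeakGradDiv.unique {K : Set Plane} (hK : IsOpen K) {v g k : L2V K}
    (hg : IsWeakGradDiv K v g) (hk : IsWeakGradDiv K v k) : g = k := by
  have hloc : LocallyIntegrableOn (fun x => (g - k : L2V K) x) K volume :=
    locallyIntegrableOn_of_locallyIntegrable_restrict
      ((Lp.memLp (g - k)).locallyIntegrable (by norm_num))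
  have hz := hK.ae_eq_zero_of_integral_contDiff_smul_eq_zero hloc fun φ hφ hc hs => by
    have hzero : ∀ x, x ∉ K → φ x • (g - k : L2V K) x = 0 := fun x hx => by
      rw [image_eq_zero_of_notMem_tsupport fun h => hx (hs h), zero_smul]
    rw [← setIntegral_eq_integral_of_forall_compl_eq_zero hzero]
    have hI : Integrable (fun x => φ x • (g - k : L2V K) x) (volume.restrict K) :=
      memLp_one_iff_integrable.1 <| (Lp.memLp (g - k)).smul (p := 2)
        (hφ.continuous.memLp_of_hasCompactSupport hc)
    refine ext_inner_left ℝ fun e => ?_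
    have ht : IsTest K (fun x => φ x • e) :=
      ⟨hφ.smul contDiff_const, hc.smul_right, (tsupport_smul_subset_left φ _).trans hs⟩
    have h1 := integral_inner_add g ((-1 : ℝ) • k) ht.smooth.continuous ht.compact
    rw [integral_inner_smul, ← hg _ ht, ← hk _ ht, neg_one_smul, ← sub_eq_add_neg] at h1
    rw [← integral_inner hI e, inner_zero_right]
    simp only [real_inner_smul_right] at h1 ⊢
    simpa [real_inner_comm] using h1
  have hz' := (ae_restrict_iff' hK.measurableSet).2 hz
  rw [← sub_eq_zero]
  refine Lp.ext ?_
  filter_upwards [hz', Lp.coeFn_zero Plane 2 (volume.restrict K)] with x h1 h2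
  rw [h1, h2, Pi.zero_apply]

/-- The norm `‖v‖_{∇div, K}`. -/
def gradDivNorm {K : Set Plane} (v : HGradDiv K) : ℝ :=
  Real.sqrt (‖(v : L2V K)‖ ^ 2 + ‖gradDiv v‖ ^ 2)

/-- The duality `⟨tr(u), v⟩ = (u, ∇ div v) - (∇ div u, v)` between the `∇div`-trace of `u`
on the boundary of `K` and `v`. -/
def gradDivDuality {K : Set Plane} (u v : HGradDiv K) : ℝ :=
  ⟪(u : L2V K), gradDiv v⟫ - ⟪gradDiv u, (v : L2V K)⟫

/-! ### Polynomial spaces -/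

/-- `P^n(K)²`: fields whose two components are polynomials of (total) degree at most `n`. -/
def VecPoly (n : ℕ) (K : Set Plane) : Submodule ℝ (L2V K) where
  carrier := {v | ∃ p : Fin 2 → MvPolynomial (Fin 2) ℝ, (∀ i, (p i).totalDegree ≤ n) ∧
    ∀ᵐ x ∂(volume.restrict K), ∀ i, v x i = MvPolynomial.eval (fun j => x j) (p i)}
  zero_mem' := by
    refine ⟨0, by simp, ?_⟩
    filter_upwards [Lp.coeFn_zero Plane 2 (volume.restrict K)] with x hx i
    rw [hx]; simp
  add_mem' := by
    rintro v w ⟨p, hp, hv⟩ ⟨q, hq, hw⟩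
    refine ⟨p + q, fun i => (MvPolynomial.totalDegree_add _ _).trans (max_le (hp i) (hq i)), ?_⟩
    filter_upwards [Lp.coeFn_add v w, hv, hw] with x hx h1 h2 i
    rw [hx]; simp [h1 i, h2 i]
  smul_mem' := by
    rintro c v ⟨p, hp, hv⟩
    refine ⟨c • p, fun i => (MvPolynomial.totalDegree_smul_le _ _).trans (hp i), ?_⟩
    filter_upwards [Lp.coeFn_smul c v, hv] with x hx h1 i
    rw [hx]; simp [h1 i]

/-! ### Triangles and traces on their boundary -/

/-- The open triangle with the (affinely independent) vertices of `T`. -/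
def cell (T : Affine.Triangle ℝ Plane) : Set Plane :=
  interior (convexHull ℝ (Set.range T.points))

/-- Affine parametrization over `[0,1]` of the edge of `T` opposite to vertex `i`. -/
def edge (T : Affine.Triangle ℝ Plane) (i : Fin 3) (t : ℝ) : Plane :=
  AffineMap.lineMap (T.points (i + 1)) (T.points (i + 2)) t

/-- The arc-length integral of `f` over the edge of `T` opposite to vertex `i`. -/
def edgeIntegral (T : Affine.Triangle ℝ Plane) (i : Fin 3) (f : Plane → ℝ) : ℝ :=
  dist (T.points (i + 1)) (T.points (i + 2)) * ∫ t in (0 : ℝ)..1, f (edge T i t)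

/-- The exterior unit normal vector on the edge of `T` opposite to vertex `i`: the direction
from vertex `i` to its orthogonal projection onto the line that contains the edge. -/
def outerNormal (T : Affine.Triangle ℝ Plane) (i : Fin 3) : Plane :=
  (‖T.altitudeFoot i -ᵥ T.points i‖)⁻¹ • (T.altitudeFoot i -ᵥ T.points i)

/-- `P^{1,c}(∂T)`: `g` is continuous on `∂T` and a polynomial of degree at most one on each
edge. (Elements of `P⁰(∂T)` are given by their three values, as functions on `Fin 3`.) -/
def IsP1c (T : Affine.Triangle ℝ Plane) (g : Plane → ℝ) : Prop :=
  ContinuousOn g (frontier (cell T)) ∧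
    ∀ i : Fin 3, ∃ a b : ℝ, ∀ t ∈ Icc (0 : ℝ) 1, g (edge T i t) = a + b * t

/-- The normal trace `(u·n)|_{∂T}` of `u ∈ H(div, T)` with weak divergence `d` is equal to the
constant `g i` on the edge opposite to vertex `i`, for each `i`. -/
def HasNormalTrace (T : Affine.Triangle ℝ Plane) (u : L2V (cell T)) (d : L2S (cell T))
    (g : Fin 3 → ℝ) : Prop :=
  ∀ φ : Plane → ℝ, ContDiff ℝ ∞ φ →
    (∫ x in cell T, d x * φ x) + ∫ x in cell T, ⟪u x, gradient φ x⟫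
      = ∑ i, g i * edgeIntegral T i φ

/-- The trace `q|_{∂T}` of `q ∈ H¹(T)` with weak gradient `G` is equal to `g`. -/
def HasTrace (T : Affine.Triangle ℝ Plane) (q : L2S (cell T)) (G : L2V (cell T))
    (g : Plane → ℝ) : Prop :=
  ∀ τ : Plane → Plane, ContDiff ℝ ∞ τ →
    (∫ x in cell T, q x * divergence τ x) + ∫ x in cell T, ⟪G x, τ x⟫
      = ∑ i, edgeIntegral T i (fun x => g x * ⟪τ x, outerNormal T i⟫)

/-- The `∇div`-trace of `u ∈ H(∇div, T)` is `(g₁, g₂)`, that is,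
`(u·n)|_{∂T} = g₁` and `(div u)|_{∂T} = g₂`. -/
def HasGradDivTrace (T : Affine.Triangle ℝ Plane) (u : HGradDiv (cell T))
    (g₁ : Fin 3 → ℝ) (g₂ : Plane → ℝ) : Prop :=
  ∃ d : L2S (cell T), IsWeakDiv (cell T) u d ∧
    HasNormalTrace T u d g₁ ∧ HasTrace T d (gradDiv u) g₂

end

end GradDivFortin

/-! Write `A` for the area of `T`, `h` for its diameter, `pᵢ` for the vertices and `λᵢ` for the
barycentric coordinates. A field `f(x)(x - pᵢ)` has no normal component on the two edges through
`pᵢ`, which makes such fields convenient lifts of traces. The fields `Xᵢ = x - pᵢ` (`fieldX`) have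
edgewise constant normal trace and divergence 2. The fields `Yᵢ = λᵢ(x - pᵢ)` (`fieldY`) have zero
normal trace and divergence `3λᵢ - 1`, and sum to zero. The field `U` (`fieldU`) has zero normal
trace and divergence 1 on the boundary. Combinations of them realize every trace in `P⁰(∂T) ×
P^{1,c}(∂T)` (`hasGradDivTrace_traceField`).

Since `∇div Xᵢ = 0` and `∇div Yᵢ` is constant, the error `e = v - Πv` has all required properties
once `(Xᵢ, ∇div e)`, `(Yᵢ, ∇div e)`, the mean of `e` and the duality of `U` with `e` vanish
(`duality_traceField_eq_zero`). Orthogonality of `∇div e` to constants is included, because the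
differences `Xᵢ - Xⱼ` are constants spanning the plane.

These conditions are met in triangular order. `opPhi` uses cubic fields with divergences `λᵢ² - 1/6`
and `λⱼλₖ`, and an explicit solution of the moment equations, to match the moments of `∇div v`
against `Xᵢ` and `Yᵢ`. `opPsi` adds a multiple of `x - centroid`, which `∇div` does not see and
whose duality with `U` is `-2A`. `opPi` adds a constant, which neither `∇div` nor the duality with
`U` sees, to match the mean. Every field is explicit, so the bounds follow from `|λᵢ| ≤ 1`, `|x -
pᵢ| ≤ h` and `|∇λᵢ| ≤ h/(2A)`: powers of `h` combine to `h²/A ≤ κ` and `h² ≤ D²`.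

It remains to see that the duality depends on `u` only through its trace (`gradDivDuality_congr`).
If the trace of `u` vanishes, then `(u, ∇div φ) = (∇div u, φ)` for `φ` smooth up to the boundary,
and `φ` has to be replaced by an arbitrary `v` in `H(∇div, T)`. No density theorem is invoked. The
kernel `η((N+1)x - Ny - c)`, with a bump `η` and an interior point `c`, is for `y ∈ T` compactly
supported in `T` as a function of `x`, by convexity, and is smooth in `y`. It may therefore be
tested against `v` in `x` and against `u` in `y`. Both tests produce the same Hessian of `η`, so
Fubini gives the identity up to the factor `((N+1)/N)²` (`kernel_identity`), and `N → ∞` finishes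
the argument (`tendsto_kernel_form`, `inner_eq_of_trace_zero`). -/

namespace GradDivFortin

noncomputable section

/-! ### Barycentric coordinates -/

/-- The affine basis of the plane given by the vertices of `T`. -/
def bary (T : Affine.Triangle ℝ Plane) : AffineBasis (Fin 3) ℝ Plane :=
  ⟨T.points, T.independent,
    (T.independent.affineSpan_eq_top_iff_card_eq_finrank_add_one).2 (by simp)⟩

/-- The barycentric coordinate of `x` at vertex `i`. -/
def lam (T : Affine.Triangle ℝ Plane) (i : Fin 3) (x : Plane) : ℝ := (bary T).coord i x

/-- The derivative of the barycentric coordinate at vertex `i`. -/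
def dlam (T : Affine.Triangle ℝ Plane) (i : Fin 3) : Plane →L[ℝ] ℝ :=
  LinearMap.toContinuousLinearMap ((bary T).coord i).linear

variable (T : Affine.Triangle ℝ Plane)

lemma lam_point (i j : Fin 3) : lam T i (T.points j) = if i = j then 1 else 0 :=
  (bary T).coord_apply i j

lemma sum_lam (x : Plane) : lam T 0 x + lam T 1 x + lam T 2 x = 1 := by
  have := (bary T).sum_coord_apply_eq_one x
  rwa [Fin.sum_univ_three] at this

lemma dlam_sub (i : Fin 3) (x y : Plane) : dlam T i (x - y) = lam T i x - lam T i y := by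
  have := ((bary T).coord i).linearMap_vsub x y
  simpa [dlam, lam] using this

lemma lam_add (i : Fin 3) (x v : Plane) : lam T i (x + v) = lam T i x + dlam T i v := by
  have := dlam_sub T i (x + v) x
  rw [add_sub_cancel_left] at this
  linarith

lemma dlam_sub_point (i j : Fin 3) (x : Plane) :
    dlam T i (x - T.points j) = lam T i x - if i = j then 1 else 0 := by
  rw [dlam_sub, lam_point]

lemma sum_dlam (v : Plane) : dlam T 0 v + dlam T 1 v + dlam T 2 v = 0 := by
  have h1 := sum_lam T (0 + v)
  have h2 := sum_lam T 0
  simp only [lam_add] at h1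
  linarith

lemma eq_sum_dlam (v : Plane) :
    v = dlam T 1 v • (T.points 1 - T.points 0) + dlam T 2 v • (T.points 2 - T.points 0) := by
  have h1 := (bary T).linear_combination_coord_eq_self (T.points 0 + v)
  have h (i) : (bary T).coord i (T.points 0 + v) = lam T i (T.points 0) + dlam T i v :=
    lam_add T i _ v
  rw [Fin.sum_univ_three] at h1
  simp only [h, lam_point] at h1
  have h0 : dlam T 0 v = - dlam T 1 v - dlam T 2 v := by linarith [sum_dlam T v]
  rw [h0] at h1
  change _ • T.points 0 + _ • T.points 1 + _ • T.points 2 = _ at h1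
  have h2 : v = (T.points 0 + v) - T.points 0 := by simp
  conv_lhs => rw [h2, ← h1]
  simp only [if_true, show ((1 : Fin 3) = 0) = False by simp, show ((2 : Fin 3) = 0) = False by simp,
    if_false]
  module

lemma hasFDerivAt_lam (i : Fin 3) (x : Plane) : HasFDerivAt (lam T i) (dlam T i) x := by
  have h : lam T i = fun y => dlam T i y + lam T i 0 := by
    funext y
    have := lam_add T i 0 y
    rw [zero_add] at this
    rw [this]; ring
  rw [h]
  exact (dlam T i).hasFDerivAt.add_const _

lemma contDiff_lam (i : Fin 3) : ContDiff ℝ ∞ (lam T i) := by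
  have h : lam T i = fun y => dlam T i y + lam T i 0 := by
    funext y
    have := lam_add T i 0 y
    rw [zero_add] at this
    rw [this]; ring
  rw [h]
  exact (dlam T i).contDiff.add contDiff_const

lemma continuous_lam (i : Fin 3) : Continuous (lam T i) := (contDiff_lam T i).continuous

lemma mem_cell (x : Plane) : x ∈ cell T ↔ ∀ i, 0 < lam T i x := by
  have := (bary T).interior_convexHull
  change interior (convexHull ℝ (range T.points)) = _ at this
  rw [cell, this]; rfl

lemma isOpen_cell : IsOpen (cell T) := isOpen_interior

lemma measurableSet_cell : MeasurableSet (cell T) := (isOpen_cell T).measurableSet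

lemma convex_cell : Convex ℝ (cell T) := (convex_convexHull ℝ _).interior

lemma isBounded_convexHull_points : Bornology.IsBounded (convexHull ℝ (range T.points)) :=
  _root_.isBounded_convexHull.2 (finite_range _).isBounded

lemma isBounded_cell : Bornology.IsBounded (cell T) :=
  (isBounded_convexHull_points T).subset interior_subset

lemma cell_nonempty : (cell T).Nonempty :=
  ⟨_, (bary T).centroid_mem_interior_convexHull⟩

lemma closure_cell : closure (cell T) = convexHull ℝ (range T.points) := by
  rw [cell, (convex_convexHull ℝ _).closure_interior_eq_closure_of_nonempty_interior
    (cell_nonempty T)]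
  exact ((finite_range T.points).isCompact_convexHull (𝕜 := ℝ)).isClosed.closure_eq

lemma point_mem_closure (i : Fin 3) : T.points i ∈ closure (cell T) := by
  rw [closure_cell]
  exact subset_convexHull ℝ _ (mem_range_self i)

lemma norm_sub_le_diam {x y : Plane} (hx : x ∈ closure (cell T)) (hy : y ∈ closure (cell T)) :
    ‖x - y‖ ≤ Metric.diam (cell T) := by
  rw [← Metric.diam_closure, ← dist_eq_norm]
  exact Metric.dist_le_diam_of_mem (isBounded_cell T).closure hx hy

lemma lam_lt_one {x : Plane} (hx : x ∈ cell T) (i : Fin 3) : lam T i x < 1 := by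
  have h := (mem_cell T x).1 hx
  have := sum_lam T x
  have h0 := h 0; have h1 := h 1; have h2 := h 2
  fin_cases i <;> simp only [Fin.zero_eta, Fin.mk_one, Fin.reduceFinMk] <;> linarith

lemma lam_edge_self (i : Fin 3) (t : ℝ) : lam T i (edge T i t) = 0 := by
  rw [edge, lam, AffineMap.apply_lineMap]
  change AffineMap.lineMap (lam T i _) (lam T i _) t = _
  rw [lam_point, lam_point]
  fin_cases i <;> simp

lemma lam_edge_add_one (i : Fin 3) (t : ℝ) : lam T (i + 1) (edge T i t) = 1 - t := by
  rw [edge, lam, AffineMap.apply_lineMap]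
  change AffineMap.lineMap (lam T _ _) (lam T _ _) t = _
  rw [lam_point, lam_point]
  fin_cases i <;> simp [AffineMap.lineMap_apply] <;> ring

lemma lam_edge_add_two (i : Fin 3) (t : ℝ) : lam T (i + 2) (edge T i t) = t := by
  rw [edge, lam, AffineMap.apply_lineMap]
  change AffineMap.lineMap (lam T _ _) (lam T _ _) t = _
  rw [lam_point, lam_point]
  fin_cases i <;> simp [AffineMap.lineMap_apply]

lemma continuous_edge (i : Fin 3) : Continuous (edge T i) :=
  AffineMap.lineMap_continuous

/-! ### Integration over a triangle -/

/-- The reference triangle. -/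
def refTriangle : Set (ℝ × ℝ) := {z | 0 < z.1 ∧ 0 < z.2 ∧ z.1 + z.2 < 1}

lemma isOpen_refTriangle : IsOpen refTriangle :=
  (isOpen_lt continuous_const continuous_fst).inter
    ((isOpen_lt continuous_const continuous_snd).inter
      (isOpen_lt (continuous_fst.add continuous_snd) continuous_const))

lemma setIntegral_refTriangle {h : ℝ × ℝ → ℝ} (hh : Continuous h) :
    ∫ z in refTriangle, h z = ∫ a in (0 : ℝ)..1, ∫ b in (0 : ℝ)..(1 - a), h (a, b) := by
  have hI : IntegrableOn h refTriangle := by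
    refine (hh.continuousOn.integrableOn_compact
      (isCompact_Icc (a := ((0 : ℝ), (0 : ℝ))) (b := (1, 1)))).mono_set ?_
    rintro ⟨a, b⟩ ⟨h1, h2, h3⟩
    simp only at h1 h2 h3
    exact ⟨⟨h1.le, h2.le⟩, ⟨by simp only; linarith, by simp only; linarith⟩⟩
  rw [← integral_indicator isOpen_refTriangle.measurableSet, Measure.volume_eq_prod, integral_prod _
    (by simpa [Measure.volume_eq_prod] using
      (integrable_indicator_iff isOpen_refTriangle.measurableSet).2 hI),
    intervalIntegral.integral_of_le zero_le_one, ← integral_Ioc_eq_integral_Ioo.symm,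
    ← integral_indicator measurableSet_Ioo]
  refine integral_congr_ae (Filter.Eventually.of_forall fun a => ?_)
  by_cases ha : a ∈ Ioo (0 : ℝ) 1
  · simp only [ha, indicator_of_mem]
    rw [intervalIntegral.integral_of_le (by linarith [ha.2]), integral_Ioc_eq_integral_Ioo,
      ← integral_indicator measurableSet_Ioo]
    refine integral_congr_ae (Filter.Eventually.of_forall fun b => ?_)
    have : (a, b) ∈ refTriangle ↔ b ∈ Ioo 0 (1 - a) :=
      ⟨fun h => ⟨h.2.1, by linarith [h.2.2]⟩, fun h => ⟨ha.1, h.1, by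
        have := h.2; simp only; linarith⟩⟩
    by_cases hb : b ∈ Ioo 0 (1 - a)
    · simp only [indicator_of_mem (this.2 hb), indicator_of_mem hb]
    · simp only [indicator_of_notMem (mt this.1 hb), indicator_of_notMem hb]
  · simp only [ha, not_false_eq_true, indicator_of_notMem]
    rw [integral_eq_zero_of_ae]
    refine Filter.Eventually.of_forall fun b => ?_
    refine indicator_of_notMem (fun h => ha ⟨h.1, ?_⟩) _
    have h2 := h.2.2; have h3 := h.2.1
    simp only at h2 h3
    linarith

/-- Both orders of integration are needed: in the divergence theorem the inner variable must run in
the direction of the derivative, once for each of the two edge directions at `p₀`. -/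
lemma setIntegral_refTriangle_swap {h : ℝ × ℝ → ℝ} (hh : Continuous h) :
    ∫ z in refTriangle, h z = ∫ a in (0 : ℝ)..1, ∫ b in (0 : ℝ)..(1 - a), h (b, a) := by
  rw [← setIntegral_refTriangle (h := fun z => h (z.2, z.1)) (by fun_prop)]
  have h1 : Prod.swap ⁻¹' refTriangle = refTriangle := by
    ext ⟨a, b⟩
    simp only [refTriangle, mem_preimage, Prod.swap, mem_ofPred_eq]
    rw [add_comm b a]; tauto
  have := (Measure.measurePreserving_swap (μ := (volume : Measure ℝ)) (ν := (volume : Measure ℝ))).setIntegral_preimage_emb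
    (MeasurableEquiv.prodComm (α := ℝ) (β := ℝ)).measurableEmbedding h refTriangle
  rw [h1] at this
  simpa [Measure.volume_eq_prod, Prod.swap] using this.symm

/-- Twice the signed area. -/
def sdet (T : Affine.Triangle ℝ Plane) : ℝ :=
  (T.points 1 - T.points 0) 0 * (T.points 2 - T.points 0) 1 -
    (T.points 1 - T.points 0) 1 * (T.points 2 - T.points 0) 0

/-- The point with barycentric coordinates `(1 - z.1 - z.2, z.1, z.2)`. -/
def refMap (z : ℝ × ℝ) : Plane :=
  T.points 0 + (z.1 • (T.points 1 - T.points 0) + z.2 • (T.points 2 - T.points 0))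

lemma continuous_refMap : Continuous (refMap T) := by unfold refMap; fun_prop

lemma lam_refMap_one (z : ℝ × ℝ) : lam T 1 (refMap T z) = z.1 := by
  simp [refMap, lam_add, lam_point, dlam_sub]

lemma lam_refMap_two (z : ℝ × ℝ) : lam T 2 (refMap T z) = z.2 := by
  simp [refMap, lam_add, lam_point, dlam_sub]

lemma lam_refMap_zero (z : ℝ × ℝ) : lam T 0 (refMap T z) = 1 - z.1 - z.2 := by
  have := sum_lam T (refMap T z)
  rw [lam_refMap_one, lam_refMap_two] at this
  linarith

lemma refMap_lam (x : Plane) : refMap T (lam T 1 x, lam T 2 x) = x := by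
  have h := eq_sum_dlam T (x - T.points 0)
  rw [dlam_sub_point, dlam_sub_point] at h
  simp only [show ((1 : Fin 3) = 0) = False by simp, show ((2 : Fin 3) = 0) = False by simp,
    if_false, sub_zero] at h
  rw [refMap, ← h]; simp

lemma preimage_cell : refMap T ⁻¹' cell T = refTriangle := by
  ext z
  rw [mem_preimage, mem_cell]
  simp only [refTriangle, mem_ofPred_eq, Fin.forall_fin_succ]
  simp only [lam_refMap_zero, show (Fin.succ 0 : Fin 3) = 1 from rfl,
    show (Fin.succ (Fin.succ 0) : Fin 3) = 2 from rfl, lam_refMap_one, lam_refMap_two]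
  constructor
  · rintro ⟨h1, h2, h3, -⟩; exact ⟨h2, h3, by linarith⟩
  · rintro ⟨h1, h2, h3⟩; exact ⟨by linarith, h1, h2, fun i => i.elim0⟩


end

end GradDivFortin

/-! ### Change of variables from the reference triangle, and moments of cubics. -/

namespace GradDivFortin

noncomputable section

variable (T : Affine.Triangle ℝ Plane)

/-- The linear part of the map from the reference triangle to `T`. -/
def refLin : Plane →ₗ[ℝ] Plane where
  toFun z := z 0 • (T.points 1 - T.points 0) + z 1 • (T.points 2 - T.points 0)
  map_add' x y := by simp only [PiLp.add_apply]; module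
  map_smul' c x := by simp only [PiLp.smul_apply, smul_eq_mul, RingHom.id_apply]; module

lemma det_refLin : LinearMap.det (refLin T) = sdet T := by
  rw [← LinearMap.det_toMatrix (EuclideanSpace.basisFun (Fin 2) ℝ).toBasis, Matrix.det_fin_two]
  simp [LinearMap.toMatrix_apply, refLin, sdet]
  ring

lemma sdet_ne_zero : sdet T ≠ 0 := by
  intro h
  rw [← det_refLin] at h
  have := LinearMap.bot_lt_ker_of_det_eq_zero h
  obtain ⟨v, hv, hv0⟩ := (Submodule.ne_bot_iff _).1 this.ne'
  refine hv0 ?_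
  have hv1 : v 0 • (T.points 1 - T.points 0) + v 1 • (T.points 2 - T.points 0) = 0 := hv
  have h1 := congrArg (dlam T 1) hv1
  have h2 := congrArg (dlam T 2) hv1
  simp [dlam_sub, lam_point] at h1 h2
  ext i
  fin_cases i <;> simp [h1, h2]

lemma setIntegral_cell_aux {f : Plane → ℝ} :
    ∫ x in cell T, f x = |sdet T| * ∫ z in refTriangle, f (refMap T z) := by
  let A : Plane →L[ℝ] Plane := LinearMap.toContinuousLinearMap (refLin T)
  let g : Plane → Plane := fun z => refMap T (z 0, z 1)
  have hg (z) : g z = T.points 0 + A z := rfl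
  let s : Set Plane := {z | ((z 0, z 1) : ℝ × ℝ) ∈ refTriangle}
  have hgs (z) : g z ∈ cell T ↔ z ∈ s := by
    change refMap T _ ∈ _ ↔ _
    rw [← mem_preimage, preimage_cell]; rfl
  have himg : g '' s = cell T := by
    ext x
    constructor
    · rintro ⟨z, hz, rfl⟩; exact (hgs z).2 hz
    · intro hx
      have : g !₂[lam T 1 x, lam T 2 x] = x := by simpa [g] using refMap_lam T x
      exact ⟨_, (hgs _).1 (by rwa [this]), this⟩
  have hs : MeasurableSet s :=
    (isOpen_refTriangle.preimage (by fun_prop : Continuous fun z : Plane => (z 0, z 1))).measurableSet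
  have hinj : InjOn g s := by
    intro x _ y _ h
    have h1 : lam T 1 (g x) = lam T 1 (g y) := by rw [h]
    have h2 : lam T 2 (g x) = lam T 2 (g y) := by rw [h]
    simp only [g, lam_refMap_one, lam_refMap_two] at h1 h2
    ext i; fin_cases i <;> assumption
  have key := integral_image_eq_integral_abs_det_fderiv_smul volume hs
    (fun x _ => ((A.hasFDerivAt.const_add (T.points 0)).hasFDerivWithinAt : HasFDerivWithinAt g A s x))
    hinj f
  change ∫ x in g '' s, f x = ∫ x in s, |A.det| • f (g x) at key
  rw [himg] at key
  have hdet : A.det = sdet T := det_refLin T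
  rw [key, hdet]
  simp only [smul_eq_mul]
  rw [integral_const_mul]
  congr 1
  -- The change of variables takes place in `Plane`; this equivalence carries Lebesgue measure there
  -- to the product measure on `ℝ × ℝ`, where Fubini is available.
  let e := (MeasurableEquiv.toLp 2 (Fin 2 → ℝ)).symm.trans (MeasurableEquiv.finTwoArrow (α := ℝ))
  have he : MeasurePreserving e volume volume :=
    (EuclideanSpace.volume_preserving_symm_measurableEquiv_toLp (Fin 2)).trans
      (volume_preserving_finTwoArrow ℝ)
  exact he.setIntegral_preimage_emb e.measurableEmbedding (fun z => f (refMap T z)) refTriangle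

lemma setIntegral_cell {f : Plane → ℝ} (hf : Continuous f) :
    ∫ x in cell T, f x =
      |sdet T| * ∫ a in (0 : ℝ)..1, ∫ b in (0 : ℝ)..(1 - a), f (refMap T (a, b)) := by
  rw [setIntegral_cell_aux, setIntegral_refTriangle (h := fun z => f (refMap T z))
    (hf.comp (continuous_refMap T))]

lemma setIntegral_cell_swap {f : Plane → ℝ} (hf : Continuous f) :
    ∫ x in cell T, f x =
      |sdet T| * ∫ a in (0 : ℝ)..1, ∫ b in (0 : ℝ)..(1 - a), f (refMap T (b, a)) := by
  rw [setIntegral_cell_aux, setIntegral_refTriangle_swap (h := fun z => f (refMap T z))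
    (hf.comp (continuous_refMap T))]

/-- Integrals of cubic polynomials in the barycentric coordinates. -/
lemma setIntegral_cubic_aux {f : Plane → ℝ} (c : Fin 10 → ℝ)
    (h : ∀ x, f x = c 0 + c 1 * lam T 1 x + c 2 * lam T 2 x + c 3 * lam T 1 x ^ 2
      + c 4 * lam T 1 x * lam T 2 x + c 5 * lam T 2 x ^ 2 + c 6 * lam T 1 x ^ 3
      + c 7 * lam T 1 x ^ 2 * lam T 2 x + c 8 * lam T 1 x * lam T 2 x ^ 2 + c 9 * lam T 2 x ^ 3) :
    ∫ x in cell T, f x = |sdet T| * (c 0 / 2 + (c 1 + c 2) / 6 + (c 3 + c 5) / 12 + c 4 / 24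
      + (c 6 + c 9) / 20 + (c 7 + c 8) / 60) := by
  have hf : Continuous f := by
    rw [funext h]
    have := continuous_lam T
    fun_prop
  rw [setIntegral_cell T hf]
  congr 1
  simp only [h, lam_refMap_one, lam_refMap_two]
  have hin (a : ℝ) : ∫ b in (0 : ℝ)..(1 - a), (c 0 + c 1 * a + c 2 * b + c 3 * a ^ 2
      + c 4 * a * b + c 5 * b ^ 2 + c 6 * a ^ 3
      + c 7 * a ^ 2 * b + c 8 * a * b ^ 2 + c 9 * b ^ 3) =
      (c 0 + c 1 * a + c 3 * a ^ 2 + c 6 * a ^ 3) * (1 - a)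
      + (c 2 + c 4 * a + c 7 * a ^ 2) * ((1 - a) ^ 2 / 2)
      + (c 5 + c 8 * a) * ((1 - a) ^ 3 / 3) + c 9 * ((1 - a) ^ 4 / 4) := by
    have hd : ∀ b ∈ uIcc (0 : ℝ) (1 - a), HasDerivAt (fun b : ℝ =>
        (c 0 + c 1 * a + c 3 * a ^ 2 + c 6 * a ^ 3) * b
      + (c 2 + c 4 * a + c 7 * a ^ 2) * (b ^ 2 / 2)
      + (c 5 + c 8 * a) * (b ^ 3 / 3) + c 9 * (b ^ 4 / 4)) (c 0 + c 1 * a + c 2 * b + c 3 * a ^ 2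
      + c 4 * a * b + c 5 * b ^ 2 + c 6 * a ^ 3
      + c 7 * a ^ 2 * b + c 8 * a * b ^ 2 + c 9 * b ^ 3) b := by
      intro b _
      have h2 := (hasDerivAt_pow 2 b).div_const 2
      have h3 := (hasDerivAt_pow 3 b).div_const 3
      have h4 := (hasDerivAt_pow 4 b).div_const 4
      have := ((((hasDerivAt_id b).const_mul (c 0 + c 1 * a + c 3 * a ^ 2 + c 6 * a ^ 3)).add
        (h2.const_mul (c 2 + c 4 * a + c 7 * a ^ 2))).add (h3.const_mul (c 5 + c 8 * a))).add
        (h4.const_mul (c 9))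
      refine this.congr_deriv ?_
      norm_num; ring
    rw [intervalIntegral.integral_eq_sub_of_hasDerivAt hd
      (Continuous.intervalIntegrable (by fun_prop) _ _)]
    ring
  simp only [hin]
  have hd : ∀ a ∈ uIcc (0 : ℝ) 1, HasDerivAt (fun a : ℝ =>
        c 0 * (a - a ^ 2 / 2) + c 1 * (a ^ 2 / 2 - a ^ 3 / 3) + c 3 * (a ^ 3 / 3 - a ^ 4 / 4)
      + c 6 * (a ^ 4 / 4 - a ^ 5 / 5) + c 2 / 2 * (a - a ^ 2 + a ^ 3 / 3)
      + c 4 / 2 * (a ^ 2 / 2 - 2 * (a ^ 3 / 3) + a ^ 4 / 4)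
      + c 7 / 2 * (a ^ 3 / 3 - 2 * (a ^ 4 / 4) + a ^ 5 / 5)
      + c 5 / 3 * (a - 3 * (a ^ 2 / 2) + a ^ 3 - a ^ 4 / 4)
      + c 8 / 3 * (a ^ 2 / 2 - a ^ 3 + 3 * (a ^ 4 / 4) - a ^ 5 / 5)
      + c 9 / 4 * (a - 2 * a ^ 2 + 2 * a ^ 3 - a ^ 4 + a ^ 5 / 5))
      ((c 0 + c 1 * a + c 3 * a ^ 2 + c 6 * a ^ 3) * (1 - a)
      + (c 2 + c 4 * a + c 7 * a ^ 2) * ((1 - a) ^ 2 / 2)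
      + (c 5 + c 8 * a) * ((1 - a) ^ 3 / 3) + c 9 * ((1 - a) ^ 4 / 4)) a := by
    intro a _
    have h1 := hasDerivAt_id a
    have h2 := hasDerivAt_pow 2 a
    have h3 := hasDerivAt_pow 3 a
    have h4 := hasDerivAt_pow 4 a
    have h5 := hasDerivAt_pow 5 a
    have := ((((((((((h1.sub (h2.div_const 2)).const_mul (c 0)).add
      (((h2.div_const 2).sub (h3.div_const 3)).const_mul (c 1))).add
      (((h3.div_const 3).sub (h4.div_const 4)).const_mul (c 3))).add
      (((h4.div_const 4).sub (h5.div_const 5)).const_mul (c 6))).add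
      (((h1.sub h2).add (h3.div_const 3)).const_mul (c 2 / 2))).add
      ((((h2.div_const 2).sub ((h3.div_const 3).const_mul 2)).add (h4.div_const 4)).const_mul
        (c 4 / 2))).add
      ((((h3.div_const 3).sub ((h4.div_const 4).const_mul 2)).add (h5.div_const 5)).const_mul
        (c 7 / 2))).add
      ((((h1.sub ((h2.div_const 2).const_mul 3)).add h3).sub (h4.div_const 4)).const_mul
        (c 5 / 3))).add
      (((((h2.div_const 2).sub h3).add ((h4.div_const 4).const_mul 3)).sub
        (h5.div_const 5)).const_mul (c 8 / 3))).add
      (((((h1.sub (h2.const_mul 2)).add (h3.const_mul 2)).sub h4).add (h5.div_const 5)).const_mul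
        (c 9 / 4))
    refine this.congr_deriv ?_
    norm_num; ring
  rw [intervalIntegral.integral_eq_sub_of_hasDerivAt hd
      (Continuous.intervalIntegrable (by fun_prop) _ _)]
  ring

/-- The area of the triangle `T`. -/
def area : ℝ := volume.real (cell T)

lemma abs_sdet : |sdet T| = 2 * area T := by
  have h := setIntegral_cubic_aux T (f := fun _ => 1) ![1, 0, 0, 0, 0, 0, 0, 0, 0, 0]
    (fun x => by simp)
  simp at h
  rw [area, h]; ring

lemma area_pos : 0 < area T := by
  have := abs_sdet T
  have h := abs_pos.2 (sdet_ne_zero T)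
  linarith

/-- The weights are those of the Dirichlet formula: `λ₁ᵃ λ₂ᵇ` integrates to `2A · a! b! / (a + b +
2)!`. -/
lemma setIntegral_cubic {f : Plane → ℝ} (c : Fin 10 → ℝ)
    (h : ∀ x, f x = c 0 + c 1 * lam T 1 x + c 2 * lam T 2 x + c 3 * lam T 1 x ^ 2
      + c 4 * lam T 1 x * lam T 2 x + c 5 * lam T 2 x ^ 2 + c 6 * lam T 1 x ^ 3
      + c 7 * lam T 1 x ^ 2 * lam T 2 x + c 8 * lam T 1 x * lam T 2 x ^ 2 + c 9 * lam T 2 x ^ 3) :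
    ∫ x in cell T, f x = area T * (c 0 + (c 1 + c 2) / 3 + (c 3 + c 5) / 6 + c 4 / 12
      + (c 6 + c 9) / 10 + (c 7 + c 8) / 30) := by
  rw [setIntegral_cubic_aux T c h, abs_sdet]; ring


end

end GradDivFortin

namespace GradDivFortin

noncomputable section

variable (T : Affine.Triangle ℝ Plane)

/-! ### The divergence theorem on a triangle -/

lemma eq_sum_single (v : Plane) : v = ∑ i, v i • EuclideanSpace.single i (1 : ℝ) := by
  ext i
  fin_cases i <;> simp [Fin.sum_univ_two]

/-- The divergence is the trace of the derivative, computed here in the basis `p₁ - p₀`, `p₂ - p₀`,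
whose dual basis is `dλ₁`, `dλ₂`. -/
lemma divergence_eq_dlam (F : Plane → Plane) (x : Plane) :
    divergence F x = dlam T 1 (fderiv ℝ F x (T.points 1 - T.points 0))
      + dlam T 2 (fderiv ℝ F x (T.points 2 - T.points 0)) := by
  set B := fderiv ℝ F x
  have h1 (k : Fin 3) (w : Plane) : dlam T k w = ∑ i, w i * dlam T k (EuclideanSpace.single i 1) := by
    conv_lhs => rw [eq_sum_single w, map_sum]
    simp
  have h2 (i : Fin 2) : B (EuclideanSpace.single i 1) =
      dlam T 1 (EuclideanSpace.single i 1) • B (T.points 1 - T.points 0)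
      + dlam T 2 (EuclideanSpace.single i 1) • B (T.points 2 - T.points 0) := by
    conv_lhs => rw [eq_sum_dlam T (EuclideanSpace.single i 1), map_add, map_smul, map_smul]
  simp only [divergence]
  change ∑ i, (B (EuclideanSpace.single i 1)) i = _
  rw [h1 1, h1 2, ← Finset.sum_add_distrib]
  refine Finset.sum_congr rfl fun i _ => ?_
  rw [h2 i]
  simp only [PiLp.add_apply, PiLp.smul_apply, smul_eq_mul]
  ring

lemma intervalIntegral_edge_reverse (f : Plane → ℝ) (i : Fin 3) :
    ∫ t in (0 : ℝ)..1, f (AffineMap.lineMap (T.points (i + 2)) (T.points (i + 1)) t) =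
      ∫ t in (0 : ℝ)..1, f (edge T i t) := by
  have := intervalIntegral.integral_comp_sub_left (a := 0) (b := 1)
    (fun t => f (edge T i t)) (1 : ℝ)
  simp only [sub_self, sub_zero] at this
  rw [← this]
  simp only [edge, AffineMap.lineMap_apply_one_sub]

/-- Every segment of `T` parallel to `p₁ - p₀` joins edge 1 to edge 0; the fundamental theorem of
calculus on these segments leaves the two edge integrals. -/
lemma setIntegral_fderiv_one {f : Plane → ℝ} (hf : ContDiff ℝ ∞ f) :
    ∫ x in cell T, fderiv ℝ f x (T.points 1 - T.points 0) =
      |sdet T| * ((∫ t in (0 : ℝ)..1, f (edge T 0 t)) - ∫ t in (0 : ℝ)..1, f (edge T 1 t)) := by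
  have hd : Continuous fun x => fderiv ℝ f x (T.points 1 - T.points 0) :=
    (hf.continuous_fderiv (by simp)).clm_apply continuous_const
  rw [setIntegral_cell_swap T hd]
  congr 1
  rw [← intervalIntegral_edge_reverse T f 1, ← intervalIntegral.integral_sub]
  rotate_left
  · exact (hf.continuous.comp (continuous_edge T 0)).intervalIntegrable _ _
  · exact (hf.continuous.comp AffineMap.lineMap_continuous).intervalIntegrable _ _
  refine intervalIntegral.integral_congr fun a _ => ?_
  have hD (b : ℝ) : HasDerivAt (fun b => f (refMap T (b, a)))
      (fderiv ℝ f (refMap T (b, a)) (T.points 1 - T.points 0)) b := by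
    have h1 : HasDerivAt (fun b : ℝ => refMap T (b, a)) (T.points 1 - T.points 0) b := by
      have := (((hasDerivAt_id b).smul_const (T.points 1 - T.points 0)).add_const
        (a • (T.points 2 - T.points 0))).const_add (T.points 0)
      simpa [refMap] using this
    exact ((hf.differentiable (by simp)) _).hasFDerivAt.comp_hasDerivAt b h1
  rw [intervalIntegral.integral_eq_sub_of_hasDerivAt (fun b _ => hD b)
    ((hd.comp ((continuous_refMap T).comp (by fun_prop))).intervalIntegrable _ _)]
  congr 2
  · simp only [refMap, edge, AffineMap.lineMap_apply_module]
    simp only [zero_add, show (0 + 2 : Fin 3) = 2 from rfl]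
    module
  · simp only [refMap, AffineMap.lineMap_apply_module]
    simp only [show (1 + 2 : Fin 3) = 0 from rfl, show (1 + 1 : Fin 3) = 2 from rfl]
    module

lemma setIntegral_fderiv_two {f : Plane → ℝ} (hf : ContDiff ℝ ∞ f) :
    ∫ x in cell T, fderiv ℝ f x (T.points 2 - T.points 0) =
      |sdet T| * ((∫ t in (0 : ℝ)..1, f (edge T 0 t)) - ∫ t in (0 : ℝ)..1, f (edge T 2 t)) := by
  have hd : Continuous fun x => fderiv ℝ f x (T.points 2 - T.points 0) :=
    (hf.continuous_fderiv (by simp)).clm_apply continuous_const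
  rw [setIntegral_cell T hd]
  congr 1
  rw [← intervalIntegral_edge_reverse T f 0, ← intervalIntegral.integral_sub]
  rotate_left
  · exact (hf.continuous.comp AffineMap.lineMap_continuous).intervalIntegrable _ _
  · exact (hf.continuous.comp (continuous_edge T 2)).intervalIntegrable _ _
  refine intervalIntegral.integral_congr fun a _ => ?_
  have hD (b : ℝ) : HasDerivAt (fun b => f (refMap T (a, b)))
      (fderiv ℝ f (refMap T (a, b)) (T.points 2 - T.points 0)) b := by
    have h1 : HasDerivAt (fun b : ℝ => refMap T (a, b)) (T.points 2 - T.points 0) b := by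
      have := (((hasDerivAt_id b).smul_const (T.points 2 - T.points 0)).const_add
        (a • (T.points 1 - T.points 0))).const_add (T.points 0)
      simpa [refMap] using this
    exact ((hf.differentiable (by simp)) _).hasFDerivAt.comp_hasDerivAt b h1
  rw [intervalIntegral.integral_eq_sub_of_hasDerivAt (fun b _ => hD b)
    ((hd.comp ((continuous_refMap T).comp (by fun_prop))).intervalIntegrable _ _)]
  congr 2
  · simp only [refMap, AffineMap.lineMap_apply_module]
    simp only [zero_add, show (0 + 2 : Fin 3) = 2 from rfl]
    module
  · simp only [refMap, edge, AffineMap.lineMap_apply_module]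
    simp only [show (2 + 1 : Fin 3) = 0 from rfl, show (2 + 2 : Fin 3) = 1 from rfl]
    module

lemma integrableOn_cell {f : Plane → ℝ} (hf : Continuous f) :
    Integrable f (volume.restrict (cell T)) := by
  have := hf.continuousOn.integrableOn_compact (μ := volume) (isBounded_cell T).isCompact_closure
  exact this.mono_set subset_closure

theorem divergence_theorem {F : Plane → Plane} (hF : ContDiff ℝ ∞ F) :
    ∫ x in cell T, divergence F x =
      ∑ i, -|sdet T| * ∫ t in (0 : ℝ)..1, dlam T i (F (edge T i t)) := by
  have hL (i : Fin 3) : ContDiff ℝ ∞ fun x => dlam T i (F x) := (dlam T i).contDiff.comp hF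
  have hfd (i : Fin 3) (x v : Plane) :
      dlam T i (fderiv ℝ F x v) = fderiv ℝ (fun x => dlam T i (F x)) x v := by
    have := ((dlam T i).hasFDerivAt.comp x ((hF.differentiable (by simp)) x).hasFDerivAt).fderiv
    change fderiv ℝ (fun x => dlam T i (F x)) x = _ at this
    rw [this]; rfl
  simp only [divergence_eq_dlam T, hfd]
  have hc (i : Fin 3) (v : Plane) : Continuous fun x => fderiv ℝ (fun x => dlam T i (F x)) x v :=
    ((hL i).continuous_fderiv (by simp)).clm_apply continuous_const
  rw [integral_add (integrableOn_cell T (hc _ _)) (integrableOn_cell T (hc _ _)),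
    setIntegral_fderiv_one T (hL 1), setIntegral_fderiv_two T (hL 2), Fin.sum_univ_three]
  have hi (i j : Fin 3) :
      IntervalIntegrable (fun t => dlam T i (F (edge T j t))) volume 0 1 :=
    ((hL i).continuous.comp (continuous_edge T j)).intervalIntegrable _ _
  -- Edge 0 receives contributions from both directional derivatives; they merge into one term
  -- because the `dλᵢ` sum to zero.
  have h0 : ∫ t in (0 : ℝ)..1, dlam T 0 (F (edge T 0 t)) =
      -(∫ t in (0 : ℝ)..1, dlam T 1 (F (edge T 0 t))) -
        ∫ t in (0 : ℝ)..1, dlam T 2 (F (edge T 0 t)) := by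
    rw [← intervalIntegral.integral_neg]
    refine Eq.trans ?_ (intervalIntegral.integral_sub (hi 1 0).neg (hi 2 0))
    refine intervalIntegral.integral_congr fun t _ => ?_
    have := sum_dlam T (F (edge T 0 t))
    linarith
  rw [h0]; ring

/-! ### Normal vectors -/

/-- The planar cross product. -/
def cross (v w : Plane) : ℝ := v 0 * w 1 - v 1 * w 0

lemma plane_inner (v w : Plane) : ⟪v, w⟫ = v 0 * w 0 + v 1 * w 1 := by
  simp [PiLp.inner_apply, Fin.sum_univ_two]; ring

lemma abs_cross_edgeVec (i : Fin 3) :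
    |cross (T.points (i + 2) - T.points (i + 1)) (T.points i - T.points (i + 1))| = |sdet T| := by
  rw [abs_eq_abs]
  fin_cases i
  · left; simp [cross, sdet]; ring
  · left; simp [cross, sdet, show (1 + 1 : Fin 3) = 2 from rfl, show (1 + 2 : Fin 3) = 0 from rfl]; ring
  · left; simp [cross, sdet, show (2 + 1 : Fin 3) = 0 from rfl, show (2 + 2 : Fin 3) = 1 from rfl]

lemma eq_sum_dlam_cyclic (i : Fin 3) (v : Plane) :
    v = dlam T i v • (T.points i - T.points (i + 1))
      + dlam T (i + 2) v • (T.points (i + 2) - T.points (i + 1)) := by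
  have h := eq_sum_dlam T v
  have h0 : dlam T 0 v = - dlam T 1 v - dlam T 2 v := by linarith [sum_dlam T v]
  conv_lhs => rw [h]
  fin_cases i
  · simp [h0]; module
  · simp [h0, show (1 + 1 : Fin 3) = 2 from rfl, show (1 + 2 : Fin 3) = 0 from rfl]; module
  · simp [show (2 + 1 : Fin 3) = 0 from rfl, show (2 + 2 : Fin 3) = 1 from rfl]; module

/-- The coordinate `λᵢ` decreases from 1 at the vertex to 0 on the opposite edge, so `∇λᵢ =
-n/height`; multiplying by base times height, which is twice the area, gives the relation. It
translates between the barycentric form of the boundary terms and the normals in the definition of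
the traces. -/
lemma dist_mul_inner_outerNormal (i : Fin 3) (w : Plane) :
    dist (T.points (i + 1)) (T.points (i + 2)) * ⟪w, outerNormal T i⟫ =
      -|sdet T| * dlam T i w := by
  have hne1 : i ≠ i + 1 := by fin_cases i <;> decide
  have hne2 : i ≠ i + 2 := by fin_cases i <;> decide
  have h1 := T.inner_vsub_vsub_altitudeFoot_eq_height_sq hne1
  have h2 := T.inner_vsub_vsub_altitudeFoot_eq_height_sq hne2
  have hH : T.height i = ‖T.points i - T.altitudeFoot i‖ := by
    rw [Affine.Simplex.height, dist_eq_norm]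
  have hpos : 0 < T.height i := T.height_pos i
  rw [hH] at h1 h2 hpos
  simp only [vsub_eq_sub] at h1 h2
  set d := T.points i - T.altitudeFoot i with hd
  set u := T.points i - T.points (i + 1) with hu
  set v := T.points (i + 2) - T.points (i + 1) with hv
  have huv : ⟪v, d⟫ = 0 := by
    have : v = u - (T.points i - T.points (i + 2)) := by rw [hu, hv]; abel
    rw [this, inner_sub_left, h1, h2, sub_self]
  have hn : outerNormal T i = -(‖d‖⁻¹ • d) := by
    rw [outerNormal, vsub_eq_sub, norm_sub_rev, ← hd, ← smul_neg, hd, neg_sub]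
  -- `w` is expanded along `pᵢ - pᵢ₊₁` and the edge vector; the latter is orthogonal to the altitude
  -- `d`.
  have hw : ⟪w, d⟫ = dlam T i w * ‖d‖ ^ 2 := by
    conv_lhs => rw [eq_sum_dlam_cyclic T i w]
    rw [inner_add_left, real_inner_smul_left, real_inner_smul_left, huv, h1]; ring
  have hcr : ‖v‖ * ‖d‖ = |sdet T| := by
    rw [← abs_cross_edgeVec T i]
    change _ = |cross v u|
    have e1 : cross v u * ‖d‖ ^ 2 = cross v d * ‖d‖ ^ 2 := by
      rw [← h1]
      have e2 : cross v u * ‖d‖ ^ 2 = cross v d * ⟪u, d⟫ - cross u d * ⟪v, d⟫ := by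
        rw [← real_inner_self_eq_norm_sq]
        simp only [plane_inner, cross]; ring
      rw [h1, e2, huv, h1]; ring
    have e3 : cross v u = cross v d := mul_right_cancel₀ (pow_pos hpos 2).ne' e1
    rw [e3]
    -- Lagrange's identity, with vanishing inner product of edge and altitude.
    have e4 : (‖v‖ * ‖d‖) ^ 2 = cross v d ^ 2 := by
      have : (‖v‖ * ‖d‖) ^ 2 = cross v d ^ 2 + ⟪v, d⟫ ^ 2 := by
        rw [mul_pow, ← real_inner_self_eq_norm_sq, ← real_inner_self_eq_norm_sq]
        simp only [plane_inner, cross]; ring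
      rw [this, huv]; ring
    rw [← sq_eq_sq₀ (by positivity) (abs_nonneg _), e4, sq_abs]
  rw [hn, inner_neg_right, real_inner_smul_right, hw, dist_comm, dist_eq_norm, ← hv, ← hcr]
  field_simp


end

end GradDivFortin

namespace GradDivFortin

noncomputable section

variable (T : Affine.Triangle ℝ Plane)

/-! ### Smooth fields -/

lemma volume_cell_lt_top : volume (cell T) < ⊤ := (isBounded_cell T).measure_lt_top

instance isFiniteMeasure_cell : IsFiniteMeasure (volume.restrict (cell T)) :=
  ⟨by rw [Measure.restrict_apply_univ]; exact volume_cell_lt_top T⟩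

lemma memLp_cell {F : Type*} [NormedAddCommGroup F] [SecondCountableTopology F]
    {f : Plane → F} (hf : Continuous f) : MemLp f 2 (volume.restrict (cell T)) := by
  obtain ⟨C, hC⟩ := (isBounded_cell T).isCompact_closure.exists_bound_of_continuousOn
    hf.continuousOn
  refine MemLp.of_bound hf.aestronglyMeasurable C ?_
  exact (ae_restrict_iff' (measurableSet_cell T)).2
    (Filter.Eventually.of_forall fun x hx => hC x (subset_closure hx))

lemma contDiff_divergence {F : Plane → Plane} (hF : ContDiff ℝ ∞ F) :
    ContDiff ℝ ∞ (divergence F) := by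
  unfold divergence
  refine ContDiff.sum fun i _ => ?_
  have h1 : ContDiff ℝ ∞ (fun x => fderiv ℝ F x (EuclideanSpace.single i 1)) :=
    (hF.fderiv_right (m := ∞) (by simp)).clm_apply contDiff_const
  exact (EuclideanSpace.proj (𝕜 := ℝ) i).contDiff.comp h1

lemma contDiff_gradient {f : Plane → ℝ} (hf : ContDiff ℝ ∞ f) : ContDiff ℝ ∞ (gradient f) := by
  unfold gradient
  exact (InnerProductSpace.toDual ℝ Plane).symm.toContinuousLinearEquiv.contDiff.comp
    (hf.fderiv_right (m := ∞) (by simp))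

lemma contDiff_classicalGradDiv {F : Plane → Plane} (hF : ContDiff ℝ ∞ F) :
    ContDiff ℝ ∞ (classicalGradDiv F) := contDiff_gradient (contDiff_divergence hF)

lemma inner_gradient (f : Plane → ℝ) (x w : Plane) : ⟪gradient f x, w⟫ = fderiv ℝ f x w := by
  rw [gradient, InnerProductSpace.toDual_symm_apply]

lemma divergence_smul {f : Plane → ℝ} {F : Plane → Plane} {x : Plane}
    (hf : DifferentiableAt ℝ f x) (hF : DifferentiableAt ℝ F x) :
    divergence (fun y => f y • F y) x = f x * divergence F x + fderiv ℝ f x (F x) := by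
  simp only [divergence]
  rw [fderiv_fun_smul hf hF]
  conv_rhs => rw [eq_sum_single (F x), map_sum, Finset.mul_sum, ← Finset.sum_add_distrib]
  refine Finset.sum_congr rfl fun i _ => ?_
  simp
  ring

lemma green {f : Plane → ℝ} {F : Plane → Plane} (hf : ContDiff ℝ ∞ f) (hF : ContDiff ℝ ∞ F) :
    (∫ x in cell T, divergence F x * f x) + ∫ x in cell T, ⟪F x, gradient f x⟫ =
      ∑ i, -|sdet T| * ∫ t in (0 : ℝ)..1, f (edge T i t) * dlam T i (F (edge T i t)) := by
  rw [← integral_add]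
  · have h := divergence_theorem T (F := fun y => f y • F y) (hf.smul hF)
    simp only [map_smul, smul_eq_mul] at h
    rw [← h]
    refine integral_congr_ae (Filter.Eventually.of_forall fun x => ?_)
    change divergence F x * f x + ⟪F x, gradient f x⟫ = divergence (fun y => f y • F y) x
    rw [divergence_smul (hf.differentiable (by simp) x) (hF.differentiable (by simp) x),
      real_inner_comm, inner_gradient, mul_comm]
  · exact integrableOn_cell T ((contDiff_divergence hF).continuous.mul hf.continuous)
  · exact integrableOn_cell T (hF.continuous.inner (contDiff_gradient hf).continuous)

lemma edge_notMem_cell (i : Fin 3) (t : ℝ) : edge T i t ∉ cell T := fun h => by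
  have := (mem_cell T _).1 h i
  rw [lam_edge_self] at this
  exact lt_irrefl _ this

lemma divergence_eq_zero_of_notMem_tsupport {φ : Plane → Plane} {x : Plane} (hx : x ∉ tsupport φ) :
    divergence φ x = 0 := by
  have : fderiv ℝ φ x = 0 := by
    have := mt (fun h => (tsupport_fderiv_subset ℝ (f := φ)) (subset_tsupport _ h)) hx
    simpa using this
  simp [divergence, this]

/-- The class in `L₂(T)²` of a continuous field. -/
def toL2V {F : Plane → Plane} (hF : Continuous F) : L2V (cell T) := (memLp_cell T hF).toLp F

lemma coeFn_toL2V {F : Plane → Plane} (hF : Continuous F) :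
    ∀ᵐ x ∂(volume.restrict (cell T)), toL2V T hF x = F x := (memLp_cell T hF).coeFn_toLp

/-- Green's formula is used twice. The boundary terms drop out because the support of a test field
lies in the open cell, so the field and its divergence vanish on all edges. -/
lemma isWeakGradDiv_toL2V {F : Plane → Plane} (hF : ContDiff ℝ ∞ F) :
    IsWeakGradDiv (cell T) (toL2V T hF.continuous)
      (toL2V T (contDiff_classicalGradDiv hF).continuous) := by
  intro φ hφ
  have hz (i : Fin 3) (t : ℝ) : edge T i t ∉ tsupport φ :=
    fun h => edge_notMem_cell T i t (hφ.subset h)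
  have h1 := green T (contDiff_divergence hφ.smooth) hF
  have h2 := green T (contDiff_divergence hF) hφ.smooth
  simp only [divergence_eq_zero_of_notMem_tsupport (hz _ _), zero_mul, intervalIntegral.integral_zero,
    mul_zero, Finset.sum_const_zero] at h1
  simp only [image_eq_zero_of_notMem_tsupport (hz _ _), map_zero, mul_zero,
    intervalIntegral.integral_zero, Finset.sum_const_zero] at h2
  have e1 : ∫ x in cell T, ⟪toL2V T hF.continuous x, classicalGradDiv φ x⟫ =
      ∫ x in cell T, ⟪F x, gradient (divergence φ) x⟫ := by
    refine integral_congr_ae ?_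
    filter_upwards [coeFn_toL2V T hF.continuous] with x hx
    rw [hx, classicalGradDiv]
  have e2 : ∫ x in cell T, ⟪toL2V T (contDiff_classicalGradDiv hF).continuous x, φ x⟫ =
      ∫ x in cell T, ⟪φ x, gradient (divergence F) x⟫ := by
    refine integral_congr_ae ?_
    filter_upwards [coeFn_toL2V T (contDiff_classicalGradDiv hF).continuous] with x hx
    rw [hx, classicalGradDiv, real_inner_comm]
  rw [e1, e2]
  simp only [mul_comm (divergence φ _)] at h2
  linarith

/-- The vector space of smooth fields. -/
def smoothFields : Submodule ℝ (Plane → Plane) where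
  carrier := {F | ContDiff ℝ ∞ F}
  zero_mem' := show ContDiff ℝ ∞ (fun _ => (0 : Plane)) from contDiff_const
  add_mem' {F G} (hF : ContDiff ℝ ∞ F) (hG : ContDiff ℝ ∞ G) :=
    show ContDiff ℝ ∞ (F + G) from hF.add hG
  smul_mem' c F (hF : ContDiff ℝ ∞ F) := show ContDiff ℝ ∞ (c • F) from hF.const_smul c

/-- A smooth field as an element of `H(∇div, T)`. -/
def ofSmooth : smoothFields →ₗ[ℝ] HGradDiv (cell T) where
  toFun F := ⟨toL2V T (ContDiff.continuous (𝕜 := ℝ) (n := ∞) F.2), _, isWeakGradDiv_toL2V T F.2⟩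
  map_add' _ _ := rfl
  map_smul' _ _ := rfl

lemma gradDiv_ofSmooth (F : smoothFields) :
    gradDiv (ofSmooth T F) = toL2V T (contDiff_classicalGradDiv F.2).continuous :=
  IsWeakGradDiv.unique (isOpen_cell T) (gradDiv_spec _) (isWeakGradDiv_toL2V T F.2)

/-- `gradDiv` as a linear map. -/
def gradDivLin : HGradDiv (cell T) →ₗ[ℝ] L2V (cell T) where
  toFun := gradDiv
  map_add' v w := by
    refine IsWeakGradDiv.unique (isOpen_cell T) (gradDiv_spec _) fun φ hφ => ?_
    rw [Submodule.coe_add,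
      integral_inner_add _ _ hφ.continuous_classicalGradDiv hφ.compact_classicalGradDiv,
      integral_inner_add _ _ hφ.smooth.continuous hφ.compact, gradDiv_spec v φ hφ,
      gradDiv_spec w φ hφ]
  map_smul' c v := by
    refine IsWeakGradDiv.unique (isOpen_cell T) (gradDiv_spec _) fun φ hφ => ?_
    rw [Submodule.coe_smul, RingHom.id_apply, integral_inner_smul, integral_inner_smul,
      gradDiv_spec v φ hφ]

lemma gradDivLin_apply (v : HGradDiv (cell T)) : gradDivLin T v = gradDiv v := rfl

lemma inner_toL2V {F G : Plane → Plane} (hF : Continuous F) (hG : Continuous G) :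
    ⟪toL2V T hF, toL2V T hG⟫ = ∫ x in cell T, ⟪F x, G x⟫ := by
  rw [L2.inner_def]
  refine integral_congr_ae ?_
  filter_upwards [coeFn_toL2V T hF, coeFn_toL2V T hG] with x h1 h2
  rw [h1, h2]

lemma norm_toL2V_le {F : Plane → Plane} (hF : Continuous F) {M : ℝ} (hM : 0 ≤ M)
    (h : ∀ x ∈ cell T, ‖F x‖ ≤ M) : ‖toL2V T hF‖ ≤ M * Real.sqrt (area T) := by
  have h1 : ‖toL2V T hF‖ ^ 2 ≤ M ^ 2 * area T := by
    rw [← real_inner_self_eq_norm_sq, inner_toL2V]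
    calc ∫ x in cell T, ⟪F x, F x⟫ ≤ ∫ x in cell T, M ^ 2 := by
          refine setIntegral_mono_on (integrableOn_cell T (hF.inner hF))
            (integrableOn_cell T continuous_const) (measurableSet_cell T) fun x hx => ?_
          rw [real_inner_self_eq_norm_sq]
          exact pow_le_pow_left₀ (norm_nonneg _) (h x hx) 2
      _ = M ^ 2 * area T := by rw [setIntegral_const, area, smul_eq_mul, mul_comm]
  have h2 : M ^ 2 * area T = (M * Real.sqrt (area T)) ^ 2 := by
    rw [mul_pow, Real.sq_sqrt (area_pos T).le]
  rw [h2] at h1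
  exact le_of_sq_le_sq h1 (by positivity)

/-- A smooth field whose normal component and whose divergence are prescribed on the edges has
the corresponding trace. -/
lemma hasGradDivTrace_ofSmooth (F : smoothFields) {g₁ : Fin 3 → ℝ} {g₂ : Plane → ℝ}
    (h1 : ∀ i, ∀ t ∈ Icc (0 : ℝ) 1, -|sdet T| * dlam T i ((F : Plane → Plane) (edge T i t)) =
      g₁ i * dist (T.points (i + 1)) (T.points (i + 2)))
    (h2 : ∀ i, ∀ t ∈ Icc (0 : ℝ) 1, divergence (F : Plane → Plane) (edge T i t) = g₂ (edge T i t)) :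
    HasGradDivTrace T (ofSmooth T F) g₁ g₂ := by
  have hF : ContDiff ℝ ∞ (F : Plane → Plane) := F.2
  have hm := memLp_cell T (contDiff_divergence hF).continuous
  have key1 : HasNormalTrace T (ofSmooth T F) (hm.toLp _) g₁ := by
    intro φ hφ
    have e1 : ∫ x in cell T, (hm.toLp _ : L2S (cell T)) x * φ x =
        ∫ x in cell T, divergence (F : Plane → Plane) x * φ x := by
      refine integral_congr_ae ?_
      filter_upwards [hm.coeFn_toLp] with x hx
      rw [hx]
    have e2 : ∫ x in cell T, ⟪(ofSmooth T F : L2V (cell T)) x, gradient φ x⟫ =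
        ∫ x in cell T, ⟪(F : Plane → Plane) x, gradient φ x⟫ := by
      refine integral_congr_ae ?_
      filter_upwards [coeFn_toL2V T hF.continuous] with x hx
      change ⟪toL2V T hF.continuous x, _⟫ = _
      rw [hx]
    rw [e1, e2, green T hφ hF]
    refine Finset.sum_congr rfl fun i _ => ?_
    rw [edgeIntegral, ← mul_assoc, ← intervalIntegral.integral_const_mul,
      ← intervalIntegral.integral_const_mul]
    refine intervalIntegral.integral_congr fun t ht => ?_
    rw [uIcc_of_le zero_le_one] at ht
    rw [← h1 i t ht]; ring
  refine ⟨hm.toLp _, fun φ hφ => ?_, key1, fun τ hτ => ?_⟩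
  -- The weak divergence comes from the normal trace identity, whose right-hand side vanishes for
  -- test functions supported in the open cell.
  · have h := key1 φ hφ.smooth
    have h0 : ∑ i, g₁ i * edgeIntegral T i φ = 0 := by
      refine Finset.sum_eq_zero fun i _ => ?_
      have (t : ℝ) : φ (edge T i t) = 0 := image_eq_zero_of_notMem_tsupport
        fun h => edge_notMem_cell T i t (hφ.subset h)
      simp [edgeIntegral, this]
    rw [h0] at h
    linarith
  · have e1 : ∫ x in cell T, (hm.toLp _ : L2S (cell T)) x * divergence τ x =
        ∫ x in cell T, divergence τ x * divergence (F : Plane → Plane) x := by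
      refine integral_congr_ae ?_
      filter_upwards [hm.coeFn_toLp] with x hx
      rw [hx, mul_comm]
    have e2 : ∫ x in cell T, ⟪gradDiv (ofSmooth T F) x, τ x⟫ =
        ∫ x in cell T, ⟪τ x, gradient (divergence (F : Plane → Plane)) x⟫ := by
      rw [gradDiv_ofSmooth]
      refine integral_congr_ae ?_
      filter_upwards [coeFn_toL2V T (contDiff_classicalGradDiv hF).continuous] with x hx
      rw [hx, real_inner_comm, classicalGradDiv]
    rw [e1, e2, green T (contDiff_divergence hF) hτ]
    refine Finset.sum_congr rfl fun i _ => ?_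
    rw [edgeIntegral, ← intervalIntegral.integral_const_mul,
      ← intervalIntegral.integral_const_mul]
    refine intervalIntegral.integral_congr fun t ht => ?_
    rw [uIcc_of_le zero_le_one] at ht
    rw [h2 i t ht]
    linear_combination -g₂ (edge T i t) * dist_mul_inner_outerNormal T i (τ (edge T i t))


end

end GradDivFortin

namespace GradDivFortin

noncomputable section

/-! ### Fields with vanishing trace -/

lemma exists_norm_fderiv_le {E : Type*} [NormedAddCommGroup E] [NormedSpace ℝ E]
    {f : E → E →L[ℝ] ℝ} (hf : ContDiff ℝ ∞ f) (hs : HasCompactSupport f) :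
    ∃ M : ℝ, ∀ z, ‖fderiv ℝ f z‖ ≤ M := by
  obtain ⟨C, hC⟩ := hf.lipschitzWith_of_hasCompactSupport hs (by simp)
  exact ⟨C, fun z => norm_fderiv_le_of_lipschitz ℝ hC⟩

lemma exists_bound_fderiv_fderiv {E : Type*} [NormedAddCommGroup E] [NormedSpace ℝ E] {η : E → ℝ}
    (hη : ContDiff ℝ ∞ η) (hs : HasCompactSupport η) :
    ∃ M, ∀ z v w, |fderiv ℝ (fderiv ℝ η) z v w| ≤ M * (‖v‖ * ‖w‖) := by
  obtain ⟨M, hM⟩ := exists_norm_fderiv_le (hη.fderiv_right (m := ∞) (by simp)) (hs.fderiv (𝕜 := ℝ))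
  refine ⟨M, fun z v w => ?_⟩
  have h := ContinuousLinearMap.le_opNorm₂ (fderiv ℝ (fderiv ℝ η) z) v w
  rw [Real.norm_eq_abs] at h
  refine h.trans ?_
  rw [mul_assoc]
  exact mul_le_mul_of_nonneg_right (hM z) (by positivity)

/-! ### The two-point kernel and the symmetric testing identity. -/

section Kernel

variable {η : Plane → ℝ}

/-- The second derivative of `η`. -/
def hess (η : Plane → ℝ) (z v w : Plane) : ℝ := fderiv ℝ (fderiv ℝ η) z v w

/-- For constant `e`, `div(f e)` is the derivative of `f` along `e`, so pairing `∇div(f e)` with `w`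
gives a second derivative; each differentiation contributes a factor `s`. -/
lemma inner_classicalGradDiv_smul (hη : ContDiff ℝ ∞ η) (a : Plane) (s : ℝ) (e w x : Plane) :
    ⟪w, classicalGradDiv (fun y => η (a + s • y) • e) x⟫ =
      s ^ 2 * hess η (a + s • x) w e := by
  have hin (y : Plane) : HasFDerivAt (fun y : Plane => a + s • y)
      (s • ContinuousLinearMap.id ℝ Plane) y := ((hasFDerivAt_id y).const_smul s).const_add a
  have hd (y : Plane) : HasFDerivAt (fun y => η (a + s • y)) (s • fderiv ℝ η (a + s • y)) y := by
    have := ((hη.differentiable (by simp)) (a + s • y)).hasFDerivAt.comp y (hin y)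
    refine this.congr_fderiv ?_
    ext v; simp
  have h1 : divergence (fun y => η (a + s • y) • e) = fun y => s * fderiv ℝ η (a + s • y) e := by
    funext y
    have := divergence_smul (F := fun _ => e) (hd y).differentiableAt (differentiableAt_const e)
    rw [this, (hd y).fderiv]
    simp [divergence]
  have h2 : HasFDerivAt (fun y => s * fderiv ℝ η (a + s • y) e)
      (s • ((s • fderiv ℝ (fderiv ℝ η) (a + s • x)).flip e)) x := by
    have h3 : Differentiable ℝ (fderiv ℝ η) :=
      (hη.fderiv_right (m := ∞) (by simp)).differentiable (by simp)
    have h4 := (h3 (a + s • x)).hasFDerivAt.comp x (hin x)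
    have h5 := (h4.clm_apply (hasFDerivAt_const e x)).const_mul s
    refine h5.congr_fderiv ?_
    ext v; simp
  rw [classicalGradDiv, real_inner_comm, inner_gradient, h1, h2.fderiv, hess]
  simp
  ring

lemma two_le_infty : (2 : WithTop ℕ∞) ≤ ∞ := ENat.LEInfty.out

lemma fderiv_fderiv_symm (hη : ContDiff ℝ ∞ η) (z v w : Plane) :
    hess η z v w = hess η z w v :=
  ((hη.of_le (m := 2) two_le_infty).contDiffAt.isSymmSndFDerivAt (by simp)).eq v w

variable {K : Set Plane} {c : Plane} {ρ : ℝ}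

lemma integrable_norm_mul_norm (M : ℝ) (hK : volume K < ⊤) {f g : Plane → Plane}
    (hf : MemLp f 2 (volume.restrict K)) (hg : MemLp g 2 (volume.restrict K)) :
    Integrable (fun z : Plane × Plane => M * (‖g z.1‖ * ‖f z.2‖))
      ((volume.restrict K).prod (volume.restrict K)) := by
  have : IsFiniteMeasure (volume.restrict K) := ⟨by rwa [Measure.restrict_apply_univ]⟩
  have hf1 := (hf.integrable (by norm_num)).norm
  have hg1 := (hg.integrable (by norm_num)).norm
  have hb := hg1.mul_prod hf1
  exact hb.const_mul M

lemma aestronglyMeasurable_form {N : ℝ} {h : Plane → Plane → Plane → ℝ}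
    (hh : Continuous fun p : (Plane × Plane) × (Plane × Plane) =>
      h ((N + 1) • p.1.1 - N • p.1.2 - c) p.2.1 p.2.2) {f g : Plane → Plane}
    (hf : AEStronglyMeasurable f (volume.restrict K))
    (hg : AEStronglyMeasurable g (volume.restrict K)) :
    AEStronglyMeasurable (fun z : Plane × Plane => h ((N + 1) • z.1 - N • z.2 - c) (g z.1) (f z.2))
      ((volume.restrict K).prod (volume.restrict K)) := by
  have h1 : AEStronglyMeasurable (fun z : Plane × Plane => g z.1)
      ((volume.restrict K).prod (volume.restrict K)) := hg.comp_fst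
  have h2 : AEStronglyMeasurable (fun z : Plane × Plane => f z.2)
      ((volume.restrict K).prod (volume.restrict K)) := hf.comp_snd
  have h3 : AEStronglyMeasurable (fun z : Plane × Plane => (z, (g z.1, f z.2)))
      ((volume.restrict K).prod (volume.restrict K)) :=
    AEStronglyMeasurable.prodMk aestronglyMeasurable_id (h1.prodMk h2)
  exact Continuous.comp_aestronglyMeasurable (f := fun z : Plane × Plane => (z, (g z.1, f z.2)))
    (g := fun p : (Plane × Plane) × (Plane × Plane) =>
      h ((N + 1) • p.1.1 - N • p.1.2 - c) p.2.1 p.2.2) hh h3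

lemma integrable_form {N M : ℝ} {h : Plane → Plane → Plane → ℝ}
    (hh : Continuous fun p : (Plane × Plane) × (Plane × Plane) =>
      h ((N + 1) • p.1.1 - N • p.1.2 - c) p.2.1 p.2.2)
    (hM : ∀ z v w, |h z v w| ≤ M * (‖v‖ * ‖w‖)) (hK : volume K < ⊤) {f g : Plane → Plane}
    (hf : MemLp f 2 (volume.restrict K)) (hg : MemLp g 2 (volume.restrict K)) :
    Integrable (fun z : Plane × Plane => h ((N + 1) • z.1 - N • z.2 - c) (g z.1) (f z.2))
      ((volume.restrict K).prod (volume.restrict K)) :=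
  Integrable.mono' (integrable_norm_mul_norm M hK hf hg)
    (aestronglyMeasurable_form hh hf.aestronglyMeasurable hg.aestronglyMeasurable)
    (Filter.Eventually.of_forall fun _ => hM _ _ _)

lemma exists_bound_kernel (hc : Continuous η) (hs : HasCompactSupport η) :
    ∃ M, ∀ z, |η z| ≤ M := hc.bounded_above_of_compact_support hs

lemma integrable_kernel_inner {N : ℝ} (hc : Continuous η) (hs : HasCompactSupport η)
    (hK : volume K < ⊤) {f g : Plane → Plane}
    (hf : MemLp f 2 (volume.restrict K)) (hg : MemLp g 2 (volume.restrict K)) :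
    Integrable (fun z : Plane × Plane => η ((N + 1) • z.1 - N • z.2 - c) * ⟪f z.2, g z.1⟫)
      ((volume.restrict K).prod (volume.restrict K)) := by
  obtain ⟨M, hM⟩ := exists_bound_kernel hc hs
  refine integrable_form (N := N) (c := c) (M := M) (h := fun z v w => η z * ⟪w, v⟫)
    (by fun_prop) (fun z v w => ?_) hK hf hg
  rw [abs_mul, mul_comm ‖v‖]
  exact mul_le_mul (hM z) (abs_real_inner_le_norm w v) (abs_nonneg _) ((abs_nonneg _).trans (hM z))

lemma continuous_hess (hη : ContDiff ℝ ∞ η) :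
    Continuous fun p : Plane × Plane × Plane => hess η p.1 p.2.1 p.2.2 := by
  have hDc : Continuous (fderiv ℝ (fderiv ℝ η)) :=
    (hη.fderiv_right (m := ∞) (by simp)).continuous_fderiv (by simp)
  exact ((hDc.comp continuous_fst).clm_apply (continuous_fst.comp continuous_snd)).clm_apply
    (continuous_snd.comp continuous_snd)

lemma integrable_hess {N : ℝ} (hη : ContDiff ℝ ∞ η) (hs : HasCompactSupport η)
    (hK : volume K < ⊤) {f g : Plane → Plane}
    (hf : MemLp f 2 (volume.restrict K)) (hg : MemLp g 2 (volume.restrict K)) :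
    Integrable (fun z : Plane × Plane => hess η ((N + 1) • z.1 - N • z.2 - c) (g z.1) (f z.2))
      ((volume.restrict K).prod (volume.restrict K)) := by
  obtain ⟨M, hM⟩ := exists_bound_fderiv_fderiv hη hs
  have h1 : Continuous fun p : (Plane × Plane) × (Plane × Plane) =>
      ((N + 1) • p.1.1 - N • p.1.2 - c, p.2.1, p.2.2) := by fun_prop
  exact integrable_form (h := hess η) ((continuous_hess hη).comp h1) hM hK hf hg

lemma contDiff_comp_smul (hη : ContDiff ℝ ∞ η) (a : Plane) (s : ℝ) (e : Plane) :
    ContDiff ℝ ∞ fun y => η (a + s • y) • e := by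
  have h1 : ContDiff ℝ ∞ fun y : Plane => a + s • y := by fun_prop
  exact (hη.comp h1).smul contDiff_const

/-- With `w = (N+1)x - Ny`, a point of the ball around `c`, `x = (N y + w)/(N+1)` is a convex
combination of two points of `K`. This is where convexity keeps the kernel, as a function of `x`,
inside `K`. -/
lemma kernel_mem (hK : Convex ℝ K) (hc : Metric.closedBall c ρ ⊆ K) {N : ℝ} (hN : 0 < N)
    {x y : Plane} (hy : y ∈ K) (h : ‖(N + 1) • x - N • y - c‖ ≤ ρ) : x ∈ K := by
  have hw : (N + 1) • x - N • y ∈ K := hc (by rwa [mem_closedBall_iff_norm])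
  have := hK hy hw (a := N / (N + 1)) (b := 1 / (N + 1)) (by positivity) (by positivity)
    (by field_simp)
  convert this using 1
  have hN1 : N + 1 ≠ 0 := by positivity
  rw [smul_sub, smul_smul, smul_smul, one_div, inv_mul_cancel₀ hN1, one_smul, div_eq_inv_mul]
  abel

lemma isTest_kernel (hη : ContDiff ℝ ∞ η) (hsupp : Function.support η ⊆ Metric.closedBall 0 ρ)
    (hK : Convex ℝ K) (hb : Bornology.IsBounded K) (hc : Metric.closedBall c ρ ⊆ K)
    {N : ℝ} (hN : 0 < N) {y : Plane} (hy : y ∈ K) (e : Plane) :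
    IsTest K (fun x => η ((-(N • y) - c) + (N + 1) • x) • e) := by
  have hsub : tsupport (fun x => η ((-(N • y) - c) + (N + 1) • x) • e) ⊆ K := by
    have h1 : tsupport (fun x => η ((-(N • y) - c) + (N + 1) • x) • e) ⊆
        {x | ‖(N + 1) • x - N • y - c‖ ≤ ρ} := by
      refine closure_minimal (fun x hx => ?_) (isClosed_le (by fun_prop) continuous_const)
      have h2 : η ((-(N • y) - c) + (N + 1) • x) ≠ 0 := fun h => hx (by simp [h])
      have h3 := hsupp h2
      rw [mem_closedBall_zero_iff] at h3
      have e1 : (N + 1) • x - N • y - c = (-(N • y) - c) + (N + 1) • x := by abel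
      change ‖_‖ ≤ ρ
      rwa [e1]
    exact fun x hx => kernel_mem hK hc hN hy (h1 hx)
  refine ⟨?_, ?_, hsub⟩
  · exact contDiff_comp_smul hη _ _ e
  · exact Metric.isCompact_of_isClosed_isBounded (isClosed_tsupport _) (hb.subset hsub)

/-- Testing `v` in the variable `x` produces `(N+1)²` times the Hessian form of `η` in `v x` and `u
y`; testing `u` in `y` produces `N²` times the same form. Fubini permits the comparison of the two
double integrals. -/
lemma kernel_identity (hη : ContDiff ℝ ∞ η) (hηc : HasCompactSupport η)
    (hsupp : Function.support η ⊆ Metric.closedBall 0 ρ)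
    (hK : Convex ℝ K) (hKm : MeasurableSet K) (hb : Bornology.IsBounded K)
    (hc : Metric.closedBall c ρ ⊆ K) {u G v g : L2V K}
    (hu : ∀ φ : Plane → Plane, ContDiff ℝ ∞ φ →
      ∫ x in K, ⟪u x, classicalGradDiv φ x⟫ = ∫ x in K, ⟪G x, φ x⟫)
    (hv : IsWeakGradDiv K v g) {N : ℝ} (hN : 0 < N) :
    N ^ 2 * ∫ x in K, ∫ y in K, η ((N + 1) • x - N • y - c) * ⟪u y, g x⟫ =
      (N + 1) ^ 2 * ∫ x in K, ∫ y in K, η ((N + 1) • x - N • y - c) * ⟪G y, v x⟫ := by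
  have hfin : volume K < ⊤ := hb.measure_lt_top
  have h1 (y : Plane) (hy : y ∈ K) : ∫ x in K, η ((N + 1) • x - N • y - c) * ⟪u y, g x⟫ =
      (N + 1) ^ 2 * ∫ x in K, hess η ((N + 1) • x - N • y - c) (v x) (u y) := by
    have := hv _ (isTest_kernel hη hsupp hK hb hc hN hy (u y))
    simp only [inner_classicalGradDiv_smul hη, real_inner_smul_right] at this
    rw [integral_const_mul] at this
    have e1 (x : Plane) : (-(N • y) - c) + (N + 1) • x = (N + 1) • x - N • y - c := by abel
    simp only [e1] at this
    rw [this]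
    simp only [real_inner_comm]
  -- As a function of `y` the kernel may reach the boundary of `K`; this is harmless because the
  -- hypothesis on `u` allows every smooth field. The inner scaling is `-N`, and its sign disappears
  -- in the square.
  have h2 (x : Plane) : ∫ y in K, η ((N + 1) • x - N • y - c) * ⟪G y, v x⟫ =
      N ^ 2 * ∫ y in K, hess η ((N + 1) • x - N • y - c) (v x) (u y) := by
    have := hu (fun y => η (((N + 1) • x - c) + (-N) • y) • v x)
      (contDiff_comp_smul hη _ _ _)
    simp only [inner_classicalGradDiv_smul hη, real_inner_smul_right] at this
    rw [integral_const_mul] at this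
    have e1 (y : Plane) : ((N + 1) • x - c) + (-N) • y = (N + 1) • x - N • y - c := by
      rw [neg_smul]; abel
    simp only [e1, neg_sq] at this
    rw [← this]
    simp only [fderiv_fderiv_symm hη _ (u _) (v x)]
  have hI := integrable_hess (N := N) (c := c) hη hηc hfin (Lp.memLp u) (Lp.memLp v)
  have hJ := integrable_kernel_inner (N := N) (c := c) hη.continuous hηc hfin (Lp.memLp u) (Lp.memLp g)
  have e1 := integral_integral_swap (f := fun x y : Plane =>
    η ((N + 1) • x - N • y - c) * ⟪u y, g x⟫) hJ
  have e2 := integral_integral_swap (f := fun x y : Plane =>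
    hess η ((N + 1) • x - N • y - c) (v x) (u y)) hI
  rw [e1, setIntegral_congr_fun hKm h1, integral_const_mul]
  simp only [h2]
  rw [integral_const_mul, e2]
  ring

end Kernel


end

end GradDivFortin

namespace GradDivFortin

noncomputable section

/-! ### Convergence of the mollified inner products. -/

section Limit

variable {η : Plane → ℝ} {K : Set Plane} {c : Plane} {ρ : ℝ}

lemma integral_kernel_right (N : ℝ) (a : Plane) :
    ∫ y, η (a - N • y) = (N ^ 2)⁻¹ * ∫ z, η z := by
  have h := Measure.integral_comp_smul (volume : Measure Plane) (fun z => η (a - z)) N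
  rw [integral_sub_left_eq_self η volume a] at h
  rw [h, finrank_euclideanSpace_fin, smul_eq_mul, abs_of_nonneg (by positivity)]

lemma integral_kernel_left (N : ℝ) (a : Plane) :
    ∫ x, η (N • x - a) = (N ^ 2)⁻¹ * ∫ z, η z := by
  have h := Measure.integral_comp_smul (volume : Measure Plane) (fun z => η (z - a)) N
  rw [integral_sub_right_eq_self η a] at h
  rw [h, finrank_euclideanSpace_fin, smul_eq_mul, abs_of_nonneg (by positivity)]

lemma integrable_kernel_right (hc : Continuous η) (hs : HasCompactSupport η) {N : ℝ} (hN : N ≠ 0)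
    (a : Plane) : Integrable fun y => η (a - N • y) := by
  have h1 : Integrable η := hc.integrable_of_hasCompactSupport hs
  exact (h1.comp_sub_left a).comp_smul hN

lemma integrable_kernel_left (hc : Continuous η) (hs : HasCompactSupport η) {N : ℝ} (hN : N ≠ 0)
    (a : Plane) : Integrable fun x => η (N • x - a) := by
  have h1 : Integrable η := hc.integrable_of_hasCompactSupport hs
  exact (h1.comp_sub_right a).comp_smul hN

lemma setIntegral_kernel_right_le (hc : Continuous η) (hs : HasCompactSupport η)
    (h0 : ∀ z, 0 ≤ η z) (h1 : ∫ z, η z = 1) {N : ℝ} (hN : 0 < N) (a : Plane) :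
    ∫ y in K, N ^ 2 * η (a - N • y) ≤ 1 := by
  have := setIntegral_le_integral (s := K) (integrable_kernel_right hc hs hN.ne' a)
    (Filter.Eventually.of_forall fun y => h0 _)
  rw [integral_kernel_right, h1, mul_one] at this
  rw [integral_const_mul]
  calc N ^ 2 * _ ≤ N ^ 2 * (N ^ 2)⁻¹ := by gcongr
    _ = 1 := mul_inv_cancel₀ (by positivity)

lemma setIntegral_kernel_left_le (hc : Continuous η) (hs : HasCompactSupport η)
    (h0 : ∀ z, 0 ≤ η z) (h1 : ∫ z, η z = 1) {N : ℝ} (hN : 0 < N) (a : Plane) :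
    ∫ x in K, N ^ 2 * η ((N + 1) • x - a) ≤ 1 := by
  have hN1 : 0 < N + 1 := by linarith
  have := setIntegral_le_integral (s := K) (integrable_kernel_left hc hs hN1.ne' a)
    (Filter.Eventually.of_forall fun y => h0 _)
  rw [integral_kernel_left, h1, mul_one] at this
  rw [integral_const_mul]
  calc N ^ 2 * _ ≤ N ^ 2 * ((N + 1) ^ 2)⁻¹ := by gcongr
    _ ≤ 1 := by
      rw [← div_eq_mul_inv, div_le_one (by positivity)]
      nlinarith

/-- Pointwise convergence of the mollification of a continuous function. -/
lemma tendsto_mollify (hc : Continuous η) (hs : HasCompactSupport η)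
    (h0 : ∀ z, 0 ≤ η z) (h1 : ∫ z, η z = 1)
    (hsupp : Function.support η ⊆ Metric.closedBall 0 ρ) (hK : IsOpen K)
    {f : Plane → ℝ} (hf : Continuous f) {x : Plane} (hx : x ∈ K) :
    Filter.Tendsto (fun n : ℕ => ∫ y in K, ((n : ℝ) + 1) ^ 2 *
      (η (((n : ℝ) + 1 + 1) • x - ((n : ℝ) + 1) • y - c) * f y)) Filter.atTop (nhds (f x)) := by
  rw [Metric.tendsto_atTop]
  intro ε hε
  obtain ⟨r1, hr1, hb1⟩ := Metric.isOpen_iff.1 hK x hx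
  obtain ⟨r2, hr2, hb2⟩ := Metric.continuous_iff.1 hf x (ε / 2) (by positivity)
  set r := min r1 r2 with hr
  have hrp : 0 < r := lt_min hr1 hr2
  -- Where the kernel is nonzero, `N(y - x) = (x - c) - z` with `‖z‖ ≤ ρ`, so `y` is within `(‖x -
  -- c‖ + ρ)/N` of `x`; this threshold makes that distance smaller than `r`.
  obtain ⟨n0, hn0⟩ := exists_nat_gt ((‖x - c‖ + ρ) / r)
  refine ⟨n0, fun n hn => ?_⟩
  set N : ℝ := (n : ℝ) + 1 with hN
  have hNp : 0 < N := by positivity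
  have hdist (y : Plane) (hy : η ((N + 1) • x - N • y - c) ≠ 0) : dist y x < r := by
    have h2 := hsupp hy
    rw [mem_closedBall_zero_iff] at h2
    have h3 : N * ‖y - x‖ ≤ ‖x - c‖ + ρ := by
      have e : N • (y - x) = (x - c) - ((N + 1) • x - N • y - c) := by module
      calc N * ‖y - x‖ = ‖N • (y - x)‖ := by rw [norm_smul, Real.norm_of_nonneg hNp.le]
        _ ≤ ‖x - c‖ + ‖(N + 1) • x - N • y - c‖ := by rw [e]; exact norm_sub_le _ _
        _ ≤ ‖x - c‖ + ρ := by gcongr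
    rw [div_lt_iff₀ hrp] at hn0
    have h5 : (n0 : ℝ) ≤ n := by exact_mod_cast hn
    rw [dist_eq_norm]
    by_contra! h6
    have h7 : (n0 : ℝ) * r < N * r := by
      apply mul_lt_mul_of_pos_right _ hrp
      linarith
    have h8 : N * r ≤ N * ‖y - x‖ := by gcongr
    linarith
  have hloc (y : Plane) (hy : η ((N + 1) • x - N • y - c) ≠ 0) : y ∈ K ∧ |f y - f x| < ε / 2 := by
    have h4 := hdist y hy
    refine ⟨hb1 (h4.trans_le (min_le_left _ _)), ?_⟩
    have := hb2 y (h4.trans_le (min_le_right _ _))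
    rwa [Real.dist_eq] at this
  have hint : Integrable (fun y => N ^ 2 * η ((N + 1) • x - N • y - c)) := by
    have := (integrable_kernel_right hc hs hNp.ne' ((N + 1) • x - c)).const_mul (N ^ 2)
    refine this.congr (Filter.Eventually.of_forall fun y => ?_)
    simp only
    congr 2; abel
  -- For these `N` the support in `y` lies in `K`, so restricting the integral loses no mass and
  -- `N²` is exactly the Jacobian factor.
  have hone : ∫ y in K, N ^ 2 * η ((N + 1) • x - N • y - c) = 1 := by
    rw [setIntegral_eq_integral_of_forall_compl_eq_zero fun y hy => by
      by_contra h
      exact hy (hloc y fun h' => h (by rw [h', mul_zero])).1]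
    have e (y : Plane) : (N + 1) • x - N • y - c = ((N + 1) • x - c) - N • y := by abel
    simp only [e]
    rw [integral_const_mul, integral_kernel_right, h1, mul_one, mul_inv_cancel₀ (by positivity)]
  have hintf : Integrable (fun y => N ^ 2 * (η ((N + 1) • x - N • y - c) * f y)) := by
    refine Continuous.integrable_of_hasCompactSupport (by fun_prop) ?_
    have h5 : HasCompactSupport fun y => η ((N + 1) • x - N • y - c) := by
      refine HasCompactSupport.intro (isCompact_closedBall x r) fun y hy => ?_
      by_contra h
      exact hy (Metric.mem_closedBall.2 (hdist y h).le)
    exact (h5.mul_right).mul_left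
  have hdiff : (∫ y in K, N ^ 2 * (η ((N + 1) • x - N • y - c) * f y)) - f x =
      ∫ y in K, N ^ 2 * η ((N + 1) • x - N • y - c) * (f y - f x) := by
    have h6 : f x = ∫ y in K, N ^ 2 * η ((N + 1) • x - N • y - c) * f x := by
      rw [integral_mul_const, hone, one_mul]
    conv_lhs => rw [h6]
    rw [← integral_sub hintf.integrableOn (hint.integrableOn.mul_const _)]
    refine integral_congr_ae (Filter.Eventually.of_forall fun y => ?_)
    simp only
    ring
  rw [Real.dist_eq, hdiff]
  have hbd : |∫ y in K, N ^ 2 * η ((N + 1) • x - N • y - c) * (f y - f x)| ≤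
      ∫ y in K, N ^ 2 * η ((N + 1) • x - N • y - c) * (ε / 2) := by
    rw [← Real.norm_eq_abs]
    refine norm_integral_le_of_norm_le (hint.integrableOn.mul_const _)
      (Filter.Eventually.of_forall fun y => ?_)
    rw [norm_mul, Real.norm_of_nonneg (mul_nonneg (sq_nonneg N) (h0 _)), Real.norm_eq_abs]
    by_cases hy : η ((N + 1) • x - N • y - c) = 0
    · simp [hy]
    · exact mul_le_mul_of_nonneg_left (hloc y hy).2.le (mul_nonneg (sq_nonneg N) (h0 _))
  rw [integral_mul_const, hone] at hbd
  linarith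

lemma integrable_kernel_mul (hc : Continuous η) (hs : HasCompactSupport η) (N : ℝ)
    {μ : Measure (Plane × Plane)} {F : Plane × Plane → ℝ} (hF : Integrable F μ) :
    Integrable (fun z : Plane × Plane => N ^ 2 * η ((N + 1) • z.1 - N • z.2 - c) * F z) μ := by
  obtain ⟨M, hM⟩ := exists_bound_kernel hc hs
  have h1 : Continuous fun z : Plane × Plane => N ^ 2 * η ((N + 1) • z.1 - N • z.2 - c) := by
    fun_prop
  refine hF.bdd_mul (c := N ^ 2 * M) h1.aestronglyMeasurable
    (Filter.Eventually.of_forall fun z => ?_)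
  rw [norm_mul, Real.norm_of_nonneg (sq_nonneg N)]
  exact mul_le_mul_of_nonneg_left (hM _) (sq_nonneg N)

lemma integrable_norm_sq {f : Plane → Plane} (hf : MemLp f 2 (volume.restrict K)) :
    Integrable (fun x => ‖f x‖ ^ 2) (volume.restrict K) :=
  (memLp_two_iff_integrable_sq_norm hf.aestronglyMeasurable).1 hf

/-- Schur's bound for the mollified inner product. -/
lemma abs_kernel_form_le (hc : Continuous η) (hs : HasCompactSupport η)
    (h0 : ∀ z, 0 ≤ η z) (h1 : ∫ z, η z = 1) (hK : volume K < ⊤) {N : ℝ} (hN : 0 < N)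
    {f g : Plane → Plane} (hf : MemLp f 2 (volume.restrict K))
    (hg : MemLp g 2 (volume.restrict K)) {l : ℝ} (hl : 0 < l) :
    |∫ x in K, ∫ y in K, N ^ 2 * η ((N + 1) • x - N • y - c) * ⟪f y, g x⟫| ≤
      (l * ∫ x in K, ‖f x‖ ^ 2) + l⁻¹ * ∫ x in K, ‖g x‖ ^ 2 := by
  have hfin : IsFiniteMeasure (volume.restrict K) := ⟨by rwa [Measure.restrict_apply_univ]⟩
  set μ := volume.restrict K with hμ
  have hF : Integrable (fun z : Plane × Plane =>
      N ^ 2 * η ((N + 1) • z.1 - N • z.2 - c) * ⟪f z.2, g z.1⟫) (μ.prod μ) := by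
    have := (integrable_kernel_inner (N := N) (c := c) hc hs hK hf hg).const_mul (N ^ 2)
    refine this.congr (Filter.Eventually.of_forall fun z => ?_)
    simp only
    ring
  have hf2 : Integrable (fun z : Plane × Plane => ‖f z.2‖ ^ 2) (μ.prod μ) :=
    (integrable_norm_sq hf).comp_snd μ
  have hg2 : Integrable (fun z : Plane × Plane => ‖g z.1‖ ^ 2) (μ.prod μ) :=
    (integrable_norm_sq hg).comp_fst μ
  have hA := integrable_kernel_mul (c := c) hc hs N hf2
  have hB := integrable_kernel_mul (c := c) hc hs N hg2
  -- Young's inequality with a free weight. The kernel has mass at most 1 in each variable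
  -- separately, so the two squares can be integrated independently; the weight `l` is chosen later.
  have key (s t : ℝ) : s * t ≤ l * s ^ 2 + l⁻¹ * t ^ 2 := by
    have e : l * s ^ 2 + l⁻¹ * t ^ 2 - 2 * (s * t) = l⁻¹ * (l * s - t) ^ 2 := by
      field_simp; ring
    have e2 : 0 ≤ l⁻¹ * (l * s - t) ^ 2 := by positivity
    have e3 : 0 ≤ l⁻¹ * (l * s + t) ^ 2 := by positivity
    have e4 : l * s ^ 2 + l⁻¹ * t ^ 2 + 2 * (s * t) = l⁻¹ * (l * s + t) ^ 2 := by
      field_simp; ring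
    rcases le_total 0 (s * t) with h | h <;> linarith
  have hbound : |∫ z, N ^ 2 * η ((N + 1) • z.1 - N • z.2 - c) * ⟪f z.2, g z.1⟫ ∂(μ.prod μ)| ≤
      ∫ z, (l * (N ^ 2 * η ((N + 1) • z.1 - N • z.2 - c) * ‖f z.2‖ ^ 2) +
        l⁻¹ * (N ^ 2 * η ((N + 1) • z.1 - N • z.2 - c) * ‖g z.1‖ ^ 2)) ∂(μ.prod μ) := by
    rw [← Real.norm_eq_abs]
    refine norm_integral_le_of_norm_le ((hA.const_mul l).add (hB.const_mul l⁻¹))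
      (Filter.Eventually.of_forall fun z => ?_)
    have hk : 0 ≤ N ^ 2 * η ((N + 1) • z.1 - N • z.2 - c) := mul_nonneg (sq_nonneg N) (h0 _)
    rw [norm_mul, Real.norm_of_nonneg hk]
    calc _ ≤ N ^ 2 * η ((N + 1) • z.1 - N • z.2 - c) * (‖f z.2‖ * ‖g z.1‖) := by
          gcongr; exact norm_inner_le_norm _ _
      _ ≤ N ^ 2 * η ((N + 1) • z.1 - N • z.2 - c) * (l * ‖f z.2‖ ^ 2 + l⁻¹ * ‖g z.1‖ ^ 2) := by
          gcongr; exact key _ _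
      _ = _ := by ring
  rw [integral_prod _ hF, integral_add (hA.const_mul l) (hB.const_mul l⁻¹), integral_const_mul,
    integral_const_mul, integral_prod_symm _ hA, integral_prod _ hB] at hbound
  refine hbound.trans (add_le_add ?_ ?_)
  · refine mul_le_mul_of_nonneg_left ?_ hl.le
    refine integral_mono hA.integral_prod_right (integrable_norm_sq hf) fun y => ?_
    simp only
    rw [integral_mul_const]
    have e (x : Plane) : (N + 1) • x - N • y - c = (N + 1) • x - (N • y + c) := by abel
    simp only [e]
    exact mul_le_of_le_one_left (sq_nonneg _) (setIntegral_kernel_left_le hc hs h0 h1 hN _)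
  · refine mul_le_mul_of_nonneg_left ?_ (inv_nonneg.2 hl.le)
    refine integral_mono hB.integral_prod_left (integrable_norm_sq hg) fun x => ?_
    simp only
    rw [integral_mul_const]
    have e (y : Plane) : (N + 1) • x - N • y - c = ((N + 1) • x - c) - N • y := by abel
    simp only [e]
    exact mul_le_of_le_one_left (sq_nonneg _) (setIntegral_kernel_right_le hc hs h0 h1 hN _)

/-- Dominated convergence in `x`: the inner integral converges pointwise to `⟪f x, g x⟫` and is
bounded by `sup ‖f‖ · ‖g x‖`. -/
lemma tendsto_kernel_form_of_continuous (hc : Continuous η) (hs : HasCompactSupport η)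
    (h0 : ∀ z, 0 ≤ η z) (h1 : ∫ z, η z = 1)
    (hsupp : Function.support η ⊆ Metric.closedBall 0 ρ) (hK : IsOpen K) (hKf : volume K < ⊤)
    {f g : Plane → Plane} (hf : Continuous f) (hfs : HasCompactSupport f)
    (hg : MemLp g 2 (volume.restrict K)) :
    Filter.Tendsto (fun n : ℕ => ∫ x in K, ∫ y in K, ((n : ℝ) + 1) ^ 2 *
      η (((n : ℝ) + 1 + 1) • x - ((n : ℝ) + 1) • y - c) * ⟪f y, g x⟫) Filter.atTop
      (nhds (∫ x in K, ⟪f x, g x⟫)) := by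
  have hfin : IsFiniteMeasure (volume.restrict K) := ⟨by rwa [Measure.restrict_apply_univ]⟩
  obtain ⟨M, hM⟩ : ∃ M, ∀ x, ‖f x‖ ≤ M := hf.bounded_above_of_compact_support hfs
  have hM0 : 0 ≤ M := (norm_nonneg _).trans (hM 0)
  have hfm : MemLp f 2 (volume.restrict K) := hf.memLp_of_hasCompactSupport hfs
  have hg1 := (hg.integrable (by norm_num)).norm
  refine tendsto_integral_of_dominated_convergence (fun x => M * ‖g x‖) (fun n => ?_)
    (hg1.const_mul M) (fun n => Filter.Eventually.of_forall fun x => ?_) ?_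
  · have hF : Integrable (fun z : Plane × Plane => ((n : ℝ) + 1) ^ 2 *
        η (((n : ℝ) + 1 + 1) • z.1 - ((n : ℝ) + 1) • z.2 - c) * ⟪f z.2, g z.1⟫)
        ((volume.restrict K).prod (volume.restrict K)) := by
      have := (integrable_kernel_inner (N := (n : ℝ) + 1) (c := c) hc hs hKf hfm hg).const_mul
        (((n : ℝ) + 1) ^ 2)
      refine this.congr (Filter.Eventually.of_forall fun z => ?_)
      simp only
      ring
    exact hF.integral_prod_left.aestronglyMeasurable
  · have hN : (0 : ℝ) < (n : ℝ) + 1 := by positivity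
    set N : ℝ := (n : ℝ) + 1
    have e (y : Plane) : (N + 1) • x - N • y - c = ((N + 1) • x - c) - N • y := by abel
    simp only [e]
    have hi := ((integrable_kernel_right hc hs hN.ne' ((N + 1) • x - c)).const_mul
      (N ^ 2)).integrableOn (s := K)
    calc ‖∫ y in K, N ^ 2 * η ((N + 1) • x - c - N • y) * ⟪f y, g x⟫‖
        ≤ ∫ y in K, N ^ 2 * η ((N + 1) • x - c - N • y) * (M * ‖g x‖) := by
          refine norm_integral_le_of_norm_le (hi.mul_const _)
            (Filter.Eventually.of_forall fun y => ?_)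
          have hk : 0 ≤ N ^ 2 * η ((N + 1) • x - c - N • y) := mul_nonneg (sq_nonneg N) (h0 _)
          rw [norm_mul, Real.norm_of_nonneg hk]
          gcongr
          exact (norm_inner_le_norm _ _).trans (by gcongr; exact hM y)
      _ = (∫ y in K, N ^ 2 * η ((N + 1) • x - c - N • y)) * (M * ‖g x‖) := integral_mul_const _ _
      _ ≤ M * ‖g x‖ := mul_le_of_le_one_left (by positivity)
          (setIntegral_kernel_right_le hc hs h0 h1 hN _)
  · refine (ae_restrict_iff' hK.measurableSet).2 (Filter.Eventually.of_forall fun x hx => ?_)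
    have := tendsto_mollify (c := c) hc hs h0 h1 hsupp hK (f := fun y => ⟪f y, g x⟫)
      (by fun_prop) hx
    simpa only [mul_assoc] using this

lemma tendsto_kernel_form (hc : Continuous η) (hs : HasCompactSupport η)
    (h0 : ∀ z, 0 ≤ η z) (h1 : ∫ z, η z = 1)
    (hsupp : Function.support η ⊆ Metric.closedBall 0 ρ) (hK : IsOpen K) (hKf : volume K < ⊤)
    (f g : L2V K) :
    Filter.Tendsto (fun n : ℕ => ∫ x in K, ∫ y in K, ((n : ℝ) + 1) ^ 2 *
      η (((n : ℝ) + 1 + 1) • x - ((n : ℝ) + 1) • y - c) * ⟪f y, g x⟫) Filter.atTop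
      (nhds ⟪f, g⟫) := by
  have hfin : IsFiniteMeasure (volume.restrict K) := ⟨by rwa [Measure.restrict_apply_univ]⟩
  rw [Metric.tendsto_atTop]
  intro ε hε
  set G := ‖g‖ ^ 2 with hG
  have hnorm (h : L2V K) : ∫ x in K, ‖h x‖ ^ 2 = ‖h‖ ^ 2 := by
    rw [← real_inner_self_eq_norm_sq, L2.inner_def]
    simp only [real_inner_self_eq_norm_sq]
  -- Chosen so that the total error `δ(1 + ‖g‖² + ‖g‖)` of replacing `f` by a continuous field stays
  -- below `ε/2`.
  set δ := min 1 (ε / (4 * (2 + G + ‖g‖))) with hδ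
  have hGn : 0 ≤ G := sq_nonneg _
  have hgn : 0 ≤ ‖g‖ := norm_nonneg _
  have hδp : 0 < δ := lt_min one_pos (by positivity)
  have hδε : δ * (1 + G + ‖g‖) < ε / 2 := by
    have h2 : δ ≤ ε / (4 * (2 + G + ‖g‖)) := min_le_right _ _
    rw [le_div_iff₀ (by positivity)] at h2
    nlinarith
  obtain ⟨f0, hf0s, hf0, hf0c, hf0m⟩ := (Lp.memLp f).exists_hasCompactSupport_eLpNorm_sub_le
    (by norm_num) (ε := ENNReal.ofReal δ) (by simpa using hδp)
  set F0 : L2V K := hf0m.toLp f0 with hF0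
  have hsub : ‖f - F0‖ ≤ δ := by
    rw [Lp.norm_def]
    refine ENNReal.toReal_le_of_le_ofReal hδp.le ?_
    refine le_trans (le_of_eq (eLpNorm_congr_ae ?_)) hf0
    filter_upwards [Lp.coeFn_sub f F0, hf0m.coeFn_toLp] with x hx1 hx2
    rw [hx1, Pi.sub_apply, Pi.sub_apply, hx2]
  have hlim := tendsto_kernel_form_of_continuous (c := c) hc hs h0 h1 hsupp hK hKf hf0c hf0s
    (Lp.memLp g)
  obtain ⟨n0, hn0⟩ := Metric.tendsto_atTop.1 hlim (ε / 2) (by positivity)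
  refine ⟨n0, fun n hn => ?_⟩
  have h2 := hn0 n hn
  have hN : (0 : ℝ) < (n : ℝ) + 1 := by positivity
  set N : ℝ := (n : ℝ) + 1
  have hF (h : Plane → Plane) (hm : MemLp h 2 (volume.restrict K)) :
      Integrable (fun z : Plane × Plane => N ^ 2 * η ((N + 1) • z.1 - N • z.2 - c) * ⟪h z.2, g z.1⟫)
        ((volume.restrict K).prod (volume.restrict K)) := by
    have := (integrable_kernel_inner (N := N) (c := c) hc hs hKf hm (Lp.memLp g)).const_mul (N ^ 2)
    refine this.congr (Filter.Eventually.of_forall fun z => ?_)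
    simp only
    ring
  have hsplit : (∫ x in K, ∫ y in K, N ^ 2 * η ((N + 1) • x - N • y - c) * ⟪f y, g x⟫) -
      (∫ x in K, ∫ y in K, N ^ 2 * η ((N + 1) • x - N • y - c) * ⟪f0 y, g x⟫) =
      ∫ x in K, ∫ y in K, N ^ 2 * η ((N + 1) • x - N • y - c) * ⟪(f - F0 : L2V K) y, g x⟫ := by
    have e1 := integral_prod _ (hF f (Lp.memLp f))
    have e2 := integral_prod _ (hF f0 hf0m)
    have e3 := integral_prod _ (hF (f - F0 : L2V K) (Lp.memLp (f - F0)))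
    simp only at e1 e2 e3
    rw [← e1, ← e2, ← e3, ← integral_sub (hF f (Lp.memLp f)) (hF f0 hf0m)]
    refine integral_congr_ae ?_
    have hae : ∀ᵐ y ∂(volume.restrict K), (f - F0 : L2V K) y = f y - f0 y := by
      filter_upwards [Lp.coeFn_sub f F0, hf0m.coeFn_toLp] with x hx1 hx2
      rw [hx1, Pi.sub_apply, hx2]
    filter_upwards [Measure.quasiMeasurePreserving_snd.ae hae] with z hz
    rw [hz, inner_sub_left]; ring
  -- With weight `δ⁻¹` the bound becomes `δ⁻¹‖f - F0‖² + δ‖g‖² ≤ δ + δ‖g‖²`, uniformly in `N`.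
  have hb := abs_kernel_form_le (c := c) hc hs h0 h1 hKf hN (Lp.memLp (f - F0)) (Lp.memLp g)
    (inv_pos.2 hδp)
  rw [← hsplit, hnorm, hnorm, inv_inv] at hb
  have hb2 : δ⁻¹ * ‖f - F0‖ ^ 2 ≤ δ := by
    rw [inv_mul_le_iff₀ hδp, ← sq]
    exact pow_le_pow_left₀ (norm_nonneg _) hsub 2
  have hi : ∫ x in K, ⟪f0 x, g x⟫ = ⟪F0, g⟫ := by
    rw [L2.inner_def]
    refine integral_congr_ae ?_
    filter_upwards [hf0m.coeFn_toLp] with x hx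
    rw [hx]
  have hi2 : |⟪F0, g⟫ - ⟪f, g⟫| ≤ δ * ‖g‖ := by
    rw [← inner_sub_left]
    refine (abs_real_inner_le_norm _ _).trans ?_
    rw [norm_sub_rev]
    gcongr
  rw [hi, Real.dist_eq] at h2
  rw [Real.dist_eq]
  have := abs_lt.1 h2
  have := abs_le.1 hb
  have := abs_le.1 hi2
  rw [abs_lt]
  constructor <;> nlinarith

end Limit

/-- Fields whose trace vanishes are orthogonal to all of `H(∇div, K)` with respect to the duality. -/
theorem inner_eq_of_trace_zero {K : Set Plane} (hKo : IsOpen K) (hK : Convex ℝ K)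
    (hb : Bornology.IsBounded K) (hne : K.Nonempty) {u G v g : L2V K}
    (hu : ∀ φ : Plane → Plane, ContDiff ℝ ∞ φ →
      ∫ x in K, ⟪u x, classicalGradDiv φ x⟫ = ∫ x in K, ⟪G x, φ x⟫)
    (hv : IsWeakGradDiv K v g) : ⟪u, g⟫ = ⟪G, v⟫ := by
  obtain ⟨c, hc⟩ := hne
  obtain ⟨ρ, hρ, hball⟩ := Metric.nhds_basis_closedBall.mem_iff.1 (hKo.mem_nhds hc)
  let b : ContDiffBump (0 : Plane) := ⟨ρ / 2, ρ, by positivity, by linarith⟩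
  set η : Plane → ℝ := b.normed volume with hη
  have hcd : ContDiff ℝ ∞ η := b.contDiff_normed
  have hcs : HasCompactSupport η := b.hasCompactSupport_normed
  have h0 : ∀ z, 0 ≤ η z := b.nonneg_normed
  have h1 : ∫ z, η z = 1 := b.integral_normed
  have hsupp : Function.support η ⊆ Metric.closedBall 0 ρ := by
    rw [hη, b.support_normed_eq]; exact Metric.ball_subset_closedBall
  have hfin : volume K < ⊤ := hb.measure_lt_top
  have t1 := tendsto_kernel_form (c := c) hcd.continuous hcs h0 h1 hsupp hKo hfin u g
  have t2 := tendsto_kernel_form (c := c) hcd.continuous hcs h0 h1 hsupp hKo hfin G v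
  -- This is the ratio `((N+1)/N)²` between the two sides of `kernel_identity`, with `N = n + 1`.
  have t3 : Filter.Tendsto (fun n : ℕ => (1 + 1 / ((n : ℝ) + 1)) ^ 2) Filter.atTop (nhds 1) := by
    have := ((tendsto_one_div_add_atTop_nhds_zero_nat (𝕜 := ℝ)).const_add 1).pow 2
    simpa using this
  have t4 := t3.mul t2
  rw [one_mul] at t4
  refine tendsto_nhds_unique t1 (t4.congr fun n => ?_)
  have hN : (0 : ℝ) < (n : ℝ) + 1 := by positivity
  have hid := kernel_identity hcd hcs hsupp hK hKo.measurableSet hb hball hu hv hN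
  simp only [mul_assoc, integral_const_mul]
  rw [hid]
  field_simp



end

end GradDivFortin

namespace GradDivFortin

noncomputable section

variable (T : Affine.Triangle ℝ Plane)

/-! ### Integrals of products of affine functions -/

/-- The affine function with vertex values `u`. -/
def aff (u : Fin 3 → ℝ) (x : Plane) : ℝ := ∑ k, u k * lam T k x

lemma lam_zero (x : Plane) : lam T 0 x = 1 - lam T 1 x - lam T 2 x := by
  linarith [sum_lam T x]

lemma aff_single (i : Fin 3) (x : Plane) : aff T (Pi.single i 1) x = lam T i x := by
  rw [aff, Finset.sum_eq_single i]
  · simp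
  · intro j _ hj; simp [hj]
  · simp

lemma aff_const (c : ℝ) (x : Plane) : aff T (fun _ => c) x = c := by
  rw [aff, ← Finset.mul_sum, Fin.sum_univ_three, sum_lam, mul_one]

lemma aff_sub (u v : Fin 3 → ℝ) (x : Plane) : aff T (u - v) x = aff T u x - aff T v x := by
  simp [aff, sub_mul, Finset.sum_sub_distrib]

lemma aff_smul (c : ℝ) (u : Fin 3 → ℝ) (x : Plane) : aff T (c • u) x = c * aff T u x := by
  simp [aff, Finset.mul_sum, mul_assoc]

lemma continuous_aff (u : Fin 3 → ℝ) : Continuous (aff T u) := by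
  have := continuous_lam T
  unfold aff
  fun_prop

/-- By multilinearity this encodes `∫ λᵢλⱼλₖ = (A/60)·m`, with `m = 6`, `2` or `1` when three,
exactly two or none of the indices coincide; the power sums reproduce `m` as `1 + 3 + 2`, `1 + 1`
and `1`. -/
lemma setIntegral_aff_mul (u v w : Fin 3 → ℝ) :
    ∫ x in cell T, aff T u x * aff T v x * aff T w x =
      area T / 60 * ((∑ k, u k) * (∑ k, v k) * (∑ k, w k) + (∑ k, u k) * (∑ k, v k * w k)
        + (∑ k, v k) * (∑ k, u k * w k) + (∑ k, w k) * (∑ k, u k * v k)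
        + 2 * ∑ k, u k * v k * w k) := by
  let a := u 0; let b := u 1 - u 0; let c := u 2 - u 0
  let a' := v 0; let b' := v 1 - v 0; let c' := v 2 - v 0
  let a'' := w 0; let b'' := w 1 - w 0; let c'' := w 2 - w 0
  rw [setIntegral_cubic T ![a * a' * a'', a * a' * b'' + a * b' * a'' + b * a' * a'',
    a * a' * c'' + a * c' * a'' + c * a' * a'',
    a * b' * b'' + b * a' * b'' + b * b' * a'',
    a * b' * c'' + a * c' * b'' + b * a' * c'' + b * c' * a'' + c * a' * b'' + c * b' * a'',
    a * c' * c'' + c * a' * c'' + c * c' * a'', b * b' * b'',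
    b * b' * c'' + b * c' * b'' + c * b' * b'', b * c' * c'' + c * b' * c'' + c * c' * b'',
    c * c' * c'']]
  · simp [Fin.sum_univ_three, a, b, c, a', b', c', a'', b'', c'']
    ring
  · intro x
    simp [aff, Fin.sum_univ_three, lam_zero, a, b, c, a', b', c', a'', b'', c'']
    ring

/-! ### Polynomial fields -/

lemma hasFDerivAt_sub_const (p x : Plane) :
    HasFDerivAt (fun y : Plane => y - p) (ContinuousLinearMap.id ℝ Plane) x :=
  (hasFDerivAt_id x).sub_const p

lemma divergence_sub_const (p x : Plane) : divergence (fun y => y - p) x = 2 := by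
  simp [divergence, (hasFDerivAt_sub_const p x).fderiv]

/-- The field `f(x)(x - pᵢ)`, where `pᵢ` is a vertex of `T`. -/
def rad (i : Fin 3) (f : Plane → ℝ) (hf : ContDiff ℝ ∞ f) : smoothFields :=
  ⟨fun x => f x • (x - T.points i), hf.smul (contDiff_id.sub contDiff_const)⟩

lemma rad_apply (i : Fin 3) {f : Plane → ℝ} (hf : ContDiff ℝ ∞ f) (x : Plane) :
    (rad T i f hf : Plane → Plane) x = f x • (x - T.points i) := rfl

lemma divergence_rad (i : Fin 3) {f : Plane → ℝ} (hf : ContDiff ℝ ∞ f) (x : Plane) :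
    divergence (rad T i f hf : Plane → Plane) x = 2 * f x + fderiv ℝ f x (x - T.points i) := by
  change divergence (fun x => f x • (x - T.points i)) x = _
  rw [divergence_smul (hf.differentiable (by simp) x) (hasFDerivAt_sub_const _ x).differentiableAt,
    divergence_sub_const]
  ring

/-- The divergence on smooth fields. -/
def sdiv : smoothFields →ₗ[ℝ] (Plane → ℝ) where
  toFun F := divergence F
  map_add' F G := by
    funext x
    have hF := (ContDiff.differentiable (𝕜 := ℝ) (n := ∞) F.2 (by simp)) x
    have hG := (ContDiff.differentiable (𝕜 := ℝ) (n := ∞) G.2 (by simp)) x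
    simp [divergence, fderiv_add hF hG, Finset.sum_add_distrib]
  map_smul' c F := by
    funext x
    have hF := (ContDiff.differentiable (𝕜 := ℝ) (n := ∞) F.2 (by simp)) x
    simp [divergence, fderiv_const_smul hF]
    ring

lemma sdiv_apply (F : smoothFields) : sdiv F = divergence F := rfl

lemma inner_gradDiv_ofSmooth (F G : smoothFields) :
    ⟪(ofSmooth T F : L2V (cell T)), gradDiv (ofSmooth T G)⟫ =
      ∫ x in cell T, fderiv ℝ (sdiv G) x ((F : Plane → Plane) x) := by
  rw [gradDiv_ofSmooth]
  change ⟪toL2V T (ContDiff.continuous (𝕜 := ℝ) (n := ∞) F.2), _⟫ = _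
  rw [inner_toL2V]
  refine integral_congr_ae (Filter.Eventually.of_forall fun x => ?_)
  simp only [classicalGradDiv]
  rw [real_inner_comm, inner_gradient, sdiv_apply]

/-! ### The explicit trial fields and their divergences. -/

/-- The product of the barycentric coordinates. -/
def bub (x : Plane) : ℝ := lam T 0 x * lam T 1 x * lam T 2 x

lemma contDiff_bub : ContDiff ℝ ∞ (bub T) :=
  ((contDiff_lam T 0).mul (contDiff_lam T 1)).mul (contDiff_lam T 2)

lemma hasFDerivAt_lam_mul (i j : Fin 3) (x : Plane) :
    HasFDerivAt (fun y => lam T i y * lam T j y) (lam T i x • dlam T j + lam T j x • dlam T i) x :=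
  (hasFDerivAt_lam T i x).mul (hasFDerivAt_lam T j x)

lemma hasFDerivAt_bub (x : Plane) : HasFDerivAt (bub T) ((lam T 0 x * lam T 1 x) • dlam T 2 +
    lam T 2 x • (lam T 0 x • dlam T 1 + lam T 1 x • dlam T 0)) x :=
  (hasFDerivAt_lam_mul T 0 1 x).mul (hasFDerivAt_lam T 2 x)

lemma hasFDerivAt_lam_sq (i : Fin 3) (x : Plane) :
    HasFDerivAt (fun y => lam T i y ^ 2) ((2 * lam T i x) • dlam T i) x := by
  have := hasFDerivAt_lam_mul T i i x
  simp only [← sq] at this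
  refine this.congr_fderiv ?_
  rw [two_mul, add_smul]

/-- The field `x - pᵢ`. -/
def fieldX (i : Fin 3) : smoothFields := rad T i (fun _ => 1) contDiff_const

/-- The field `λᵢ(x - pᵢ)`. -/
def fieldY (i : Fin 3) : smoothFields := rad T i (lam T i) (contDiff_lam T i)

/-- The field `λᵢ²(x - pᵢ)`. -/
def fieldS (i : Fin 3) : smoothFields :=
  rad T i (fun x => lam T i x ^ 2) ((contDiff_lam T i).pow 2)

/-- The field `λⱼλₖ(x - pᵢ)`, where `i`, `j`, `k` are distinct. -/
def fieldW (i : Fin 3) : smoothFields :=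
  rad T i (fun x => lam T (i + 1) x * lam T (i + 2) x)
    ((contDiff_lam T (i + 1)).mul (contDiff_lam T (i + 2)))

/-- A field with vanishing normal trace whose divergence is equal to one on the boundary. -/
def fieldU : smoothFields :=
  ∑ i, rad T i (fun x => 1 / 2 * lam T i x ^ 2 - 4 * bub T x)
    ((contDiff_const.mul ((contDiff_lam T i).pow 2)).sub (contDiff_const.mul (contDiff_bub T)))

/-- A constant field. -/
def fieldC (w : Plane) : smoothFields := ⟨fun _ => w, show ContDiff ℝ ∞ (fun _ : Plane => w) from contDiff_const⟩

lemma sdiv_fieldX (i : Fin 3) : sdiv (fieldX T i) = fun _ => 2 := by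
  funext x
  rw [sdiv_apply, fieldX, divergence_rad]
  simp

lemma sdiv_fieldY (i : Fin 3) : sdiv (fieldY T i) = fun x => 3 * lam T i x - 1 := by
  funext x
  rw [sdiv_apply, fieldY, divergence_rad, (hasFDerivAt_lam T i x).fderiv, dlam_sub_point]
  simp; ring

lemma sdiv_fieldS (i : Fin 3) :
    sdiv (fieldS T i) = fun x => 4 * lam T i x ^ 2 - 2 * lam T i x := by
  funext x
  rw [sdiv_apply, fieldS, divergence_rad, (hasFDerivAt_lam_sq T i x).fderiv]
  simp [dlam_sub_point]; ring

lemma add_one_ne (i : Fin 3) : i + 1 ≠ i := by fin_cases i <;> decide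

lemma add_two_ne (i : Fin 3) : i + 2 ≠ i := by fin_cases i <;> decide

lemma sdiv_fieldW (i : Fin 3) :
    sdiv (fieldW T i) = fun x => 4 * (lam T (i + 1) x * lam T (i + 2) x) := by
  funext x
  rw [sdiv_apply, fieldW, divergence_rad, (hasFDerivAt_lam_mul T _ _ x).fderiv]
  simp only [add_apply, smul_apply, smul_eq_mul,
    dlam_sub_point, add_one_ne, add_two_ne, if_false]
  ring

/-- With `σ = λ₀λ₁ + λ₁λ₂ + λ₂λ₀`, the square terms contribute `2∑λᵢ² - 1 = 1 - 4σ` and the bubble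
terms contribute `4σ - 60 λ₀λ₁λ₂`. The factor 4 in the field is what cancels `σ`, leaving 1 on the
boundary. -/
lemma sdiv_fieldU : sdiv (fieldU T) = fun x => 1 - 60 * bub T x := by
  funext x
  have h (i : Fin 3) : HasFDerivAt (fun x => 1 / 2 * lam T i x ^ 2 - 4 * bub T x)
      ((1 / 2 : ℝ) • ((2 * lam T i x) • dlam T i) - (4 : ℝ) • ((lam T 0 x * lam T 1 x) • dlam T 2 +
    lam T 2 x • (lam T 0 x • dlam T 1 + lam T 1 x • dlam T 0))) x :=
    ((hasFDerivAt_lam_sq T i x).const_mul _).sub ((hasFDerivAt_bub T x).const_mul _)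
  rw [fieldU, map_sum, Finset.sum_apply]
  simp only [sdiv_apply, divergence_rad, (h _).fderiv]
  simp [Fin.sum_univ_three, dlam_sub_point, lam_zero, bub]
  ring

lemma sdiv_fieldC (w : Plane) : sdiv (fieldC w) = fun _ => 0 := by
  funext x
  simp [sdiv_apply, fieldC, divergence]

/-- This is the barycentric representation `x = ∑ λᵢ pᵢ`. The resulting linear dependence is
essential later: it constrains the data of the moment problem. -/
lemma sum_fieldY : ∑ i, fieldY T i = 0 := by
  ext x : 2
  have h := eq_sum_dlam T (x - T.points 0)
  simp only [dlam_sub_point, show ((1 : Fin 3) = 0) = False by simp,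
    show ((2 : Fin 3) = 0) = False by simp, if_false, sub_zero] at h
  have h1 : x = T.points 0 + (lam T 1 x • (T.points 1 - T.points 0) +
    lam T 2 x • (T.points 2 - T.points 0)) := by rw [← h]; abel
  simp only [Fin.sum_univ_three, fieldY]
  change lam T 0 x • (x - T.points 0) + lam T 1 x • (x - T.points 1)
    + lam T 2 x • (x - T.points 2) = 0
  have h2 : lam T 0 x • (x - T.points 0) + lam T 1 x • (x - T.points 1)
    + lam T 2 x • (x - T.points 2) = (x - T.points 0) - (lam T 1 x • (T.points 1 - T.points 0) +
    lam T 2 x • (T.points 2 - T.points 0)) := by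
    rw [lam_zero]; module
  rw [h2, ← h, sub_self]

lemma fieldX_sub (i j : Fin 3) : fieldX T i - fieldX T j = fieldC (T.points j - T.points i) := by
  ext x : 2
  change (1 : ℝ) • (x - T.points i) - (1 : ℝ) • (x - T.points j) = T.points j - T.points i
  module

/-! ### Moments of polynomial fields -/

/-- Since `dλᵢ(x - pₗ) = λᵢ - δᵢₗ`, the integrand is a product of affine functions. The other
moments are reduced in the same way, padded to three affine factors if necessary; those of the
fields other than `fieldU` all have the form `A(α + β δᵢₗ)`. -/
lemma inner_fieldX_gradDiv_fieldY (l i : Fin 3) :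
    ⟪(ofSmooth T (fieldX T l) : L2V (cell T)), gradDiv (ofSmooth T (fieldY T i))⟫ =
      area T * (1 - if i = l then 3 else 0) := by
  rw [inner_gradDiv_ofSmooth, sdiv_fieldY]
  have h (x : Plane) : fderiv ℝ (fun x => 3 * lam T i x - 1) x ((fieldX T l : Plane → Plane) x) =
      aff T (fun _ => 3) x * aff T (Pi.single i 1 - fun _ => if i = l then 1 else 0) x
        * aff T (fun _ => 1) x := by
    rw [(((hasFDerivAt_lam T i x).const_mul 3).sub_const 1).fderiv]
    simp [aff_sub, aff_single, aff_const, fieldX, rad_apply, dlam_sub_point]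
  simp only [h, setIntegral_aff_mul]
  fin_cases l <;> fin_cases i <;> simp [Fin.sum_univ_three] <;> ring

lemma inner_fieldX_gradDiv_fieldS (l i : Fin 3) :
    ⟪(ofSmooth T (fieldX T l) : L2V (cell T)), gradDiv (ofSmooth T (fieldS T i))⟫ =
      area T * (2 / 3 - if i = l then 2 / 3 else 0) := by
  rw [inner_gradDiv_ofSmooth, sdiv_fieldS]
  have h (x : Plane) : fderiv ℝ (fun x => 4 * lam T i x ^ 2 - 2 * lam T i x) x
      ((fieldX T l : Plane → Plane) x) =
      aff T ((8 : ℝ) • Pi.single i 1 - fun _ => 2) x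
        * aff T (Pi.single i 1 - fun _ => if i = l then 1 else 0) x * aff T (fun _ => 1) x := by
    have hd : HasFDerivAt (fun x => 4 * lam T i x ^ 2 - 2 * lam T i x) _ x :=
      ((hasFDerivAt_lam_sq T i x).const_mul 4).sub ((hasFDerivAt_lam T i x).const_mul 2)
    rw [hd.fderiv]
    simp [aff_sub, aff_single, aff_const, aff_smul, fieldX, rad_apply, dlam_sub_point]
    ring
  simp only [h, setIntegral_aff_mul]
  fin_cases l <;> fin_cases i <;> simp [Fin.sum_univ_three] <;>
    first | ring1 | (ring_nf; simp)

lemma inner_fieldY_gradDiv_fieldY (l i : Fin 3) :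
    ⟪(ofSmooth T (fieldY T l) : L2V (cell T)), gradDiv (ofSmooth T (fieldY T i))⟫ =
      area T * (1 / 4 - if i = l then 3 / 4 else 0) := by
  rw [inner_gradDiv_ofSmooth, sdiv_fieldY]
  have h (x : Plane) : fderiv ℝ (fun x => 3 * lam T i x - 1) x ((fieldY T l : Plane → Plane) x) =
      aff T (fun _ => 3) x * aff T (Pi.single i 1 - fun _ => if i = l then 1 else 0) x
        * aff T (Pi.single l 1) x := by
    rw [(((hasFDerivAt_lam T i x).const_mul 3).sub_const 1).fderiv]
    simp [aff_sub, aff_single, aff_const, fieldY, rad_apply, dlam_sub_point]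
    ring
  simp only [h, setIntegral_aff_mul]
  fin_cases l <;> fin_cases i <;> simp [Fin.sum_univ_three] <;> ring

lemma inner_fieldY_gradDiv_fieldS (l i : Fin 3) :
    ⟪(ofSmooth T (fieldY T l) : L2V (cell T)), gradDiv (ofSmooth T (fieldS T i))⟫ =
      area T * (1 / 10 - if i = l then 3 / 10 else 0) := by
  rw [inner_gradDiv_ofSmooth, sdiv_fieldS]
  have h (x : Plane) : fderiv ℝ (fun x => 4 * lam T i x ^ 2 - 2 * lam T i x) x
      ((fieldY T l : Plane → Plane) x) =
      aff T ((8 : ℝ) • Pi.single i 1 - fun _ => 2) x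
        * aff T (Pi.single i 1 - fun _ => if i = l then 1 else 0) x * aff T (Pi.single l 1) x := by
    have hd : HasFDerivAt (fun x => 4 * lam T i x ^ 2 - 2 * lam T i x) _ x :=
      ((hasFDerivAt_lam_sq T i x).const_mul 4).sub ((hasFDerivAt_lam T i x).const_mul 2)
    rw [hd.fderiv]
    simp [aff_sub, aff_single, aff_const, aff_smul, fieldY, rad_apply, dlam_sub_point]
    ring
  simp only [h, setIntegral_aff_mul]
  fin_cases l <;> fin_cases i <;> simp [Fin.sum_univ_three] <;> ring

lemma integrable_aff_mul (u v w : Fin 3 → ℝ) :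
    Integrable (fun x => aff T u x * aff T v x * aff T w x) (volume.restrict (cell T)) :=
  integrableOn_cell T (((continuous_aff T u).mul (continuous_aff T v)).mul (continuous_aff T w))

lemma inner_fieldX_gradDiv_fieldW (l i : Fin 3) :
    ⟪(ofSmooth T (fieldX T l) : L2V (cell T)), gradDiv (ofSmooth T (fieldW T i))⟫ =
      area T * (-(2 / 3) + if i = l then 4 / 3 else 0) := by
  rw [inner_gradDiv_ofSmooth, sdiv_fieldW]
  have h (x : Plane) : fderiv ℝ (fun x => 4 * (lam T (i + 1) x * lam T (i + 2) x)) x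
      ((fieldX T l : Plane → Plane) x) =
      aff T (Pi.single (i + 1) 1) x
        * aff T (Pi.single (i + 2) 1 - fun _ => if i + 2 = l then 1 else 0) x * aff T (fun _ => 4) x
      + aff T (Pi.single (i + 2) 1) x
        * aff T (Pi.single (i + 1) 1 - fun _ => if i + 1 = l then 1 else 0) x
        * aff T (fun _ => 4) x := by
    rw [((hasFDerivAt_lam_mul T (i + 1) (i + 2) x).const_mul 4).fderiv]
    simp [aff_sub, aff_single, aff_const, fieldX, rad_apply, dlam_sub_point]
    ring
  simp only [h]
  rw [integral_add (integrable_aff_mul T _ _ _) (integrable_aff_mul T _ _ _), setIntegral_aff_mul,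
    setIntegral_aff_mul]
  fin_cases l <;> fin_cases i <;> simp [Fin.sum_univ_three, show (2 : Fin 3) + 2 = 1 from rfl,
    show (2 : Fin 3) + 1 = 0 from rfl, show (1 : Fin 3) + 2 = 0 from rfl,
    show (1 : Fin 3) + 1 = 2 from rfl] <;> ring

lemma inner_fieldY_gradDiv_fieldW (l i : Fin 3) :
    ⟪(ofSmooth T (fieldY T l) : L2V (cell T)), gradDiv (ofSmooth T (fieldW T i))⟫ =
      area T * (-(1 / 15) + if i = l then 1 / 5 else 0) := by
  rw [inner_gradDiv_ofSmooth, sdiv_fieldW]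
  have h (x : Plane) : fderiv ℝ (fun x => 4 * (lam T (i + 1) x * lam T (i + 2) x)) x
      ((fieldY T l : Plane → Plane) x) =
      aff T (Pi.single (i + 1) 1) x
        * aff T (Pi.single (i + 2) 1 - fun _ => if i + 2 = l then 1 else 0) x
        * aff T ((4 : ℝ) • Pi.single l 1) x
      + aff T (Pi.single (i + 2) 1) x
        * aff T (Pi.single (i + 1) 1 - fun _ => if i + 1 = l then 1 else 0) x
        * aff T ((4 : ℝ) • Pi.single l 1) x := by
    rw [((hasFDerivAt_lam_mul T (i + 1) (i + 2) x).const_mul 4).fderiv]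
    simp [aff_sub, aff_single, aff_const, aff_smul, fieldY, rad_apply, dlam_sub_point]
    ring
  simp only [h]
  rw [integral_add (integrable_aff_mul T _ _ _) (integrable_aff_mul T _ _ _), setIntegral_aff_mul,
    setIntegral_aff_mul]
  fin_cases l <;> fin_cases i <;> simp [Fin.sum_univ_three, show (2 : Fin 3) + 2 = 1 from rfl,
    show (2 : Fin 3) + 1 = 0 from rfl, show (1 : Fin 3) + 2 = 0 from rfl,
    show (1 : Fin 3) + 1 = 2 from rfl] <;> ring

lemma inner_fieldX_gradDiv_fieldU (l : Fin 3) :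
    ⟪(ofSmooth T (fieldX T l) : L2V (cell T)), gradDiv (ofSmooth T (fieldU T))⟫ = 2 * area T := by
  rw [inner_gradDiv_ofSmooth, sdiv_fieldU]
  -- The derivative of the bubble along `x - pₗ` is `(3λₗ - 1)λₗ₊₁λₗ₊₂`.
  have h (x : Plane) : fderiv ℝ (fun x => 1 - 60 * bub T x) x ((fieldX T l : Plane → Plane) x) =
      aff T ((fun _ => 60) - (180 : ℝ) • Pi.single l 1) x
        * aff T (Pi.single (l + 1) 1) x * aff T (Pi.single (l + 2) 1) x := by
    rw [(((hasFDerivAt_bub T x).const_mul 60).const_sub 1).fderiv]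
    simp [aff_sub, aff_single, aff_const, aff_smul, fieldX, rad_apply, dlam_sub_point]
    fin_cases l <;> simp [show (2 : Fin 3) + 2 = 1 from rfl,
    show (2 : Fin 3) + 1 = 0 from rfl, show (1 : Fin 3) + 2 = 0 from rfl,
    show (1 : Fin 3) + 1 = 2 from rfl] <;> ring
  simp only [h, setIntegral_aff_mul]
  fin_cases l <;> simp [Fin.sum_univ_three, show (2 : Fin 3) + 2 = 1 from rfl,
    show (2 : Fin 3) + 1 = 0 from rfl, show (1 : Fin 3) + 2 = 0 from rfl,
    show (1 : Fin 3) + 1 = 2 from rfl] <;> ring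

lemma gradDiv_fieldX (i : Fin 3) : gradDiv (ofSmooth T (fieldX T i)) = 0 := by
  have h : classicalGradDiv (fieldX T i : Plane → Plane) = fun _ => 0 := by
    funext x
    have := sdiv_fieldX T i
    rw [sdiv_apply] at this
    rw [classicalGradDiv, this, gradient_fun_const]
  rw [gradDiv_ofSmooth]
  refine Lp.ext ?_
  filter_upwards [coeFn_toL2V T (contDiff_classicalGradDiv (fieldX T i).2).continuous,
    Lp.coeFn_zero Plane 2 (volume.restrict (cell T))] with x h1 h2
  rw [h1, h2, h, Pi.zero_apply]


end

end GradDivFortin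

namespace GradDivFortin

noncomputable section

variable (T : Affine.Triangle ℝ Plane)

/-! ### Traces in `P⁰(∂T) × P^{1,c}(∂T)` -/

/-- A smooth field whose `∇div`-trace is given by edge values `g₁` and vertex values `g₂`. -/
def traceField (g₁ : Fin 3 → ℝ) (g₂ : Plane → ℝ) : smoothFields :=
  (∑ i, (g₁ i * dist (T.points (i + 1)) (T.points (i + 2)) / (2 * area T)) • fieldX T i)
    + (∑ i, ((g₂ (T.points i) - 2 * ∑ j, g₁ j * dist (T.points (j + 1)) (T.points (j + 2)) /
        (2 * area T)) / 3) • fieldY T i)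
    + ((∑ i, (g₂ (T.points i) - 2 * ∑ j, g₁ j * dist (T.points (j + 1)) (T.points (j + 2)) /
        (2 * area T))) / 3) • fieldU T

/-- `dlam` composed with evaluation at a point, as a linear map on smooth fields. -/
def dlamEval (l : Fin 3) (x : Plane) : smoothFields →ₗ[ℝ] ℝ where
  toFun F := dlam T l ((F : Plane → Plane) x)
  map_add' F G := by simp
  map_smul' c F := by simp

lemma dlamEval_rad (l i : Fin 3) (x : Plane) {f : Plane → ℝ} (hf : ContDiff ℝ ∞ f) :
    dlamEval T l x (rad T i f hf) = f x * (lam T l x - if l = i then 1 else 0) := by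
  change dlam T l (f x • (x - T.points i)) = _
  rw [map_smul, dlam_sub_point, smul_eq_mul]

lemma bub_eq_zero {x : Plane} {l : Fin 3} (h : lam T l x = 0) : bub T x = 0 := by
  fin_cases l <;> simp at h <;> simp [bub, h]

lemma dlamEval_fieldX (l i : Fin 3) {x : Plane} (h : lam T l x = 0) :
    dlamEval T l x (fieldX T i) = -if l = i then 1 else 0 := by
  rw [fieldX, dlamEval_rad, h]; ring

lemma dlamEval_fieldY (l i : Fin 3) {x : Plane} (h : lam T l x = 0) :
    dlamEval T l x (fieldY T i) = 0 := by
  rw [fieldY, dlamEval_rad, h]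
  by_cases hl : l = i
  · rw [← hl, h]; ring
  · simp [hl]

lemma dlamEval_fieldU (l : Fin 3) {x : Plane} (h : lam T l x = 0) :
    dlamEval T l x (fieldU T) = 0 := by
  rw [fieldU, map_sum]
  refine Finset.sum_eq_zero fun i _ => ?_
  rw [dlamEval_rad, h, bub_eq_zero T h]
  by_cases hl : l = i
  · rw [← hl, h]; ring
  · simp [hl]

lemma edge_eq (i : Fin 3) : edge T i 0 = T.points (i + 1) ∧ edge T i 1 = T.points (i + 2) := by
  simp [edge]

lemma sum_eq_cyclic (f : Fin 3 → ℝ) (i : Fin 3) : ∑ j, f j = f i + f (i + 1) + f (i + 2) := by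
  rw [Fin.sum_univ_three]
  fin_cases i
  · simp
  · simp [show (1 : Fin 3) + 1 = 2 from rfl, show (1 : Fin 3) + 2 = 0 from rfl]; ring
  · simp [show (2 : Fin 3) + 1 = 0 from rfl, show (2 : Fin 3) + 2 = 1 from rfl]; ring

/-- The `Xᵢ` produce the normal trace and, as a by-product, a constant divergence. The remaining
vertex values `rᵢ` are interpolated through `∑ rᵢλᵢ = ∑ (rᵢ/3)(3λᵢ - 1) + (∑ rᵢ)/3`, the two parts
being the boundary divergences of the `Yᵢ` and of `U`, which do not disturb the normal trace. -/
lemma hasGradDivTrace_traceField {g₁ : Fin 3 → ℝ} {g₂ : Plane → ℝ} (hg : IsP1c T g₂) :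
    HasGradDivTrace T (ofSmooth T (traceField T g₁ g₂)) g₁ g₂ := by
  have hA := area_pos T
  refine hasGradDivTrace_ofSmooth T _ (fun l t _ => ?_) (fun l t ht => ?_)
  · have h0 := lam_edge_self T l t
    change -|sdet T| * dlamEval T l (edge T l t) (traceField T g₁ g₂) = _
    simp only [traceField, map_add, map_sum, map_smul, dlamEval_fieldX T l _ h0,
      dlamEval_fieldY T l _ h0, dlamEval_fieldU T l h0, smul_eq_mul, mul_zero, add_zero,
      Finset.sum_const_zero, mul_neg, mul_ite, mul_one, Finset.sum_neg_distrib, Finset.sum_ite_eq,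
      Finset.mem_univ, if_true]
    rw [abs_sdet]
    field_simp
  · obtain ⟨a, b, hab⟩ := hg.2 l
    have ha : g₂ (T.points (l + 1)) = a := by
      have := hab 0 (by simp)
      rw [(edge_eq T l).1] at this
      rw [this]; ring
    have hb : g₂ (T.points (l + 2)) = a + b := by
      have := hab 1 (by simp)
      rw [(edge_eq T l).2] at this
      rw [this]; ring
    rw [hab t ht, ← sdiv_apply]
    simp only [traceField, map_add, map_sum, map_smul, sdiv_fieldX, sdiv_fieldY, sdiv_fieldU,
      Pi.add_apply, Finset.sum_apply, Pi.smul_apply, smul_eq_mul,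
      bub_eq_zero T (lam_edge_self T l t)]
    rw [← Finset.sum_mul]
    set R := ∑ j, g₁ j * dist (T.points (j + 1)) (T.points (j + 2)) / (2 * area T)
    rw [sum_eq_cyclic _ l, sum_eq_cyclic _ l, lam_edge_self, lam_edge_add_one, lam_edge_add_two,
      ha, hb]
    ring

/-- The normal trace is tested with `div φ` and the trace of the divergence with `φ`; the volume
term `∫ d div φ` cancels in the difference. Two fields with equal traces thus have a difference to
which `inner_eq_of_trace_zero` applies. -/
lemma trace_identity {u : HGradDiv (cell T)} {g₁ : Fin 3 → ℝ} {g₂ : Plane → ℝ}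
    (hu : HasGradDivTrace T u g₁ g₂) {φ : Plane → Plane} (hφ : ContDiff ℝ ∞ φ) :
    (∫ x in cell T, ⟪(u : L2V (cell T)) x, classicalGradDiv φ x⟫) -
      ∫ x in cell T, ⟪gradDiv u x, φ x⟫ = (∑ i, g₁ i * edgeIntegral T i (divergence φ))
        - ∑ i, edgeIntegral T i (fun x => g₂ x * ⟪φ x, outerNormal T i⟫) := by
  obtain ⟨d, -, h1, h2⟩ := hu
  rw [← h1 _ (contDiff_divergence hφ), ← h2 _ hφ]
  simp only [classicalGradDiv]
  ring

lemma integrable_inner_cell (v : L2V (cell T)) {ψ : Plane → Plane} (hψ : Continuous ψ) :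
    Integrable (fun x => ⟪v x, ψ x⟫) (volume.restrict (cell T)) := by
  refine (L2.integrable_inner (𝕜 := ℝ) v (toL2V T hψ)).congr ?_
  filter_upwards [coeFn_toL2V T hψ] with x hx
  rw [hx]

lemma setIntegral_inner_sub (v w : L2V (cell T)) {ψ : Plane → Plane} (hψ : Continuous ψ) :
    ∫ x in cell T, ⟪(v - w : L2V (cell T)) x, ψ x⟫ =
      (∫ x in cell T, ⟪v x, ψ x⟫) - ∫ x in cell T, ⟪w x, ψ x⟫ := by
  rw [← integral_sub (integrable_inner_cell T v hψ) (integrable_inner_cell T w hψ)]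
  refine integral_congr_ae ?_
  filter_upwards [Lp.coeFn_sub v w] with x hx
  rw [hx, Pi.sub_apply, inner_sub_left]

/-- The duality depends on its first argument only through the `∇div`-trace. -/
theorem gradDivDuality_congr {u u' : HGradDiv (cell T)} {g₁ : Fin 3 → ℝ} {g₂ : Plane → ℝ}
    (hu : HasGradDivTrace T u g₁ g₂) (hu' : HasGradDivTrace T u' g₁ g₂) (v : HGradDiv (cell T)) :
    gradDivDuality u v = gradDivDuality u' v := by
  have h := inner_eq_of_trace_zero (isOpen_cell T) (convex_cell T) (isBounded_cell T)
    (cell_nonempty T) (u := (u : L2V (cell T)) - u') (G := gradDiv u - gradDiv u')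
    (fun φ hφ => by
      rw [setIntegral_inner_sub T _ _ (contDiff_classicalGradDiv hφ).continuous,
        setIntegral_inner_sub T _ _ hφ.continuous]
      have h1 := trace_identity T hu hφ
      have h2 := trace_identity T hu' hφ
      linarith) (gradDiv_spec v)
  rw [inner_sub_left, inner_sub_left] at h
  simp only [gradDivDuality]
  linarith

/-- The duality with `u` as a linear functional. -/
def dualityL (u : HGradDiv (cell T)) : HGradDiv (cell T) →ₗ[ℝ] ℝ :=
  (innerₛₗ ℝ (u : L2V (cell T))).comp (gradDivLin T) -
    (innerₛₗ ℝ (gradDiv u)).comp (HGradDiv (cell T)).subtype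

lemma dualityL_apply (u v : HGradDiv (cell T)) : dualityL T u v = gradDivDuality u v := rfl

lemma gradDivDuality_add_left (u u' v : HGradDiv (cell T)) :
    gradDivDuality (u + u') v = gradDivDuality u v + gradDivDuality u' v := by
  simp only [gradDivDuality, ← gradDivLin_apply, map_add, Submodule.coe_add, inner_add_left]
  ring

lemma gradDivDuality_smul_left (c : ℝ) (u v : HGradDiv (cell T)) :
    gradDivDuality (c • u) v = c * gradDivDuality u v := by
  simp only [gradDivDuality, ← gradDivLin_apply, map_smul, Submodule.coe_smul,
    real_inner_smul_left]
  ring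

/-- The duality with a fixed second argument as a linear functional. -/
def dualityR (v : HGradDiv (cell T)) : HGradDiv (cell T) →ₗ[ℝ] ℝ where
  toFun u := gradDivDuality u v
  map_add' u u' := gradDivDuality_add_left T u u' v
  map_smul' c u := gradDivDuality_smul_left T c u v

/-! ### The operator `Π` -/

/-- The pairing `(F, ∇ div v)` with a smooth field `F`. -/
def pairG (F : smoothFields) : HGradDiv (cell T) →ₗ[ℝ] ℝ :=
  (innerₛₗ ℝ (ofSmooth T F : L2V (cell T))).comp (gradDivLin T)

lemma pairG_apply (F : smoothFields) (v : HGradDiv (cell T)) :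
    pairG T F v = ⟪(ofSmooth T F : L2V (cell T)), gradDiv v⟫ := rfl

/-- The pairing `(F, v)` with a smooth field `F`. -/
def pairV (F : smoothFields) : HGradDiv (cell T) →ₗ[ℝ] ℝ :=
  (innerₛₗ ℝ (ofSmooth T F : L2V (cell T))).comp (HGradDiv (cell T)).subtype

lemma pairV_apply (F : smoothFields) (v : HGradDiv (cell T)) :
    pairV T F v = ⟪(ofSmooth T F : L2V (cell T)), (v : L2V (cell T))⟫ := rfl

/-- The coefficient functional of the square terms. -/
def coefA (i : Fin 3) : HGradDiv (cell T) →ₗ[ℝ] ℝ :=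
  (3 / (2 * area T)) • pairG T (fieldX T i) - (10 / area T) • pairG T (fieldY T i)

/-- The coefficient functional of the mixed terms. -/
def coefB (i : Fin 3) : HGradDiv (cell T) →ₗ[ℝ] ℝ :=
  (6 / area T) • pairG T (fieldX T i) - (20 / area T) • pairG T (fieldY T i)
    - (3 / area T) • ∑ j, pairG T (fieldX T j)

/-- The cubic field associated with a square term. -/
def fieldQ (i : Fin 3) : smoothFields := (1 / 4 : ℝ) • fieldS T i + (1 / 6 : ℝ) • fieldY T i

/-- The part of the operator that reproduces the degrees of freedom of `∇ div v`. -/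
def opPhi : HGradDiv (cell T) →ₗ[ℝ] HGradDiv (cell T) :=
  ∑ i, ((coefA T i).smulRight (ofSmooth T (fieldQ T i)) +
    (coefB T i).smulRight (ofSmooth T ((1 / 4 : ℝ) • fieldW T i)))

/-- The field `x - c`, where `c` is the centroid of `T`. -/
def fieldM : smoothFields := (1 / 3 : ℝ) • ∑ i, fieldX T i

/-- `opPhi` corrected by a multiple of `x - c`. -/
def opPsi : HGradDiv (cell T) →ₗ[ℝ] HGradDiv (cell T) :=
  opPhi T + ((-(1 / (2 * area T))) • (dualityL T (ofSmooth T (fieldU T))).comp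
    (LinearMap.id - opPhi T)).smulRight (ofSmooth T (fieldM T))

/-- The Fortin operator: `opPsi` corrected by constant fields. -/
def opPi : HGradDiv (cell T) →ₗ[ℝ] HGradDiv (cell T) :=
  opPsi T + ∑ k : Fin 2, ((1 / area T) • (pairV T (fieldC (EuclideanSpace.single k 1))).comp
    (LinearMap.id - opPsi T)).smulRight (ofSmooth T (fieldC (EuclideanSpace.single k 1)))

/-! ### Verification of the moment and duality conditions. -/

lemma opPhi_apply (v : HGradDiv (cell T)) : opPhi T v = ∑ i, (coefA T i v • ofSmooth T (fieldQ T i)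
    + coefB T i v • ofSmooth T ((1 / 4 : ℝ) • fieldW T i)) := by
  simp [opPhi, LinearMap.sum_apply]

lemma opPsi_apply (v : HGradDiv (cell T)) : opPsi T v = opPhi T v +
    (-(1 / (2 * area T)) * gradDivDuality (ofSmooth T (fieldU T)) (v - opPhi T v)) •
      ofSmooth T (fieldM T) := rfl

lemma opPi_apply (v : HGradDiv (cell T)) : opPi T v = opPsi T v +
    ∑ k : Fin 2, (1 / area T * pairV T (fieldC (EuclideanSpace.single k 1)) (v - opPsi T v)) •
      ofSmooth T (fieldC (EuclideanSpace.single k 1)) := by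
  simp only [opPi, LinearMap.add_apply, LinearMap.sum_apply]
  rfl

lemma sum_pairG_fieldY (v : HGradDiv (cell T)) : ∑ i, pairG T (fieldY T i) v = 0 := by
  simp only [pairG_apply]
  rw [← sum_inner]
  have : ∑ i, (ofSmooth T (fieldY T i) : L2V (cell T)) = 0 := by
    rw [← Submodule.coe_sum, ← map_sum, sum_fieldY, map_zero, Submodule.coe_zero]
  rw [this, inner_zero_left]

/-- The coefficients of `opPhi` solve the moment system for data `x`, `y`; the constraint on `y` is
the relation among the `Yᵢ`. Adding `t` to all square coefficients and `2t` to all mixed ones leaves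
`∇div` unchanged, because `∑λᵢ² + 2∑λⱼλₖ = 1`, so the coefficients are one convenient choice. -/
lemma sum_coef_fieldX {A : ℝ} (hA : A ≠ 0) (x y : Fin 3 → ℝ) (hy : ∑ i, y i = 0) (l : Fin 3) :
    ∑ i, ((3 / (2 * A) * x i - 10 / A * y i) * (1 / 4 * (A * (2 / 3 - if i = l then 2 / 3 else 0))
      + 1 / 6 * (A * (1 - if i = l then 3 else 0)))
      + (6 / A * x i - 20 / A * y i - 3 / A * ∑ j, x j)
        * (1 / 4 * (A * (-(2 / 3) + if i = l then 4 / 3 else 0)))) = x l := by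
  rw [Fin.sum_univ_three] at hy
  have h2 : y 2 = -y 0 - y 1 := by linarith
  simp only [Fin.sum_univ_three, h2]
  fin_cases l <;> simp <;> field_simp <;> ring

lemma sum_coef_fieldY {A : ℝ} (hA : A ≠ 0) (x y : Fin 3 → ℝ) (hy : ∑ i, y i = 0) (l : Fin 3) :
    ∑ i, ((3 / (2 * A) * x i - 10 / A * y i)
        * (1 / 4 * (A * (1 / 10 - if i = l then 3 / 10 else 0))
      + 1 / 6 * (A * (1 / 4 - if i = l then 3 / 4 else 0)))
      + (6 / A * x i - 20 / A * y i - 3 / A * ∑ j, x j)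
        * (1 / 4 * (A * (-(1 / 15) + if i = l then 1 / 5 else 0)))) = y l := by
  rw [Fin.sum_univ_three] at hy
  have h2 : y 2 = -y 0 - y 1 := by linarith
  simp only [Fin.sum_univ_three]
  fin_cases l <;> simp [h2] <;> field_simp <;> ring

lemma coefA_apply (i : Fin 3) (v : HGradDiv (cell T)) : coefA T i v =
    3 / (2 * area T) * pairG T (fieldX T i) v - 10 / area T * pairG T (fieldY T i) v := rfl

lemma coefB_apply (i : Fin 3) (v : HGradDiv (cell T)) : coefB T i v =
    6 / area T * pairG T (fieldX T i) v - 20 / area T * pairG T (fieldY T i) v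
      - 3 / area T * ∑ j, pairG T (fieldX T j) v := by
  rw [coefB, LinearMap.sub_apply, LinearMap.sub_apply, LinearMap.smul_apply, LinearMap.smul_apply,
    LinearMap.smul_apply, LinearMap.sum_apply]
  rfl

lemma map_smul_add_smul {V W : Type*} [AddCommGroup V] [Module ℝ V] [AddCommGroup W] [Module ℝ W]
    (L : V →ₗ[ℝ] W) (a b : ℝ) (x y : V) : L (a • x + b • y) = a • L x + b • L y := by
  rw [map_add, map_smul, map_smul]

lemma map_opPhi {W : Type*} [AddCommGroup W] [Module ℝ W] (L : HGradDiv (cell T) →ₗ[ℝ] W)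
    (v : HGradDiv (cell T)) : L (opPhi T v) = ∑ i, (coefA T i v • L (ofSmooth T (fieldQ T i)) +
      coefB T i v • L (ofSmooth T ((1 / 4 : ℝ) • fieldW T i))) := by
  rw [opPhi_apply]
  exact (_root_.map_sum L _ _).trans
    (Finset.sum_congr rfl fun i _ => map_smul_add_smul L _ _ _ _)

lemma map_opPsi {W : Type*} [AddCommGroup W] [Module ℝ W] (L : HGradDiv (cell T) →ₗ[ℝ] W)
    (v : HGradDiv (cell T)) : L (opPsi T v) = L (opPhi T v) +
      (-(1 / (2 * area T)) * gradDivDuality (ofSmooth T (fieldU T)) (v - opPhi T v)) •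
        L (ofSmooth T (fieldM T)) := by
  rw [opPsi_apply]
  exact (L.map_add _ _).trans (congrArg _ (L.map_smul _ _))

lemma map_opPi {W : Type*} [AddCommGroup W] [Module ℝ W] (L : HGradDiv (cell T) →ₗ[ℝ] W)
    (v : HGradDiv (cell T)) : L (opPi T v) = L (opPsi T v) +
      ∑ k : Fin 2, (1 / area T * pairV T (fieldC (EuclideanSpace.single k 1)) (v - opPsi T v)) •
        L (ofSmooth T (fieldC (EuclideanSpace.single k 1))) := by
  rw [opPi_apply]
  exact (L.map_add _ _).trans (congrArg _ ((_root_.map_sum L _ _).trans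
    (Finset.sum_congr rfl fun k _ => L.map_smul _ _)))

lemma pairG_opPhi (F : smoothFields) (v : HGradDiv (cell T)) : pairG T F (opPhi T v) =
    ∑ i, (coefA T i v * (1 / 4 * pairG T F (ofSmooth T (fieldS T i))
      + 1 / 6 * pairG T F (ofSmooth T (fieldY T i)))
      + coefB T i v * (1 / 4 * pairG T F (ofSmooth T (fieldW T i)))) := by
  refine (map_opPhi T (pairG T F) v).trans (Finset.sum_congr rfl fun i _ => congrArg₂ _
    (congrArg _ ?_) (congrArg _ ?_))
  · exact map_smul_add_smul ((pairG T F).comp (ofSmooth T)) _ _ (fieldS T i) (fieldY T i)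
  · exact ((pairG T F).comp (ofSmooth T)).map_smul _ (fieldW T i)

lemma pairG_fieldX_opPhi (l : Fin 3) (v : HGradDiv (cell T)) :
    pairG T (fieldX T l) (opPhi T v) = pairG T (fieldX T l) v := by
  have hS (i : Fin 3) : pairG T (fieldX T l) (ofSmooth T (fieldS T i)) = _ :=
    inner_fieldX_gradDiv_fieldS T l i
  have hY (i : Fin 3) : pairG T (fieldX T l) (ofSmooth T (fieldY T i)) = _ :=
    inner_fieldX_gradDiv_fieldY T l i
  have hW (i : Fin 3) : pairG T (fieldX T l) (ofSmooth T (fieldW T i)) = _ :=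
    inner_fieldX_gradDiv_fieldW T l i
  refine (pairG_opPhi T _ v).trans ?_
  simp only [coefA_apply, coefB_apply, hS, hY, hW]
  exact sum_coef_fieldX (area_pos T).ne' (fun i => pairG T (fieldX T i) v)
    (fun i => pairG T (fieldY T i) v) (sum_pairG_fieldY T v) l

lemma pairG_fieldY_opPhi (l : Fin 3) (v : HGradDiv (cell T)) :
    pairG T (fieldY T l) (opPhi T v) = pairG T (fieldY T l) v := by
  have hS (i : Fin 3) : pairG T (fieldY T l) (ofSmooth T (fieldS T i)) = _ :=
    inner_fieldY_gradDiv_fieldS T l i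
  have hY (i : Fin 3) : pairG T (fieldY T l) (ofSmooth T (fieldY T i)) = _ :=
    inner_fieldY_gradDiv_fieldY T l i
  have hW (i : Fin 3) : pairG T (fieldY T l) (ofSmooth T (fieldW T i)) = _ :=
    inner_fieldY_gradDiv_fieldW T l i
  refine (pairG_opPhi T _ v).trans ?_
  simp only [coefA_apply, coefB_apply, hS, hY, hW]
  exact sum_coef_fieldY (area_pos T).ne' (fun i => pairG T (fieldX T i) v)
    (fun i => pairG T (fieldY T i) v) (sum_pairG_fieldY T v) l

lemma gradDiv_fieldC (w : Plane) : gradDiv (ofSmooth T (fieldC w)) = 0 := by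
  have h : classicalGradDiv (fieldC w : Plane → Plane) = fun _ => 0 := by
    funext x
    have := sdiv_fieldC w
    rw [sdiv_apply] at this
    rw [classicalGradDiv, this, gradient_fun_const]
  rw [gradDiv_ofSmooth]
  refine Lp.ext ?_
  filter_upwards [coeFn_toL2V T (contDiff_classicalGradDiv (fieldC w).2).continuous,
    Lp.coeFn_zero Plane 2 (volume.restrict (cell T))] with x h1 h2
  rw [h1, h2, h, Pi.zero_apply]

lemma gradDiv_fieldM : gradDiv (ofSmooth T (fieldM T)) = 0 := by
  rw [← gradDivLin_apply, fieldM, map_smul, map_smul, map_sum, map_sum, Finset.sum_eq_zero,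
    smul_zero]
  exact fun i _ => gradDiv_fieldX T i

/-- Both corrections have constant divergence, so they preserve the moments already matched. -/
lemma gradDiv_opPi (v : HGradDiv (cell T)) : gradDiv (opPi T v) = gradDiv (opPhi T v) := by
  have h1 : gradDiv (opPi T v) = gradDiv (opPsi T v) + _ := map_opPi T (gradDivLin T) v
  have h2 : gradDiv (opPsi T v) = gradDiv (opPhi T v) + _ := map_opPsi T (gradDivLin T) v
  rw [h1, h2]
  simp only [gradDivLin_apply, gradDiv_fieldM, gradDiv_fieldC, smul_zero, Finset.sum_const_zero,
    add_zero]

lemma inner_fieldC (w w' : Plane) : ⟪(ofSmooth T (fieldC w) : L2V (cell T)),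
    (ofSmooth T (fieldC w') : L2V (cell T))⟫ = area T * ⟪w, w'⟫ := by
  change ⟪toL2V T (continuous_const (y := w)), toL2V T (continuous_const (y := w'))⟫ = _
  rw [inner_toL2V, setIntegral_const, smul_eq_mul]; rfl

lemma fieldC_eq_sum (w : Plane) : fieldC w = ∑ k, w k • fieldC (EuclideanSpace.single k 1) := by
  ext x : 2
  rw [Submodule.coe_sum, Finset.sum_apply]
  exact eq_sum_single w

lemma pairV_fieldC_opPi (w : Plane) (v : HGradDiv (cell T)) :
    pairV T (fieldC w) (opPi T v) = pairV T (fieldC w) v := by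
  have hA := area_pos T
  -- The unit constant fields are orthogonal with squared norm `A`, so the last correction is the
  -- `L₂` projection of the defect onto constants.
  have key (j : Fin 2) : pairV T (fieldC (EuclideanSpace.single j 1)) (opPi T v) =
      pairV T (fieldC (EuclideanSpace.single j 1)) v := by
    have hk (k : Fin 2) := inner_fieldC T (EuclideanSpace.single j 1) (EuclideanSpace.single k 1)
    simp only [← pairV_apply] at hk
    rw [map_opPi]
    simp only [hk, map_sub, smul_eq_mul, Fin.sum_univ_two]
    fin_cases j <;> simp [EuclideanSpace.inner_single_left] <;> field_simp <;> ring
  have hw (v' : HGradDiv (cell T)) : pairV T (fieldC w) v' =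
      ∑ k, w k * pairV T (fieldC (EuclideanSpace.single k 1)) v' := by
    simp only [pairV_apply]
    conv_lhs => rw [fieldC_eq_sum w, map_sum, Submodule.coe_sum, sum_inner]
    refine Finset.sum_congr rfl fun k _ => ?_
    rw [map_smul, Submodule.coe_smul, real_inner_smul_left]
  rw [hw, hw]
  simp only [key]

/-- Constants are spanned by differences of the `Xᵢ`, so the second orthogonality in property 1
costs no extra degrees of freedom. -/
lemma pairG_fieldC_eq_zero {v : HGradDiv (cell T)} (h : ∀ l, pairG T (fieldX T l) v = 0) (w : Plane) :
    pairG T (fieldC w) v = 0 := by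
  have h1 (i j : Fin 3) : pairG T (fieldC (T.points j - T.points i)) v = 0 := by
    rw [← fieldX_sub, pairG_apply, map_sub, Submodule.coe_sub, inner_sub_left, ← pairG_apply,
      ← pairG_apply, h, h, sub_zero]
  have h2 : fieldC w = dlam T 1 w • fieldC (T.points 1 - T.points 0)
      + dlam T 2 w • fieldC (T.points 2 - T.points 0) := by
    ext x : 2
    exact eq_sum_dlam T w
  rw [h2, pairG_apply, map_add, map_smul, map_smul, Submodule.coe_add, Submodule.coe_smul,
    Submodule.coe_smul, inner_add_left, real_inner_smul_left, real_inner_smul_left,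
    ← pairG_apply, ← pairG_apply, h1, h1]
  ring

/-- The value is nonzero, so `x - centroid` can correct the duality with `U`, and independent of
`l`, so constants, being differences of the `Xᵢ`, have zero duality with `U`. -/
lemma duality_fieldU_fieldX (l : Fin 3) :
    gradDivDuality (ofSmooth T (fieldU T)) (ofSmooth T (fieldX T l)) = -(2 * area T) := by
  rw [gradDivDuality, gradDiv_fieldX, inner_zero_right, real_inner_comm,
    inner_fieldX_gradDiv_fieldU]
  ring

lemma duality_fieldU_fieldM :
    gradDivDuality (ofSmooth T (fieldU T)) (ofSmooth T (fieldM T)) = -(2 * area T) := by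
  rw [← dualityL_apply, fieldM, map_smul, map_smul, map_sum, map_sum]
  simp only [dualityL_apply, duality_fieldU_fieldX, Fin.sum_univ_three, smul_eq_mul]
  ring

lemma duality_fieldU_fieldC (w : Plane) :
    gradDivDuality (ofSmooth T (fieldU T)) (ofSmooth T (fieldC w)) = 0 := by
  have h1 (i j : Fin 3) : gradDivDuality (ofSmooth T (fieldU T))
      (ofSmooth T (fieldC (T.points j - T.points i))) = 0 := by
    rw [← fieldX_sub, ← dualityL_apply, map_sub, map_sub, dualityL_apply, dualityL_apply,
      duality_fieldU_fieldX, duality_fieldU_fieldX, sub_self]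
  have h2 : fieldC w = dlam T 1 w • fieldC (T.points 1 - T.points 0)
      + dlam T 2 w • fieldC (T.points 2 - T.points 0) := by
    ext x : 2
    exact eq_sum_dlam T w
  rw [h2, ← dualityL_apply]
  simp only [map_add, map_smul, dualityL_apply, h1, smul_zero, add_zero]

lemma duality_fieldU_opPi (v : HGradDiv (cell T)) :
    gradDivDuality (ofSmooth T (fieldU T)) (opPi T v) =
      gradDivDuality (ofSmooth T (fieldU T)) v := by
  have hA := area_pos T
  have h1 := map_opPi T (dualityL T (ofSmooth T (fieldU T))) v
  have h2 := map_opPsi T (dualityL T (ofSmooth T (fieldU T))) v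
  have h3 := (dualityL T (ofSmooth T (fieldU T))).map_sub v (opPhi T v)
  simp only [dualityL_apply, duality_fieldU_fieldC, duality_fieldU_fieldM, mul_zero,
    Finset.sum_const_zero, add_zero, smul_eq_mul] at h1 h2 h3
  rw [h1, h2, h3]
  field_simp
  ring

lemma pairG_opPi_fieldX (l : Fin 3) (v : HGradDiv (cell T)) :
    pairG T (fieldX T l) (v - opPi T v) = 0 := by
  refine ((pairG T (fieldX T l)).map_sub v (opPi T v)).trans (sub_eq_zero.2 ?_)
  rw [pairG_apply T _ (opPi T v), gradDiv_opPi]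
  exact (pairG_fieldX_opPhi T l v).symm

lemma gradDiv_fieldY_eq (i : Fin 3) : ∃ w, gradDiv (ofSmooth T (fieldY T i)) =
    (ofSmooth T (fieldC w) : L2V (cell T)) := by
  refine ⟨gradient (fun x => 3 * lam T i x - 1) 0, ?_⟩
  have h : classicalGradDiv (fieldY T i : Plane → Plane) =
      fun _ => gradient (fun x => 3 * lam T i x - 1) 0 := by
    funext x
    have := sdiv_fieldY T i
    rw [sdiv_apply] at this
    rw [classicalGradDiv, this]
    have hg (y : Plane) := (((hasFDerivAt_lam T i y).const_mul 3).sub_const 1).fderiv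
    simp only [gradient, hg]
  rw [gradDiv_ofSmooth]
  refine Lp.ext ?_
  filter_upwards [coeFn_toL2V T (contDiff_classicalGradDiv (fieldY T i).2).continuous,
    coeFn_toL2V T (continuous_const (y := gradient (fun x => 3 * lam T i x - 1) 0))] with x h1 h2
  rw [h1, h]
  exact h2.symm

lemma pairG_opPi_fieldY (l : Fin 3) (v : HGradDiv (cell T)) :
    pairG T (fieldY T l) (v - opPi T v) = 0 := by
  refine ((pairG T (fieldY T l)).map_sub v (opPi T v)).trans (sub_eq_zero.2 ?_)
  rw [pairG_apply T _ (opPi T v), gradDiv_opPi]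
  exact (pairG_fieldY_opPhi T l v).symm

lemma pairV_opPi_fieldC (w : Plane) (v : HGradDiv (cell T)) :
    pairV T (fieldC w) (v - opPi T v) = 0 :=
  ((pairV T (fieldC w)).map_sub v (opPi T v)).trans
    (sub_eq_zero.2 (pairV_fieldC_opPi T w v).symm)

lemma duality_fieldU_sub_opPi (v : HGradDiv (cell T)) :
    gradDivDuality (ofSmooth T (fieldU T)) (v - opPi T v) = 0 :=
  ((dualityL T (ofSmooth T (fieldU T))).map_sub v (opPi T v)).trans
    (sub_eq_zero.2 (duality_fieldU_opPi T v).symm)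

/-- By linearity only the three kinds of lifts matter. For `Xᵢ` the duality is just the moment of
`∇div e`; for `Yᵢ` the second term pairs `e` with a constant. -/
lemma duality_traceField_eq_zero {e : HGradDiv (cell T)}
    (hX : ∀ i, pairG T (fieldX T i) e = 0) (hY : ∀ i, pairG T (fieldY T i) e = 0)
    (hC : ∀ w, pairV T (fieldC w) e = 0) (hU : gradDivDuality (ofSmooth T (fieldU T)) e = 0)
    (g₁ : Fin 3 → ℝ) (g₂ : Plane → ℝ) :
    gradDivDuality (ofSmooth T (traceField T g₁ g₂)) e = 0 := by
  have key : traceField T g₁ g₂ ∈ LinearMap.ker ((dualityR T e).comp (ofSmooth T)) := by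
    refine add_mem (add_mem (sum_mem fun i _ => ?_) (sum_mem fun i _ => ?_)) ?_ <;>
      refine Submodule.smul_mem _ _ ?_
    · change gradDivDuality _ _ = 0
      rw [gradDivDuality, gradDiv_fieldX, inner_zero_left, sub_zero]
      exact hX i
    · change gradDivDuality _ _ = 0
      obtain ⟨w, hw⟩ := gradDiv_fieldY_eq T i
      rw [gradDivDuality, hw]
      exact (congrArg₂ (· - ·) (hY i) (hC w)).trans (sub_zero 0)
    · exact hU
  exact key

/-- The Fortin property with respect to the traces. -/
lemma duality_traceField_sub_opPi (g₁ : Fin 3 → ℝ) (g₂ : Plane → ℝ) (v : HGradDiv (cell T)) :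
    gradDivDuality (ofSmooth T (traceField T g₁ g₂)) (v - opPi T v) = 0 :=
  duality_traceField_eq_zero T (fun i => pairG_opPi_fieldX T i v)
    (fun i => pairG_opPi_fieldY T i v) (fun w => pairV_opPi_fieldC T w v)
    (duality_fieldU_sub_opPi T v) g₁ g₂

end

end GradDivFortin

namespace GradDivFortin

noncomputable section

variable (T : Affine.Triangle ℝ Plane)

/-! ### Polynomial fields -/

/-- `f` is a polynomial function of total degree at most `n`. -/
def IsPoly (n : ℕ) (f : Plane → ℝ) : Prop :=
  ∃ q : MvPolynomial (Fin 2) ℝ, q.totalDegree ≤ n ∧ ∀ x, f x = MvPolynomial.eval (fun j => x j) q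

lemma isPoly_const (n : ℕ) (c : ℝ) : IsPoly n fun _ => c :=
  ⟨MvPolynomial.C c, by simp, fun x => by simp⟩

lemma IsPoly.mono {m n : ℕ} (h : m ≤ n) {f : Plane → ℝ} (hf : IsPoly m f) : IsPoly n f := by
  obtain ⟨q, hq, he⟩ := hf
  exact ⟨q, hq.trans h, he⟩

lemma IsPoly.add {n : ℕ} {f g : Plane → ℝ} (hf : IsPoly n f) (hg : IsPoly n g) :
    IsPoly n fun x => f x + g x := by
  obtain ⟨p, hp, hf⟩ := hf
  obtain ⟨q, hq, hg⟩ := hg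
  exact ⟨p + q, (MvPolynomial.totalDegree_add _ _).trans (max_le hp hq),
    fun x => by simp only [hf, hg, map_add]⟩

lemma IsPoly.mul {m n : ℕ} {f g : Plane → ℝ} (hf : IsPoly m f) (hg : IsPoly n g) :
    IsPoly (m + n) fun x => f x * g x := by
  obtain ⟨p, hp, hf⟩ := hf
  obtain ⟨q, hq, hg⟩ := hg
  exact ⟨p * q, (MvPolynomial.totalDegree_mul _ _).trans (add_le_add hp hq),
    fun x => by simp only [hf, hg, map_mul]⟩

lemma isPoly_coord (k : Fin 2) : IsPoly 1 fun x => x k :=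
  ⟨MvPolynomial.X k, by simp, fun x => by simp⟩

lemma isPoly_lam (i : Fin 3) : IsPoly 1 (lam T i) := by
  have h : lam T i = fun x => lam T i 0 + (x 0 * dlam T i (EuclideanSpace.single 0 1) +
      x 1 * dlam T i (EuclideanSpace.single 1 1)) := by
    funext x
    have h1 := lam_add T i 0 x
    have h2 : dlam T i x = dlam T i (∑ k, x k • EuclideanSpace.single k 1) :=
      congrArg (dlam T i) (eq_sum_single x)
    rw [Fin.sum_univ_two, map_add, map_smul, map_smul, smul_eq_mul, smul_eq_mul] at h2
    rw [zero_add] at h1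
    rw [h1, h2]
  rw [h]
  -- The coefficients are taken with degree bound 0, so that the product has bound `1 + 0`, which
  -- reduces to 1.
  exact (isPoly_const 1 _).add (((isPoly_coord 0).mul (isPoly_const 0 _)).add
    ((isPoly_coord 1).mul (isPoly_const 0 _)))

/-- The smooth fields that are polynomials of degree at most `n`, up to null sets in `T`. -/
def polyFields (n : ℕ) : Submodule ℝ smoothFields :=
  (VecPoly n (cell T)).comap ((HGradDiv (cell T)).subtype.comp (ofSmooth T))

lemma mem_polyFields {n : ℕ} {F : smoothFields}
    (h : ∀ k, IsPoly n fun x => (F : Plane → Plane) x k) : F ∈ polyFields T n := by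
  choose q hq he using h
  refine ⟨q, hq, ?_⟩
  filter_upwards [coeFn_toL2V T (ContDiff.continuous (𝕜 := ℝ) (n := ∞) F.2)] with x hx k
  change toL2V T (ContDiff.continuous (𝕜 := ℝ) (n := ∞) F.2) x k = _
  rw [hx]
  exact he k x

lemma rad_mem_polyFields {n : ℕ} (i : Fin 3) {f : Plane → ℝ} (hf : ContDiff ℝ ∞ f)
    (h : IsPoly n f) : rad T i f hf ∈ polyFields T (n + 1) := by
  refine mem_polyFields T fun k => ?_
  have h1 : IsPoly 1 fun x => x k + -(T.points i k) :=
    (isPoly_coord k).add (isPoly_const 1 _)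
  obtain ⟨q, hq, he⟩ := h.mul h1
  refine ⟨q, hq, fun x => ?_⟩
  rw [← he]
  change (f x • (x - T.points i)) k = f x * (x k + -(T.points i k))
  rw [PiLp.smul_apply, PiLp.sub_apply, smul_eq_mul, sub_eq_add_neg]

lemma fieldC_mem_polyFields (n : ℕ) (w : Plane) : fieldC w ∈ polyFields T n :=
  mem_polyFields T fun k => isPoly_const n (w k)

lemma fieldX_mem_polyFields (i : Fin 3) : fieldX T i ∈ polyFields T 3 :=
  rad_mem_polyFields T i _ (isPoly_const 2 1)

lemma fieldY_mem_polyFields (i : Fin 3) : fieldY T i ∈ polyFields T 3 :=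
  rad_mem_polyFields T i _ ((isPoly_lam T i).mono (by norm_num : 1 ≤ 2))

lemma fieldS_mem_polyFields (i : Fin 3) : fieldS T i ∈ polyFields T 3 := by
  refine rad_mem_polyFields T i _ (n := 2) ?_
  simp only [sq]
  exact (isPoly_lam T i).mul (isPoly_lam T i)

lemma fieldW_mem_polyFields (i : Fin 3) : fieldW T i ∈ polyFields T 3 :=
  rad_mem_polyFields T i _ ((isPoly_lam T (i + 1)).mul (isPoly_lam T (i + 2)))

lemma opPi_mem_vecPoly (v : HGradDiv (cell T)) : (opPi T v : L2V (cell T)) ∈ VecPoly 3 (cell T) := by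
  let V := (VecPoly 3 (cell T)).comap (HGradDiv (cell T)).subtype
  have hV {F : smoothFields} (hF : F ∈ polyFields T 3) : ofSmooth T F ∈ V := hF
  change opPi T v ∈ V
  rw [opPi_apply, opPsi_apply, opPhi_apply]
  refine V.add_mem (V.add_mem (V.sum_mem fun i _ => V.add_mem (V.smul_mem _ (hV ?_))
    (V.smul_mem _ (hV ?_))) (V.smul_mem _ (hV ?_))) (V.sum_mem fun k _ => V.smul_mem _ (hV ?_))
  · exact (polyFields T 3).add_mem ((polyFields T 3).smul_mem _ (fieldS_mem_polyFields T i))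
      ((polyFields T 3).smul_mem _ (fieldY_mem_polyFields T i))
  · exact (polyFields T 3).smul_mem _ (fieldW_mem_polyFields T i)
  · exact (polyFields T 3).smul_mem _ ((polyFields T 3).sum_mem fun i _ => fieldX_mem_polyFields T i)
  · exact fieldC_mem_polyFields T 3 _

lemma exists_eq_fieldC {w : L2V (cell T)} (hw : w ∈ VecPoly 0 (cell T)) :
    ∃ c, w = (ofSmooth T (fieldC c) : L2V (cell T)) := by
  obtain ⟨p, hp, he⟩ := hw
  have h (i : Fin 2) : p i = MvPolynomial.C (MvPolynomial.coeff 0 (p i)) :=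
    MvPolynomial.totalDegree_eq_zero_iff_eq_C.1 (Nat.le_zero.1 (hp i))
  refine ⟨WithLp.toLp 2 fun i => MvPolynomial.coeff 0 (p i), Lp.ext ?_⟩
  filter_upwards [he, coeFn_toL2V T (continuous_const
    (y := (WithLp.toLp 2 fun i => MvPolynomial.coeff 0 (p i) : Plane)))] with x h1 h2
  refine Eq.trans ?_ h2.symm
  ext i
  rw [h1 i, h i, MvPolynomial.eval_C]

lemma inner_sub_opPi_eq_zero {w : L2V (cell T)} (hw : w ∈ VecPoly 0 (cell T))
    (v : HGradDiv (cell T)) : ⟪w, ((v - opPi T v : HGradDiv (cell T)) : L2V (cell T))⟫ = 0 := by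
  obtain ⟨c, rfl⟩ := exists_eq_fieldC T hw
  exact pairV_opPi_fieldC T c v

lemma inner_gradDiv_sub_opPi_eq_zero {w : L2V (cell T)} (hw : w ∈ VecPoly 0 (cell T))
    (v : HGradDiv (cell T)) : ⟪w, gradDiv (v - opPi T v)⟫ = 0 := by
  obtain ⟨c, rfl⟩ := exists_eq_fieldC T hw
  exact pairG_fieldC_eq_zero T (fun l => pairG_opPi_fieldX T l v) c


end

end GradDivFortin

namespace GradDivFortin

noncomputable section

variable (T : Affine.Triangle ℝ Plane)

/-! ### Norm estimates -/

lemma norm_outerNormal_le (i : Fin 3) : ‖outerNormal T i‖ ≤ 1 := by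
  rw [outerNormal, norm_smul, norm_inv, norm_norm]
  exact inv_mul_le_one

/-- The normal relation `2A ∇λᵢ = -|edge| n` and `|edge| ≤ h`. This is the only source of negative
powers of the area in the gradients. -/
lemma norm_dlam_le (i : Fin 3) : ‖dlam T i‖ ≤ Metric.diam (cell T) / (2 * area T) := by
  have hA := area_pos T
  refine ContinuousLinearMap.opNorm_le_bound _ (by positivity) fun w => ?_
  have h := congrArg abs (dist_mul_inner_outerNormal T i w)
  rw [abs_sdet, abs_mul, abs_mul, abs_neg, abs_of_nonneg dist_nonneg,
    abs_of_pos (by positivity : 0 < 2 * area T)] at h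
  have h1 : dist (T.points (i + 1)) (T.points (i + 2)) ≤ Metric.diam (cell T) := by
    rw [dist_eq_norm]
    exact norm_sub_le_diam T (point_mem_closure T _) (point_mem_closure T _)
  have h2 : |⟪w, outerNormal T i⟫| ≤ ‖w‖ :=
    (abs_real_inner_le_norm _ _).trans
      (mul_le_of_le_one_right (norm_nonneg _) (norm_outerNormal_le T i))
  have h3 := mul_le_mul h1 h2 (abs_nonneg _) Metric.diam_nonneg
  rw [h] at h3
  rw [Real.norm_eq_abs, div_mul_eq_mul_div, le_div_iff₀ (by positivity)]
  linarith

lemma norm_ofSmooth_le {F : smoothFields} {c : ℝ} (hc : 0 ≤ c)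
    (h : ∀ x ∈ cell T, ‖(F : Plane → Plane) x‖ ≤ c) :
    ‖(ofSmooth T F : L2V (cell T))‖ ≤ c * Real.sqrt (area T) :=
  norm_toL2V_le T (ContDiff.continuous (𝕜 := ℝ) (n := ∞) F.2) hc h

lemma norm_gradDiv_ofSmooth_le {F : smoothFields} {c : ℝ} (hc : 0 ≤ c)
    (h : ∀ x ∈ cell T, ‖fderiv ℝ (sdiv F) x‖ ≤ c) :
    ‖gradDiv (ofSmooth T F)‖ ≤ c * Real.sqrt (area T) := by
  rw [gradDiv_ofSmooth]
  refine norm_toL2V_le T _ hc fun x hx => ?_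
  rw [classicalGradDiv, gradient, LinearIsometryEquiv.norm_map, ← sdiv_apply]
  exact h x hx

lemma norm_rad_le (i : Fin 3) {f : Plane → ℝ} (hf : ContDiff ℝ ∞ f) {c : ℝ} {x : Plane}
    (hx : x ∈ cell T) (h : |f x| ≤ c) :
    ‖(rad T i f hf : Plane → Plane) x‖ ≤ c * Metric.diam (cell T) := by
  rw [rad_apply, norm_smul, Real.norm_eq_abs]
  exact mul_le_mul h (norm_sub_le_diam T (subset_closure hx) (point_mem_closure T i))
    (norm_nonneg _) ((abs_nonneg _).trans h)

lemma lam_mem {x : Plane} (hx : x ∈ cell T) (i : Fin 3) : 0 ≤ lam T i x ∧ lam T i x ≤ 1 :=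
  ⟨((mem_cell T x).1 hx i).le, (lam_lt_one T hx i).le⟩

lemma abs_lam_le {x : Plane} (hx : x ∈ cell T) (i : Fin 3) : |lam T i x| ≤ 1 := by
  rw [abs_of_nonneg (lam_mem T hx i).1]
  exact (lam_mem T hx i).2

lemma abs_lam_mul_le {x : Plane} (hx : x ∈ cell T) (i j : Fin 3) :
    |lam T i x * lam T j x| ≤ 1 := by
  rw [abs_mul]
  exact mul_le_one₀ (abs_lam_le T hx i) (abs_nonneg _) (abs_lam_le T hx j)

lemma abs_bub_le {x : Plane} (hx : x ∈ cell T) : |bub T x| ≤ 1 := by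
  rw [bub, abs_mul]
  exact mul_le_one₀ (abs_lam_mul_le T hx 0 1) (abs_nonneg _) (abs_lam_le T hx 2)

lemma norm_fieldX_le (i : Fin 3) : ‖(ofSmooth T (fieldX T i) : L2V (cell T))‖ ≤
    Metric.diam (cell T) * Real.sqrt (area T) := by
  refine norm_ofSmooth_le T Metric.diam_nonneg fun x hx => ?_
  have := norm_rad_le T i (f := fun _ => 1) contDiff_const (c := 1) hx (by simp)
  rwa [one_mul] at this

lemma norm_fieldY_le (i : Fin 3) : ‖(ofSmooth T (fieldY T i) : L2V (cell T))‖ ≤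
    Metric.diam (cell T) * Real.sqrt (area T) := by
  refine norm_ofSmooth_le T Metric.diam_nonneg fun x hx => ?_
  have := norm_rad_le T i (contDiff_lam T i) hx (abs_lam_le T hx i)
  rwa [one_mul] at this

lemma norm_fieldQ_le (i : Fin 3) : ‖(ofSmooth T (fieldQ T i) : L2V (cell T))‖ ≤
    Metric.diam (cell T) * Real.sqrt (area T) := by
  refine norm_ofSmooth_le T Metric.diam_nonneg fun x hx => ?_
  have h1 := norm_rad_le T i (contDiff_lam T i) hx (abs_lam_le T hx i)
  have h2 := norm_rad_le T i (f := fun x => lam T i x ^ 2) ((contDiff_lam T i).pow 2) hx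
    (c := 1) (by rw [sq]; exact abs_lam_mul_le T hx i i)
  change ‖(1 / 4 : ℝ) • (fieldS T i : Plane → Plane) x + (1 / 6 : ℝ) • (fieldY T i : Plane → Plane) x‖ ≤ _
  refine (norm_add_le _ _).trans ?_
  rw [norm_smul, norm_smul, Real.norm_of_nonneg (by norm_num : (0 : ℝ) ≤ 1 / 4),
    Real.norm_of_nonneg (by norm_num : (0 : ℝ) ≤ 1 / 6)]
  have h0 : 0 ≤ Metric.diam (cell T) := Metric.diam_nonneg
  rw [fieldS, fieldY]
  linarith

lemma norm_fieldW_le (i : Fin 3) :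
    ‖(ofSmooth T ((1 / 4 : ℝ) • fieldW T i) : L2V (cell T))‖ ≤
      Metric.diam (cell T) * Real.sqrt (area T) := by
  refine norm_ofSmooth_le T Metric.diam_nonneg fun x hx => ?_
  have h1 := norm_rad_le T i (f := fun x => lam T (i + 1) x * lam T (i + 2) x)
    ((contDiff_lam T _).mul (contDiff_lam T _)) hx (abs_lam_mul_le T hx (i + 1) (i + 2))
  change ‖(1 / 4 : ℝ) • (fieldW T i : Plane → Plane) x‖ ≤ _
  rw [norm_smul, Real.norm_of_nonneg (by norm_num : (0 : ℝ) ≤ 1 / 4)]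
  have h0 : 0 ≤ Metric.diam (cell T) := Metric.diam_nonneg
  rw [fieldW]
  linarith

lemma norm_fieldU_le : ‖(ofSmooth T (fieldU T) : L2V (cell T))‖ ≤
    15 * Metric.diam (cell T) * Real.sqrt (area T) := by
  have h0 : 0 ≤ Metric.diam (cell T) := Metric.diam_nonneg
  refine norm_ofSmooth_le T (by positivity) fun x hx => ?_
  rw [fieldU, Submodule.coe_sum, Finset.sum_apply]
  refine (norm_sum_le _ _).trans ?_
  have h1 (i : Fin 3) : |1 / 2 * lam T i x ^ 2 - 4 * bub T x| ≤ 5 := by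
    have h2 := abs_le.1 (abs_lam_mul_le T hx i i)
    have h3 := abs_le.1 (abs_bub_le T hx)
    rw [← sq] at h2
    rw [abs_le]
    constructor <;> linarith
  refine (Finset.sum_le_sum fun i _ => norm_rad_le T i _ hx (h1 i)).trans ?_
  simp only [Finset.sum_const, Finset.card_univ, Fintype.card_fin, nsmul_eq_mul]
  exact le_of_eq (by push_cast; ring)

lemma norm_fieldM_le : ‖(ofSmooth T (fieldM T) : L2V (cell T))‖ ≤
    Metric.diam (cell T) * Real.sqrt (area T) := by
  have h0 : 0 ≤ Metric.diam (cell T) := Metric.diam_nonneg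
  refine norm_ofSmooth_le T h0 fun x hx => ?_
  rw [fieldM, Submodule.coe_smul, Submodule.coe_sum, Pi.smul_apply, Finset.sum_apply, norm_smul,
    Real.norm_of_nonneg (by norm_num : (0 : ℝ) ≤ 1 / 3)]
  have h1 := (norm_sum_le Finset.univ fun i => (fieldX T i : Plane → Plane) x).trans
    (Finset.sum_le_sum fun i _ => norm_rad_le T i (f := fun _ => 1) contDiff_const (c := 1) hx
      (by simp))
  simp only [Finset.sum_const, Finset.card_univ, Fintype.card_fin, nsmul_eq_mul] at h1
  push_cast at h1
  linarith

lemma norm_fieldC_le (k : Fin 2) :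
    ‖(ofSmooth T (fieldC (EuclideanSpace.single k 1)) : L2V (cell T))‖ ≤ Real.sqrt (area T) := by
  have := norm_ofSmooth_le T (F := fieldC (EuclideanSpace.single k 1)) zero_le_one fun x _ => by
    change ‖(EuclideanSpace.single k 1 : Plane)‖ ≤ 1
    simp
  rwa [one_mul] at this

lemma norm_gradDiv_fieldQ_le (i : Fin 3) : ‖gradDiv (ofSmooth T (fieldQ T i))‖ ≤
    3 * (Metric.diam (cell T) / (2 * area T)) * Real.sqrt (area T) := by
  have hA := area_pos T
  have h0 : 0 ≤ Metric.diam (cell T) / (2 * area T) := by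
    have : 0 ≤ Metric.diam (cell T) := Metric.diam_nonneg
    positivity
  refine norm_gradDiv_ofSmooth_le T (by positivity) fun x hx => ?_
  have hs : sdiv (fieldQ T i) = fun x => lam T i x ^ 2 - 1 / 6 := by
    rw [fieldQ, map_add, map_smul, map_smul, sdiv_fieldS, sdiv_fieldY]
    funext x
    simp only [Pi.add_apply, Pi.smul_apply, smul_eq_mul]
    ring
  rw [hs, ((hasFDerivAt_lam_sq T i x).sub_const _).fderiv, norm_smul, Real.norm_eq_abs, abs_mul,
    abs_two]
  have h1 := mul_le_mul (abs_lam_le T hx i) (norm_dlam_le T i) (norm_nonneg _) zero_le_one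
  linarith

lemma norm_fderiv_lam_mul_le (i j : Fin 3) {x : Plane} (hx : x ∈ cell T) :
    ‖lam T i x • dlam T j + lam T j x • dlam T i‖ ≤ 2 * (Metric.diam (cell T) / (2 * area T)) := by
  refine (norm_add_le _ _).trans ?_
  rw [norm_smul, norm_smul, Real.norm_eq_abs, Real.norm_eq_abs]
  have h1 := mul_le_mul (abs_lam_le T hx i) (norm_dlam_le T j) (norm_nonneg _) zero_le_one
  have h2 := mul_le_mul (abs_lam_le T hx j) (norm_dlam_le T i) (norm_nonneg _) zero_le_one
  linarith

lemma norm_gradDiv_fieldW_le (i : Fin 3) :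
    ‖gradDiv (ofSmooth T ((1 / 4 : ℝ) • fieldW T i))‖ ≤
      2 * (Metric.diam (cell T) / (2 * area T)) * Real.sqrt (area T) := by
  have hA := area_pos T
  have h0 : 0 ≤ Metric.diam (cell T) / (2 * area T) := by
    have : 0 ≤ Metric.diam (cell T) := Metric.diam_nonneg
    positivity
  refine norm_gradDiv_ofSmooth_le T (by positivity) fun x hx => ?_
  have hs : sdiv ((1 / 4 : ℝ) • fieldW T i) = fun x => lam T (i + 1) x * lam T (i + 2) x := by
    rw [map_smul, sdiv_fieldW]
    funext x
    simp only [Pi.smul_apply, smul_eq_mul]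
    ring
  rw [hs, (hasFDerivAt_lam_mul T _ _ x).fderiv]
  exact norm_fderiv_lam_mul_le T _ _ hx

lemma norm_gradDiv_fieldU_le : ‖gradDiv (ofSmooth T (fieldU T))‖ ≤
    180 * (Metric.diam (cell T) / (2 * area T)) * Real.sqrt (area T) := by
  have hA := area_pos T
  have h0 : 0 ≤ Metric.diam (cell T) / (2 * area T) := by
    have : 0 ≤ Metric.diam (cell T) := Metric.diam_nonneg
    positivity
  refine norm_gradDiv_ofSmooth_le T (by positivity) fun x hx => ?_
  rw [sdiv_fieldU, (((hasFDerivAt_bub T x).const_mul 60).const_sub 1).fderiv, norm_neg, norm_smul,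
    Real.norm_of_nonneg (by norm_num : (0 : ℝ) ≤ 60)]
  have h1 := norm_add_le ((lam T 0 x * lam T 1 x) • dlam T 2)
    (lam T 2 x • (lam T 0 x • dlam T 1 + lam T 1 x • dlam T 0))
  rw [norm_smul (lam T 0 x * lam T 1 x), norm_smul (lam T 2 x), Real.norm_eq_abs,
    Real.norm_eq_abs] at h1
  have h2 := mul_le_mul (abs_lam_mul_le T hx 0 1) (norm_dlam_le T 2) (norm_nonneg _) zero_le_one
  have h3 := mul_le_mul (abs_lam_le T hx 2) (norm_fderiv_lam_mul_le T 0 1 hx) (norm_nonneg _)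
    zero_le_one
  linarith

lemma abs_pairG_le {F : smoothFields} {c : ℝ} (h : ‖(ofSmooth T F : L2V (cell T))‖ ≤ c)
    (v : HGradDiv (cell T)) : |pairG T F v| ≤ c * ‖gradDiv v‖ := by
  rw [pairG_apply]
  exact (abs_real_inner_le_norm _ _).trans (mul_le_mul_of_nonneg_right h (norm_nonneg _))

lemma abs_coefA_le (i : Fin 3) (v : HGradDiv (cell T)) : |coefA T i v| ≤
    12 / area T * (Metric.diam (cell T) * Real.sqrt (area T) * ‖gradDiv v‖) := by
  have hA := area_pos T
  have hX := abs_pairG_le T (norm_fieldX_le T i) v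
  have hY := abs_pairG_le T (norm_fieldY_le T i) v
  rw [coefA_apply]
  generalize pairG T (fieldX T i) v = a at *
  generalize pairG T (fieldY T i) v = b at *
  generalize Metric.diam (cell T) * Real.sqrt (area T) * ‖gradDiv v‖ = c at *
  have e : 3 / (2 * area T) * a - 10 / area T * b = (3 * a / 2 - 10 * b) / area T := by
    field_simp
  rw [e, abs_div, abs_of_pos hA, div_mul_eq_mul_div]
  refine div_le_div_of_nonneg_right ?_ hA.le
  have h1 := abs_le.1 hX
  have h2 := abs_le.1 hY
  rw [abs_le]
  constructor <;> linarith

lemma abs_coefB_le (i : Fin 3) (v : HGradDiv (cell T)) : |coefB T i v| ≤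
    35 / area T * (Metric.diam (cell T) * Real.sqrt (area T) * ‖gradDiv v‖) := by
  have hA := area_pos T
  have hX (j : Fin 3) := abs_pairG_le T (norm_fieldX_le T j) v
  have hY := abs_pairG_le T (norm_fieldY_le T i) v
  rw [coefB_apply, Fin.sum_univ_three]
  generalize Metric.diam (cell T) * Real.sqrt (area T) * ‖gradDiv v‖ = c at *
  have e (a b d : ℝ) : 6 / area T * a - 20 / area T * b - 3 / area T * d =
      (6 * a - 20 * b - 3 * d) / area T := by
    field_simp
  rw [e, abs_div, abs_of_pos hA, div_mul_eq_mul_div]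
  refine div_le_div_of_nonneg_right ?_ hA.le
  have h1 := abs_le.1 (hX i)
  have h2 := abs_le.1 hY
  have h3 := abs_le.1 (hX 0)
  have h4 := abs_le.1 (hX 1)
  have h5 := abs_le.1 (hX 2)
  rw [abs_le]
  constructor <;> linarith

lemma norm_smul_le_of_le {E : Type*} [NormedAddCommGroup E] [NormedSpace ℝ E] {a b c : ℝ} {x : E}
    (ha : |a| ≤ b) (hx : ‖x‖ ≤ c) : ‖a • x‖ ≤ b * c := by
  rw [norm_smul, Real.norm_eq_abs]
  exact mul_le_mul ha hx (norm_nonneg _) ((abs_nonneg _).trans ha)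

lemma norm_sum_le_of_le_three {E : Type*} [NormedAddCommGroup E] (f : Fin 3 → E) {c : ℝ}
    (h : ∀ i, ‖f i‖ ≤ c) : ‖∑ i, f i‖ ≤ 3 * c := by
  have := norm_sum_le_of_le Finset.univ fun i _ => h i
  simpa using this

/-- The coefficient bounds carry `A⁻¹ h √A`, the fields `h √A`, so the area cancels; `141 = 3(12 +
35)`. Only `∇div v` enters, because the coefficients are moments of it. -/
lemma norm_opPhi_le (v : HGradDiv (cell T)) : ‖(opPhi T v : L2V (cell T))‖ ≤
    141 * Metric.diam (cell T) ^ 2 * ‖gradDiv v‖ := by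
  have hA := area_pos T
  have hs := Real.sq_sqrt hA.le
  rw [opPhi_apply, Submodule.coe_sum]
  refine (norm_sum_le_of_le_three _ fun i => (norm_add_le _ _).trans
    (add_le_add (norm_smul_le_of_le (abs_coefA_le T i v) (norm_fieldQ_le T i))
      (norm_smul_le_of_le (abs_coefB_le T i v) (norm_fieldW_le T i)))).trans (le_of_eq ?_)
  field_simp
  linear_combination 141 * Metric.diam (cell T) ^ 2 * ‖gradDiv v‖ * hs

/-- Here one factor `h` is replaced by `h/(2A)`, which leaves the shape parameter; `159 = 3(12 · 3/2
+ 35 · 2/2)`. -/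
lemma norm_gradDiv_opPhi_le (v : HGradDiv (cell T)) : ‖gradDiv (opPhi T v)‖ ≤
    159 * (Metric.diam (cell T) ^ 2 / area T) * ‖gradDiv v‖ := by
  have hA := area_pos T
  have hs := Real.sq_sqrt hA.le
  have e : gradDiv (opPhi T v) = ∑ i, (coefA T i v • gradDiv (ofSmooth T (fieldQ T i))
      + coefB T i v • gradDiv (ofSmooth T ((1 / 4 : ℝ) • fieldW T i))) :=
    map_opPhi T (gradDivLin T) v
  rw [e]
  refine (norm_sum_le_of_le_three _ fun i => (norm_add_le _ _).trans
    (add_le_add (norm_smul_le_of_le (abs_coefA_le T i v) (norm_gradDiv_fieldQ_le T i))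
      (norm_smul_le_of_le (abs_coefB_le T i v) (norm_gradDiv_fieldW_le T i)))).trans (le_of_eq ?_)
  field_simp
  rw [hs]
  ring

lemma abs_gradDivDuality_le (u v : HGradDiv (cell T)) : |gradDivDuality u v| ≤
    ‖(u : L2V (cell T))‖ * ‖gradDiv v‖ + ‖gradDiv u‖ * ‖(v : L2V (cell T))‖ := by
  refine (abs_sub _ _).trans (add_le_add ?_ ?_) <;> exact abs_real_inner_le_norm _ _

lemma norm_gradDiv_sub_le (v w : HGradDiv (cell T)) :
    ‖gradDiv (v - w)‖ ≤ ‖gradDiv v‖ + ‖gradDiv w‖ := by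
  have h : gradDiv (v - w) = gradDiv v - gradDiv w := (gradDivLin T).map_sub v w
  rw [h]
  exact norm_sub_le _ _

/-- The elementary inequality behind the bound of `opPsi`. -/
lemma opPsi_bound {κ D A s h nU gU nM d x y p q n g : ℝ} (hA : 0 < A) (hs : s ^ 2 = A)
    (hs0 : 0 ≤ s) (h0 : 0 ≤ h) (hg : 0 ≤ g) (hn : 0 ≤ n) (hx0 : 0 ≤ x) (hy0 : 0 ≤ y)
    (hnM0 : 0 ≤ nM) (hκ : h ^ 2 / A ≤ κ) (hD : h ≤ D)
    (hP : p ≤ 141 * h ^ 2 * g) (hG : q ≤ 159 * (h ^ 2 / A) * g) (hd : d ≤ nU * x + gU * y)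
    (h1 : x ≤ g + q) (h2 : y ≤ n + p) (hU : nU ≤ 15 * h * s)
    (hU' : gU ≤ 180 * (h / (2 * A)) * s) (hM : nM ≤ h * s) :
    p + 1 / (2 * A) * d * nM ≤ 45 * κ * n +
      (141 * D ^ 2 + 15 / 2 * D ^ 2 * (1 + 159 * κ) + 6345 * κ * D ^ 2) * g := by
  have hh : h ^ 2 ≤ D ^ 2 := pow_le_pow_left₀ h0 hD 2
  have hκ0 : 0 ≤ κ := le_trans (by positivity) hκ
  have hq : q ≤ 159 * κ * g := hG.trans (by gcongr)
  have hp : p ≤ 141 * D ^ 2 * g := hP.trans (by gcongr)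
  have hd2 : d ≤ 15 * h * s * ((1 + 159 * κ) * g) +
      180 * (h / (2 * A)) * s * (n + 141 * D ^ 2 * g) := by
    refine hd.trans (add_le_add (mul_le_mul hU ?_ hx0 (by positivity))
      (mul_le_mul hU' ?_ hy0 (by positivity))) <;> linarith
  have h3 : 1 / (2 * A) * d * nM ≤ 1 / (2 * A) * (15 * h * s * ((1 + 159 * κ) * g) +
      180 * (h / (2 * A)) * s * (n + 141 * D ^ 2 * g)) * (h * s) :=
    mul_le_mul (mul_le_mul_of_nonneg_left hd2 (by positivity)) hM hnM0 (by positivity)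
  -- Each term contains `s² = A`, which cancels the normalization. The part from `∇div v` scales
  -- like `h²`, the part from `v` like `h²/A`; the constant `6345` is `45 · 141`.
  have h4 : 1 / (2 * A) * (15 * h * s * ((1 + 159 * κ) * g) +
      180 * (h / (2 * A)) * s * (n + 141 * D ^ 2 * g)) * (h * s) =
      15 / 2 * h ^ 2 * ((1 + 159 * κ) * g) + 45 * (h ^ 2 / A) * (n + 141 * D ^ 2 * g) := by
    have e : s * s = A := by rw [← sq, hs]
    calc _ = 1 / (2 * A) * (15 * h * ((1 + 159 * κ) * g) +
          180 * (h / (2 * A)) * (n + 141 * D ^ 2 * g)) * h * (s * s) := by ring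
      _ = _ := by rw [e]; field_simp; ring
  have h5 : 15 / 2 * h ^ 2 * ((1 + 159 * κ) * g) + 45 * (h ^ 2 / A) * (n + 141 * D ^ 2 * g) ≤
      15 / 2 * D ^ 2 * ((1 + 159 * κ) * g) + 45 * κ * (n + 141 * D ^ 2 * g) := by gcongr
  linarith

lemma norm_opPsi_le {κ D : ℝ} (hκ : Metric.diam (cell T) ^ 2 / area T ≤ κ)
    (hD : Metric.diam (cell T) ≤ D) (v : HGradDiv (cell T)) : ‖(opPsi T v : L2V (cell T))‖ ≤
      45 * κ * ‖(v : L2V (cell T))‖ +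
        (141 * D ^ 2 + 15 / 2 * D ^ 2 * (1 + 159 * κ) + 6345 * κ * D ^ 2) * ‖gradDiv v‖ := by
  have hA := area_pos T
  rw [opPsi_apply, Submodule.coe_add, Submodule.coe_smul]
  refine (norm_add_le _ _).trans ?_
  rw [norm_smul, Real.norm_eq_abs, abs_mul, abs_neg, abs_of_pos (by positivity)]
  exact opPsi_bound hA (Real.sq_sqrt hA.le) (Real.sqrt_nonneg _) Metric.diam_nonneg
    (norm_nonneg _) (norm_nonneg _) (norm_nonneg _) (norm_nonneg _) (norm_nonneg _) hκ hD
    (norm_opPhi_le T v) (norm_gradDiv_opPhi_le T v)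
    (abs_gradDivDuality_le T (ofSmooth T (fieldU T)) (v - opPhi T v))
    (norm_gradDiv_sub_le T v (opPhi T v)) (norm_sub_le _ _) (norm_fieldU_le T)
    (norm_gradDiv_fieldU_le T) (norm_fieldM_le T)

lemma norm_smul_pairV_fieldC_le (k : Fin 2) (v : HGradDiv (cell T)) :
    ‖(1 / area T * pairV T (fieldC (EuclideanSpace.single k 1)) v) •
      (ofSmooth T (fieldC (EuclideanSpace.single k 1)) : L2V (cell T))‖ ≤ ‖(v : L2V (cell T))‖ := by
  have hA := area_pos T
  have hs := Real.sq_sqrt hA.le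
  have h1 := norm_fieldC_le T k
  have h2 : |1 / area T * pairV T (fieldC (EuclideanSpace.single k 1)) v| ≤
      1 / area T * (Real.sqrt (area T) * ‖(v : L2V (cell T))‖) := by
    rw [abs_mul, abs_of_pos (by positivity), pairV_apply]
    exact mul_le_mul_of_nonneg_left ((abs_real_inner_le_norm _ _).trans
      (mul_le_mul_of_nonneg_right h1 (norm_nonneg _))) (by positivity)
  refine (norm_smul_le_of_le h2 h1).trans (le_of_eq ?_)
  field_simp
  rw [hs]

/-- Each of the two constant corrections is bounded by `‖v - opPsi v‖`, so together they add at most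
`2‖v‖ + 2‖opPsi v‖`. -/
lemma norm_opPi_le (v : HGradDiv (cell T)) : ‖(opPi T v : L2V (cell T))‖ ≤
    2 * ‖(v : L2V (cell T))‖ + 3 * ‖(opPsi T v : L2V (cell T))‖ := by
  have h : (opPi T v : L2V (cell T)) = (opPsi T v : L2V (cell T)) + _ :=
    map_opPi T (HGradDiv (cell T)).subtype v
  have h0 : ‖((v - opPsi T v : HGradDiv (cell T)) : L2V (cell T))‖ ≤
      ‖(v : L2V (cell T))‖ + ‖(opPsi T v : L2V (cell T))‖ := norm_sub_le _ _
  have h1 (k : Fin 2) := (norm_smul_pairV_fieldC_le T k (v - opPsi T v)).trans h0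
  rw [h]
  refine (norm_add_le_of_le le_rfl (norm_sum_le_of_le Finset.univ fun k _ => h1 k)).trans
    (le_of_eq ?_)
  rw [Finset.sum_const, Finset.card_univ, Fintype.card_fin, nsmul_eq_mul, Nat.cast_ofNat]
  ring

lemma gradDivNorm_le_add (v : HGradDiv (cell T)) :
    gradDivNorm v ≤ ‖(v : L2V (cell T))‖ + ‖gradDiv v‖ := by
  have h1 := norm_nonneg (v : L2V (cell T))
  have h2 := norm_nonneg (gradDiv v)
  refine Real.sqrt_le_iff.2 ⟨by positivity, ?_⟩
  nlinarith

lemma norm_le_gradDivNorm (v : HGradDiv (cell T)) : ‖(v : L2V (cell T))‖ ≤ gradDivNorm v :=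
  Real.le_sqrt_of_sq_le (by nlinarith [sq_nonneg ‖gradDiv v‖])

lemma norm_gradDiv_le_gradDivNorm (v : HGradDiv (cell T)) : ‖gradDiv v‖ ≤ gradDivNorm v :=
  Real.le_sqrt_of_sq_le (by nlinarith [sq_nonneg ‖(v : L2V (cell T))‖])

/-- The bound of the Fortin operator for triangles with shape parameter at most `κ` and diameter
at most `D`. -/
def fortinBound (κ D : ℝ) : ℝ :=
  2 + 135 * κ + 3 * (141 * D ^ 2 + 15 / 2 * D ^ 2 * (1 + 159 * κ) + 6345 * κ * D ^ 2) + 159 * κ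

lemma gradDivNorm_opPi_le {κ D : ℝ} (hκ : Metric.diam (cell T) ^ 2 / area T ≤ κ)
    (hD : Metric.diam (cell T) ≤ D) (v : HGradDiv (cell T)) :
    gradDivNorm (opPi T v) ≤ fortinBound κ D * gradDivNorm v := by
  have hA := area_pos T
  have hκ0 : 0 ≤ κ := le_trans (by positivity) hκ
  have h1 := gradDivNorm_le_add T (opPi T v)
  have h2 := norm_opPi_le T v
  have h3 := norm_opPsi_le T hκ hD v
  have h4 : ‖gradDiv (opPi T v)‖ ≤ 159 * κ * ‖gradDiv v‖ := by
    rw [gradDiv_opPi]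
    exact (norm_gradDiv_opPhi_le T v).trans (by gcongr)
  have h5 := norm_le_gradDivNorm T v
  have h6 := norm_gradDiv_le_gradDivNorm T v
  have h7 := mul_le_mul_of_nonneg_left h5 (by positivity : 0 ≤ 2 + 135 * κ)
  have h8 := mul_le_mul_of_nonneg_left h6 (by positivity : 0 ≤
    3 * (141 * D ^ 2 + 15 / 2 * D ^ 2 * (1 + 159 * κ) + 6345 * κ * D ^ 2) + 159 * κ)
  rw [fortinBound]
  linarith

end

end GradDivFortin

/-! ### Assembly of the main theorem. -/

open GradDivFortin in
theorem mainTheorem7 (κ D : ℝ) :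
    ∃ C : ℝ, 0 < C ∧ ∀ T : Affine.Triangle ℝ Plane,
      Metric.diam (cell T) ^ 2 / volume.real (cell T) ≤ κ →
      Metric.diam (cell T) ≤ D →
      ∃ P : HGradDiv (cell T) →ₗ[ℝ] HGradDiv (cell T),
        (∀ v, (P v : L2V (cell T)) ∈ VecPoly 3 (cell T)) ∧
        (∀ w ∈ VecPoly 0 (cell T), ∀ v, ⟪w, ((v - P v : HGradDiv (cell T)) : L2V (cell T))⟫ = 0) ∧
        (∀ w ∈ VecPoly 0 (cell T), ∀ v, ⟪w, gradDiv (v - P v)⟫ = 0) ∧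
        (∀ (g₁ : Fin 3 → ℝ) (g₂ : Plane → ℝ), IsP1c T g₂ →
          (∃ u, HasGradDivTrace T u g₁ g₂) ∧
          ∀ u, HasGradDivTrace T u g₁ g₂ → ∀ v, gradDivDuality u (v - P v) = 0) ∧
        ∀ v, gradDivNorm (P v) ≤ C * gradDivNorm v := by
  -- Truncating `κ` at 0 makes the constant positive for all real parameters, since `D` enters only
  -- through its square.
  refine ⟨fortinBound (max κ 0) D, ?_, fun T hκ hD => ⟨opPi T, opPi_mem_vecPoly T,
    fun w hw v => inner_sub_opPi_eq_zero T hw v,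
    fun w hw v => inner_gradDiv_sub_opPi_eq_zero T hw v, fun g₁ g₂ hg => ?_,
    fun v => gradDivNorm_opPi_le T (hκ.trans (le_max_left κ 0)) hD v⟩⟩
  · have h : 0 ≤ max κ 0 := le_max_right κ 0
    rw [fortinBound]
    positivity
  · have h := hasGradDivTrace_traceField T (g₁ := g₁) hg
    refine ⟨⟨_, h⟩, fun u hu v => ?_⟩
    rw [gradDivDuality_congr T hu h]
    exact duality_traceField_sub_opPi T g₁ g₂ v
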